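/- Let $p\in C^1([0,1];(0,\infty))$, $r\in C^0([0,1];(0,\infty))$, $q\in C^0([0,1])$ and let $a_1,a_2,b_1,b_2\in\mathbb R$ with $|a_1|+|a_2|>0$, $|b_1|+|b_2|>0$. Let $L^2_r(0,1)$ be the space of (classes of) measurable functions on $[0,1]$ with $\|g\|_r^2=\int_0^1 r(x)|g(x)|^2dx<\infty$. Let $A$ be the Sturm–Liouville operator $$(Ag)(x)=-\frac1{r(x)}\frac{d}{dx}\Big(p(x)\frac{dg}{dx}(x)\Big)+\frac{q(x)}{r(x)}g(x)$$ with domain $D$, the set of $g\in H^2(0,1)$ with $b_1g(0)+b_2g'(0)=a_1g(1)+a_2g'(1)=0$. Let $\lambda_1<\lambda_2<\cdots$ be its eigenvalues and $\phi_n\in C^2([0,1])$ the corresponding eigenfunctions with $\|\phi_n\|_r=1$. Assume (H) $\sum_{n\ge N}\lambda_n^{-1}\max_{0\le x\le1}|\phi_n(x)|<\infty$ for some $N$ with $\lambda_N>0$. Below, $(\tau_i)_{i\ge0}$ always denotes a strictly increasing sequence with $\tau_0=0$ and $\tau_i\to+\infty$. $PC^1([0,1])$ is the class of continuous $g:[0,1]\to\mathbb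 R$ that have a finite right derivative at every point of $[0,1)$ and a finite left derivative at every point of $(0,1]$, and that are differentiable with continuous derivative on $(0,1)\setminus S$ for some finite $S\subset(0,1)$. Class $GD$: $f:\mathbb R_+\times[0,1]\to\mathbb R$ is in $GD$, with times $(\tau_i)$, if for every $i\ge1$ there are $f_1,f_2\in C^0((\tau_{i-1},\tau_i)\times[0,1])$, $a\in PC^1([0,1])$, $b\in C^0([0,1])$, $c\in D\cap C^2([0,1])$ such that, for $t\in(\tau_{i-1},\tau_i)$, $f_1(t,\cdot)\in PC^1([0,1])$, $f_2(t,\cdot)\in D\cap C^2([0,1])$ and $f(t,\cdot)=f_1(t,\cdot)+f_2(t,\cdot)$ on $[0,1]$; $\sup_{t\in(\tau_{i-1},\tau_i)}\int_0^1 r\,(|f_1(t,x)|^2+|f_2(t,x)|^2+|(Af_2(t,\cdot))(x)|^2)\,dx<\infty$; $\partial f_1/\partial t$ exists and is continuous on $(\tau_{i-1},\tau_i)\times[0,1]$; and, as $t\to\tau_i^-$, $f_1(t,x)\to a(x)$ and $f_2(t,x)\to c(x)$ for every $x\in[0,1]$, and $\frac{\partial f_1}{\partial t}(t,x)\to b(x)$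 uniformly in $x\in[0,1]$. Class $GB$: a right continuous $d:\mathbb R_+\to\mathbb R$ is in $GB$, with times $(\tau_i)$, if $d\in C^2(\mathbb R_+\setminus\{\tau_i\})$, the left limits of $d,\dot d,\ddot d$ at every $\tau_i$, $i\ge1$, exist and are finite, and $\sup_{(\tau_i,\tau_{i+1})}|\dot d|<\infty$ for every $i\ge0$. **Theorem.** Let $f\in GD$ and $d_0,d_1\in GB$. Then there is a sequence $(\tau_i)$ that serves for $f$, $d_0$ and $d_1$ simultaneously. For every such sequence, with $I=\mathbb R_+\setminus\{\tau_i: i\ge0\}$, and for every $u_0\in L^2_r(0,1)$, there is a unique $u:\mathbb R_+\times[0,1]\to\mathbb R$ such that: $t\mapsto u(t,\cdot)$ is continuous from $\mathbb R_+$ to $L^2_r(0,1)$; $u\in C^1(I\times[0,1])$; $u(t,\cdot)\in C^2([0,1])$ for all $t>0$; for all $i\ge1$ and $x\in[0,1]$, $$\lim_{t\to\tau_i^-}u(t,x)=u(\tau_i,x),\quad \lim_{t\to\tau_i^-}\frac{\partial u}{\partial x}(t,x)=\frac{\partial u}{\partial x}(\tau_i,x),\quad \lim_{t\to\tau_i^-}\frac{\partial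 u}{\partial t}(t,x)=-(Au(\tau_i,\cdot))(x)+\lim_{t\to\tau_i^-}f(t,x),$$ the limit of $f$ on the right existing; $u(0,x)=u_0(x)$ for all $x\in[0,1]$; $$\frac{\partial u}{\partial t}(t,x)-\frac1{r(x)}\frac{\partial}{\partial x}\Big(p(x)\frac{\partial u}{\partial x}(t,x)\Big)+\frac{q(x)}{r(x)}u(t,x)=f(t,x)\quad\text{for all }(t,x)\in I\times(0,1);$$ $$b_1u(t,0)+b_2\frac{\partial u}{\partial x}(t,0)-d_0(t)=a_1u(t,1)+a_2\frac{\partial u}{\partial x}(t,1)-d_1(t)=0\quad\text{for all }t\in I.$$ -/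

import Mathlib

open Set Filter Topology MeasureTheory

noncomputable section

namespace SLParabolic

/-- The data of a regular Sturm-Liouville operator on `[0,1]`: coefficients
`p ∈ C¹([0,1];(0,∞))`, `r ∈ C⁰([0,1];(0,∞))`, `q ∈ C⁰([0,1])` and nontrivial boundary constants.
Only the values of `p`, `q`, `r` on `[0,1]` matter. -/
structure SLData where
  p : ℝ → ℝ
  q : ℝ → ℝ
  r : ℝ → ℝ
  a₁ : ℝ
  a₂ : ℝ
  b₁ : ℝ
  b₂ : ℝ
  p_contDiff : ContDiffOn ℝ 1 p (Icc 0 1)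
  p_pos : ∀ x ∈ Icc (0 : ℝ) 1, 0 < p x
  r_cont : ContinuousOn r (Icc 0 1)
  r_pos : ∀ x ∈ Icc (0 : ℝ) 1, 0 < r x
  q_cont : ContinuousOn q (Icc 0 1)
  a_ne : 0 < |a₁| + |a₂|
  b_ne : 0 < |b₁| + |b₂|

/-- The derivative on `[0,1]` (one-sided at the end points). -/
def dx (g : ℝ → ℝ) (x : ℝ) : ℝ := derivWithin g (Icc 0 1) x

/-- `(A g)(x) = -(1/r(x)) (p g')'(x) + (q(x)/r(x)) g(x)` for `x ∈ [0,1]`. -/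
def SLData.op (A : SLData) (g : ℝ → ℝ) (x : ℝ) : ℝ :=
  -(1 / A.r x) * dx (fun y => A.p y * dx g y) x + A.q x / A.r x * g x

/-- The left boundary functional `b₁ g(0) + b₂ g'(0)`. -/
def SLData.bc0 (A : SLData) (g : ℝ → ℝ) : ℝ := A.b₁ * g 0 + A.b₂ * dx g 0

/-- The right boundary functional `a₁ g(1) + a₂ g'(1)`. -/
def SLData.bc1 (A : SLData) (g : ℝ → ℝ) : ℝ := A.a₁ * g 1 + A.a₂ * dx g 1

/-- Membership in `D ∩ C²([0,1])`, where `D` is the set of `H²(0,1)` functions satisfying the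
homogeneous boundary conditions. -/
def SLData.MemDC2 (A : SLData) (g : ℝ → ℝ) : Prop :=
  ContDiffOn ℝ 2 g (Icc 0 1) ∧ A.bc0 g = 0 ∧ A.bc1 g = 0

/-- The measure `r(x) dx` on `[0,1]`; `L²_r(0,1)` is the `L²` space of this measure. -/
def SLData.wt (A : SLData) : Measure ℝ :=
  (volume.restrict (Icc 0 1)).withDensity (fun x => ENNReal.ofReal (A.r x))

/-- `φ` is an eigenfunction of `A` for the eigenvalue `μ`, with `‖φ‖_r = 1`. -/
def SLData.IsEigenfunction (A : SLData) (μ : ℝ) (φ : ℝ → ℝ) : Prop :=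
  A.MemDC2 φ ∧ (∀ x ∈ Ioo (0 : ℝ) 1, A.op φ x = μ * φ x) ∧
    ∫ x in (0 : ℝ)..1, A.r x * φ x ^ 2 = 1

def SLData.IsEigenvalue (A : SLData) (μ : ℝ) : Prop := ∃ φ, A.IsEigenfunction μ φ

/-- Assumption (H): `∑_{n ≥ N} λ_n⁻¹ max_{[0,1]} |φ_n| < ∞` for some `N` with `λ_N > 0`.
The eigenvalues `λ_1 < λ_2 < ⋯` are simple, so the sum over `n ≥ N` is the sum over all
eigenvalues `μ ≥ Λ := λ_N`; `φ μ` is the normalized eigenfunction (unique up to sign) of `μ`. -/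
def SLData.AssumptionH (A : SLData) : Prop :=
  ∃ φ : ℝ → ℝ → ℝ, (∀ μ, A.IsEigenvalue μ → A.IsEigenfunction μ (φ μ)) ∧
    ∃ Λ : ℝ, A.IsEigenvalue Λ ∧ 0 < Λ ∧
      Summable (fun μ : {μ : ℝ // A.IsEigenvalue μ ∧ Λ ≤ μ} =>
        (μ : ℝ)⁻¹ * sSup ((fun x => |φ μ x|) '' Icc 0 1))

/-- The class `PC¹([0,1])` of continuous, piecewise `C¹` functions. -/
def PC1 (g : ℝ → ℝ) : Prop :=
  ContinuousOn g (Icc 0 1) ∧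
  (∀ x ∈ Ico (0 : ℝ) 1, DifferentiableWithinAt ℝ g (Ici x) x) ∧
  (∀ x ∈ Ioc (0 : ℝ) 1, DifferentiableWithinAt ℝ g (Iic x) x) ∧
  ∃ S : Set ℝ, S.Finite ∧ S ⊆ Ioo 0 1 ∧
    (∀ x ∈ Ioo (0 : ℝ) 1 \ S, DifferentiableAt ℝ g x) ∧
    ContinuousOn (deriv g) (Ioo 0 1 \ S)

/-- Increasing sequences of times `0 = τ_0 < τ_1 < ⋯` tending to `+∞`. -/
def IsTimes (τ : ℕ → ℝ) : Prop := StrictMono τ ∧ τ 0 = 0 ∧ Tendsto τ atTop atTop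

/-- The set `I = ℝ₊ \ {τ_i : i = 0, 1, 2, …}`. -/
def offTimes (τ : ℕ → ℝ) : Set ℝ := Ici 0 \ range τ

/-- The requirements of the class `GD` on the time interval `(s, T)`. The left limit of
`∂f₁/∂t` at `T` is uniform in `x ∈ [0,1]`. -/
def SLData.GDOn (A : SLData) (s T : ℝ) (f : ℝ → ℝ → ℝ) : Prop :=
  ∃ (f₁ f₂ : ℝ → ℝ → ℝ) (a b c : ℝ → ℝ),
    ContinuousOn (fun z : ℝ × ℝ => f₁ z.1 z.2) (Ioo s T ×ˢ Icc 0 1) ∧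
    ContinuousOn (fun z : ℝ × ℝ => f₂ z.1 z.2) (Ioo s T ×ˢ Icc 0 1) ∧
    PC1 a ∧ ContinuousOn b (Icc 0 1) ∧ A.MemDC2 c ∧
    (∀ t ∈ Ioo s T, PC1 (f₁ t) ∧ A.MemDC2 (f₂ t)) ∧
    (∀ t ∈ Ioo s T, ∀ x ∈ Icc (0 : ℝ) 1, f t x = f₁ t x + f₂ t x) ∧
    (∃ M : ℝ, ∀ t ∈ Ioo s T,
      ∫ x in (0 : ℝ)..1, A.r x * (|f₁ t x| ^ 2 + |f₂ t x| ^ 2 + |A.op (f₂ t) x| ^ 2) ≤ M) ∧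
    (∀ t ∈ Ioo s T, ∀ x ∈ Icc (0 : ℝ) 1, DifferentiableAt ℝ (fun s' => f₁ s' x) t) ∧
    ContinuousOn (fun z : ℝ × ℝ => deriv (fun s' => f₁ s' z.2) z.1) (Ioo s T ×ˢ Icc 0 1) ∧
    (∀ x ∈ Icc (0 : ℝ) 1, Tendsto (fun t => f₁ t x) (𝓝[<] T) (𝓝 (a x))) ∧
    TendstoUniformlyOn (fun t x => deriv (fun s' => f₁ s' x) t) b (𝓝[<] T) (Icc 0 1) ∧
    (∀ x ∈ Icc (0 : ℝ) 1, Tendsto (fun t => f₂ t x) (𝓝[<] T) (𝓝 (c x)))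

/-- `f` satisfies the requirements of the class `GD` with the sequence of times `τ`. -/
def SLData.GDAlong (A : SLData) (τ : ℕ → ℝ) (f : ℝ → ℝ → ℝ) : Prop :=
  ∀ i, A.GDOn (τ i) (τ (i + 1)) f

/-- The class `GD`. -/
def SLData.GD (A : SLData) (f : ℝ → ℝ → ℝ) : Prop := ∃ τ, IsTimes τ ∧ A.GDAlong τ f

/-- `d` satisfies the requirements of the class `GB` with the sequence of times `τ`. -/
def GBAlong (τ : ℕ → ℝ) (d : ℝ → ℝ) : Prop :=
  (∀ t, 0 ≤ t → ContinuousWithinAt d (Ici t) t) ∧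
  ContDiffOn ℝ 2 d (offTimes τ) ∧
  (∀ i, 1 ≤ i → (∃ L, Tendsto d (𝓝[<] (τ i)) (𝓝 L)) ∧
    (∃ L, Tendsto (deriv d) (𝓝[<] (τ i)) (𝓝 L)) ∧
    (∃ L, Tendsto (deriv (deriv d)) (𝓝[<] (τ i)) (𝓝 L))) ∧
  (∀ i, ∃ M : ℝ, ∀ t ∈ Ioo (τ i) (τ (i + 1)), |deriv d t| ≤ M)

/-- The class `GB`. -/
def GB (d : ℝ → ℝ) : Prop := ∃ τ, IsTimes τ ∧ GBAlong τ d

/-- `τ` is a sequence of times that serves for `f ∈ GD` and `d₀, d₁ ∈ GB` at the same time. -/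
def SLData.Admissible (A : SLData) (τ : ℕ → ℝ) (f : ℝ → ℝ → ℝ) (d₀ d₁ : ℝ → ℝ) : Prop :=
  IsTimes τ ∧ A.GDAlong τ f ∧ GBAlong τ d₀ ∧ GBAlong τ d₁

/-- `u ∈ C⁰(ℝ₊; L²_r(0,1))`. -/
def SLData.ContL2 (A : SLData) (u : ℝ → ℝ → ℝ) : Prop :=
  (∀ t, 0 ≤ t → MemLp (u t) 2 A.wt) ∧
  ∀ t₀, 0 ≤ t₀ → Tendsto (fun t => eLpNorm (u t - u t₀) 2 A.wt) (𝓝[Ici 0] t₀) (𝓝 0)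

/-- `u` solves the initial-boundary value problem with inputs `f, d₀, d₁`, switching times `τ`
and initial state `u₀`. Only the values of `u` on `[0,∞) × [0,1]` matter. -/
structure SLData.IsSolution (A : SLData) (τ : ℕ → ℝ) (f : ℝ → ℝ → ℝ) (d₀ d₁ : ℝ → ℝ)
    (u₀ : ℝ → ℝ) (u : ℝ → ℝ → ℝ) : Prop where
  contL2 : A.ContL2 u
  contDiff_one : ContDiffOn ℝ 1 (fun z : ℝ × ℝ => u z.1 z.2) (offTimes τ ×ˢ Icc 0 1)
  contDiff_two : ∀ t, 0 < t → ContDiffOn ℝ 2 (u t) (Icc 0 1)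
  left_limit : ∀ i, 1 ≤ i → ∀ x ∈ Icc (0 : ℝ) 1,
    Tendsto (fun t => u t x) (𝓝[<] (τ i)) (𝓝 (u (τ i) x))
  left_limit_dt : ∀ i, 1 ≤ i → ∀ x ∈ Icc (0 : ℝ) 1,
    ∃ L, Tendsto (fun t => f t x) (𝓝[<] (τ i)) (𝓝 L) ∧
      Tendsto (fun t => deriv (fun s => u s x) t) (𝓝[<] (τ i)) (𝓝 (-A.op (u (τ i)) x + L))
  left_limit_dx : ∀ i, 1 ≤ i → ∀ x ∈ Icc (0 : ℝ) 1,
    Tendsto (fun t => dx (u t) x) (𝓝[<] (τ i)) (𝓝 (dx (u (τ i)) x))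
  initial : ∀ x ∈ Icc (0 : ℝ) 1, u 0 x = u₀ x
  pde : ∀ t ∈ offTimes τ, ∀ x ∈ Ioo (0 : ℝ) 1,
    deriv (fun s => u s x) t - 1 / A.r x * dx (fun y => A.p y * dx (u t) y) x
      + A.q x / A.r x * u t x = f t x
  boundary : ∀ t ∈ offTimes τ, A.bc0 (u t) - d₀ t = 0 ∧ A.bc1 (u t) - d₁ t = 0

end SLParabolic

end

/-!
For `κ` below the spectrum of `A` the resolvent `(A - κ)⁻¹` is an integral operator whose kernel,
the Green function, is continuous. It is compact, self-adjoint and injective on `L²_r(0,1)`, so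
the eigenfunctions form a Hilbert basis. After subtracting a lift of the boundary data, the
coefficient `c` of a solution along an eigenfunction for the eigenvalue `μ` solves `c' = -μ c +
⟨f, φ_μ⟩`. Since `f` is the sum of a part differentiable in time and a part with values in the
domain of `A`, `c` and `c'` are `O(1 / (μ - κ))` away from the initial time, and by (H) the
eigenfunction series for `u` and `u_t` converge uniformly. The regularity in space comes from `u =
(A - κ)⁻¹ (f - u_t - κ u)`. These solutions extend to the right end points of the time intervals,
where the next ones start. Conversely, the coefficients of the difference of two solutions satisfy
the homogeneous equation and vanish at time `0`.
-/

noncomputable section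

namespace SLParabolic

/-! ### Linear systems and calculus on the unit interval -/

/-- Truncation of a real number to `[-R, R]`, used to make linear vector fields bounded. -/
def clamp (R y : ℝ) : ℝ := max (-R) (min R y)

lemma abs_clamp_sub_le (R y z : ℝ) : |clamp R y - clamp R z| ≤ |y - z| := by
  refine (abs_max_sub_max_le_max _ _ _ _).trans (max_le (by simp) ?_)
  exact (abs_min_sub_min_le_max _ _ _ _).trans (max_le (by simp) le_rfl)

lemma abs_clamp_le {R : ℝ} (hR : 0 ≤ R) (y : ℝ) : |clamp R y| ≤ R :=
  abs_le.2 ⟨le_max_left _ _, max_le (by linarith) (min_le_left _ _)⟩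

lemma clamp_eq_self {R y : ℝ} (h : |y| ≤ R) : clamp R y = y := by
  rw [clamp, min_eq_right (abs_le.1 h).2, max_eq_right (abs_le.1 h).1]

lemma abs_clamp_le_abs {R : ℝ} (hR : 0 ≤ R) (y : ℝ) : |clamp R y| ≤ |y| := by
  have h0 : clamp R 0 = 0 := clamp_eq_self (by simpa using hR)
  simpa [h0] using abs_clamp_sub_le R y 0

lemma exists_abs_le_of_continuousOn {g : ℝ → ℝ} {a b : ℝ} (hg : ContinuousOn g (Icc a b)) :
    ∃ C, 0 < C ∧ ∀ x ∈ Icc a b, |g x| ≤ C := by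
  obtain ⟨C, hC⟩ := isCompact_Icc.exists_bound_of_continuousOn hg
  exact ⟨max C 1, by positivity, fun x hx => (hC x hx).trans (le_max_left _ _)⟩

lemma exists_hasDerivWithinAt_of_bounded_lipschitz {E : Type*} [NormedAddCommGroup E]
    [NormedSpace ℝ E] [CompleteSpace E] {v : ℝ → E → E} {K L a b : ℝ} (hab : a ≤ b) (hK : 0 ≤ K)
    (hcont : ∀ w, ContinuousOn (fun t => v t w) (Icc a b))
    (hlip : ∀ t ∈ Icc a b, ∀ w w', ‖v t w - v t w'‖ ≤ K * ‖w - w'‖)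
    (hbdd : ∀ t ∈ Icc a b, ∀ w, ‖v t w‖ ≤ L) (w₀ : E) :
    ∃ φ : ℝ → E, φ a = w₀ ∧ ∀ t ∈ Icc a b, HasDerivWithinAt φ (v t (φ t)) (Icc a b) t := by
  have hL : 0 ≤ L := (norm_nonneg _).trans (hbdd a (left_mem_Icc.2 hab) w₀)
  have hPL : IsPicardLindelof v (⟨a, left_mem_Icc.2 hab⟩ : Icc a b) w₀
      ⟨L * (b - a), mul_nonneg hL (sub_nonneg.2 hab)⟩ 0 ⟨L, hL⟩ ⟨K, hK⟩ := by
    refine ⟨fun t ht => ?_, fun w _ => hcont w, fun t ht w _ => hbdd t ht w, ?_⟩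
    · refine LipschitzOnWith.of_dist_le_mul fun w _ w' _ => ?_
      rw [dist_eq_norm, dist_eq_norm]
      exact hlip t ht w w'
    · change L * max (b - a) (a - a) ≤ L * (b - a) - 0
      simp [hab]
  exact hPL.exists_eq_forall_mem_Icc_hasDerivWithinAt₀

lemma norm_swap_mul_le {K a b a' b' : ℝ} {w : ℝ × ℝ} (hK : 0 ≤ K) (ha : |a| ≤ K) (hb : |b| ≤ K)
    (ha' : |a'| ≤ |w.2|) (hb' : |b'| ≤ |w.1|) : ‖((a * a', b * b') : ℝ × ℝ)‖ ≤ K * ‖w‖ := by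
  simp only [Prod.norm_def, Real.norm_eq_abs, abs_mul]
  exact max_le (mul_le_mul ha (ha'.trans (le_max_right _ _)) (abs_nonneg _) hK)
    (mul_le_mul hb (hb'.trans (le_max_left _ _)) (abs_nonneg _) hK)

section LinearSystem

variable {α β : ℝ → ℝ}

lemma exists_abs_le_of_continuousOn_pair (hα : ContinuousOn α (Icc 0 1))
    (hβ : ContinuousOn β (Icc 0 1)) :
    ∃ K, 0 < K ∧ ∀ x ∈ Icc (0 : ℝ) 1, |α x| ≤ K ∧ |β x| ≤ K := by
  obtain ⟨K₁, hK₁, hαK⟩ := exists_abs_le_of_continuousOn hα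
  obtain ⟨K₂, -, hβK⟩ := exists_abs_le_of_continuousOn hβ
  exact ⟨max K₁ K₂, lt_max_of_lt_left hK₁, fun x hx =>
    ⟨(hαK x hx).trans (le_max_left _ _), (hβK x hx).trans (le_max_right _ _)⟩⟩

lemma norm_le_of_norm_deriv_le {E : Type*} [NormedAddCommGroup E] [NormedSpace ℝ E]
    {φ φ' : ℝ → E} {K : ℝ} (hK : 0 ≤ K)
    (hφ : ∀ t ∈ Icc (0 : ℝ) 1, HasDerivWithinAt φ (φ' t) (Icc 0 1) t)
    (hφ' : ∀ t ∈ Icc (0 : ℝ) 1, ‖φ' t‖ ≤ K * ‖φ t‖) :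
    ∀ t ∈ Icc (0 : ℝ) 1, ‖φ t‖ ≤ ‖φ 0‖ * Real.exp K := by
  intro t ht
  have hgronwall : ‖φ t‖ ≤ gronwallBound ‖φ 0‖ K 0 (t - 0) :=
    norm_le_gronwallBound_of_norm_deriv_right_le (fun t ht => (hφ t ht).continuousWithinAt)
      (fun x hx => (hφ x (Ico_subset_Icc_self hx)).mono_of_mem_nhdsWithin
        (Icc_mem_nhdsGE_of_mem hx)) le_rfl
      (fun x hx => by simpa using hφ' x (Ico_subset_Icc_self hx)) t ht
  rw [gronwallBound_ε0, sub_zero] at hgronwall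
  refine hgronwall.trans (mul_le_mul_of_nonneg_left (Real.exp_le_exp.2 ?_) (norm_nonneg _))
  exact mul_le_of_le_one_right hK ht.2

lemma exists_linearSystem (hα : ContinuousOn α (Icc 0 1)) (hβ : ContinuousOn β (Icc 0 1))
    (y₀ z₀ : ℝ) :
    ∃ y z : ℝ → ℝ, y 0 = y₀ ∧ z 0 = z₀ ∧ ∀ x ∈ Icc (0 : ℝ) 1,
      HasDerivWithinAt y (α x * z x) (Icc 0 1) x ∧
      HasDerivWithinAt z (β x * y x) (Icc 0 1) x := by
  obtain ⟨K, hK, hαβ⟩ := exists_abs_le_of_continuousOn_pair hα hβ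
  -- By Grönwall a solution stays within distance `R` of the origin, where the truncation is inert.
  set R := ‖(y₀, z₀)‖ * Real.exp K
  have hR : 0 ≤ R := by positivity
  let v : ℝ → ℝ × ℝ → ℝ × ℝ := fun t w => (α t * clamp R w.2, β t * clamp R w.1)
  have hlip : ∀ t ∈ Icc (0 : ℝ) 1, ∀ w w', ‖v t w - v t w'‖ ≤ K * ‖w - w'‖ := fun t ht w w' => by
    simp only [v, Prod.mk_sub_mk, ← mul_sub]
    exact norm_swap_mul_le hK.le (hαβ t ht).1 (hαβ t ht).2 (abs_clamp_sub_le _ _ _)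
      (abs_clamp_sub_le _ _ _)
  have hbdd : ∀ t ∈ Icc (0 : ℝ) 1, ∀ w, ‖v t w‖ ≤ K * ‖((R, R) : ℝ × ℝ)‖ := fun t ht w =>
    norm_swap_mul_le hK.le (hαβ t ht).1 (hαβ t ht).2
      ((abs_clamp_le hR _).trans (le_abs_self R)) ((abs_clamp_le hR _).trans (le_abs_self R))
  obtain ⟨φ, hφ0, hφ⟩ := exists_hasDerivWithinAt_of_bounded_lipschitz (v := v) zero_le_one hK.le
    (fun w => (hα.mul continuousOn_const).prodMk (hβ.mul continuousOn_const)) hlip hbdd (y₀, z₀)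
  have hφR : ∀ t ∈ Icc (0 : ℝ) 1, ‖φ t‖ ≤ R := by
    simpa only [hφ0] using norm_le_of_norm_deriv_le hK.le hφ fun t ht =>
      norm_swap_mul_le hK.le (hαβ t ht).1 (hαβ t ht).2 (abs_clamp_le_abs hR _)
        (abs_clamp_le_abs hR _)
  refine ⟨fun t => (φ t).1, fun t => (φ t).2, by simp [hφ0], by simp [hφ0], fun t ht => ?_⟩
  have h := hφ t ht
  simp only [v, clamp_eq_self ((norm_fst_le (φ t)).trans (hφR t ht)),
    clamp_eq_self ((norm_snd_le (φ t)).trans (hφR t ht))] at h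
  exact ⟨h.fst, h.snd⟩

lemma exists_linearSystem_right (hα : ContinuousOn α (Icc 0 1)) (hβ : ContinuousOn β (Icc 0 1))
    (y₁ z₁ : ℝ) :
    ∃ y z : ℝ → ℝ, y 1 = y₁ ∧ z 1 = z₁ ∧ ∀ x ∈ Icc (0 : ℝ) 1,
      HasDerivWithinAt y (α x * z x) (Icc 0 1) x ∧
      HasDerivWithinAt z (β x * y x) (Icc 0 1) x := by
  have hmaps : MapsTo (fun x : ℝ => 1 - x) (Icc 0 1) (Icc 0 1) := fun x hx =>
    ⟨by linarith [hx.2], by linarith [hx.1]⟩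
  have hcont : ContinuousOn (fun x : ℝ => 1 - x) (Icc 0 1) := by fun_prop
  obtain ⟨y, z, hy, hz, h⟩ := exists_linearSystem (hα.comp hcont hmaps) (hβ.comp hcont hmaps)
    y₁ (-z₁)
  refine ⟨fun x => y (1 - x), fun x => -z (1 - x), by simpa using hy, by simp [hz], fun x hx => ?_⟩
  have hd : HasDerivWithinAt (fun x : ℝ => 1 - x) (-1) (Icc 0 1) x := by
    simpa using (hasDerivWithinAt_id x (Icc (0 : ℝ) 1)).const_sub 1
  obtain ⟨hy', hz'⟩ := h (1 - x) (hmaps hx)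
  exact ⟨(hy'.scomp x hd hmaps).congr_deriv (by simp),
    (hz'.scomp x hd hmaps).neg.congr_deriv (by simp)⟩

lemma linearSystem_eq_zero {y z : ℝ → ℝ} (hα : ContinuousOn α (Icc 0 1))
    (hβ : ContinuousOn β (Icc 0 1)) (hy0 : y 0 = 0) (hz0 : z 0 = 0)
    (hy : ∀ x ∈ Icc (0 : ℝ) 1, HasDerivWithinAt y (α x * z x) (Icc 0 1) x)
    (hz : ∀ x ∈ Icc (0 : ℝ) 1, HasDerivWithinAt z (β x * y x) (Icc 0 1) x) :
    ∀ x ∈ Icc (0 : ℝ) 1, y x = 0 ∧ z x = 0 := by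
  obtain ⟨K, hK, hαβ⟩ := exists_abs_le_of_continuousOn_pair hα hβ
  intro x hx
  have h := norm_le_of_norm_deriv_le (φ := fun t => (y t, z t)) hK.le
    (fun t ht => (hy t ht).prodMk (hz t ht))
    (fun t ht => norm_swap_mul_le hK.le (hαβ t ht).1 (hαβ t ht).2 le_rfl le_rfl) x hx
  simp only [hy0, hz0, Prod.mk_zero_zero, norm_zero, zero_mul, norm_le_zero_iff] at h
  exact Prod.mk_eq_zero.1 h

end LinearSystem

section UnitInterval

lemma uniqueDiffOn_unit : UniqueDiffOn ℝ (Icc (0 : ℝ) 1) := uniqueDiffOn_Icc zero_lt_one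

lemma dx_eq {g : ℝ → ℝ} {g' x : ℝ} (hx : x ∈ Icc (0 : ℝ) 1)
    (h : HasDerivWithinAt g g' (Icc 0 1) x) : dx g x = g' :=
  h.derivWithin (uniqueDiffOn_unit x hx)

lemma dx_congr {g h : ℝ → ℝ} (H : EqOn g h (Icc 0 1)) {x : ℝ} (hx : x ∈ Icc (0 : ℝ) 1) :
    dx g x = dx h x :=
  derivWithin_congr H (H hx)

lemma hasDerivWithinAt_dx {g : ℝ → ℝ} (hg : ContDiffOn ℝ 1 g (Icc 0 1)) {x : ℝ}
    (hx : x ∈ Icc (0 : ℝ) 1) : HasDerivWithinAt g (dx g x) (Icc 0 1) x :=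
  ((hg.differentiableOn one_ne_zero) x hx).hasDerivWithinAt

lemma continuousOn_dx {g : ℝ → ℝ} (hg : ContDiffOn ℝ 1 g (Icc 0 1)) :
    ContinuousOn (dx g) (Icc 0 1) :=
  hg.continuousOn_derivWithin uniqueDiffOn_unit le_rfl

lemma contDiffOn_dx {g : ℝ → ℝ} (hg : ContDiffOn ℝ 2 g (Icc 0 1)) :
    ContDiffOn ℝ 1 (dx g) (Icc 0 1) :=
  hg.derivWithin uniqueDiffOn_unit (by norm_num)

lemma contDiffOn_succ_of_hasDerivWithinAt {g g' : ℝ → ℝ} {n : ℕ}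
    (h : ∀ x ∈ Icc (0 : ℝ) 1, HasDerivWithinAt g (g' x) (Icc 0 1) x)
    (hg' : ContDiffOn ℝ n g' (Icc 0 1)) : ContDiffOn ℝ (n + 1) g (Icc 0 1) :=
  (contDiffOn_succ_iff_derivWithin uniqueDiffOn_unit).2
    ⟨fun x hx => (h x hx).differentiableWithinAt, by simp, hg'.congr fun x hx => dx_eq hx (h x hx)⟩

lemma contDiffOn_one_of_hasDerivWithinAt {g g' : ℝ → ℝ}
    (h : ∀ x ∈ Icc (0 : ℝ) 1, HasDerivWithinAt g (g' x) (Icc 0 1) x)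
    (hg' : ContinuousOn g' (Icc 0 1)) : ContDiffOn ℝ 1 g (Icc 0 1) := by
  simpa using contDiffOn_succ_of_hasDerivWithinAt (n := 0) h (contDiffOn_zero.2 hg')

lemma contDiffOn_two_of_hasDerivWithinAt {g g' : ℝ → ℝ}
    (h : ∀ x ∈ Icc (0 : ℝ) 1, HasDerivWithinAt g (g' x) (Icc 0 1) x)
    (hg' : ContDiffOn ℝ 1 g' (Icc 0 1)) : ContDiffOn ℝ 2 g (Icc 0 1) :=
  (contDiffOn_succ_of_hasDerivWithinAt (n := 1) h hg').of_le (by norm_num)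

lemma intervalIntegrable_of_continuousOn {g : ℝ → ℝ} (hg : ContinuousOn g (Icc 0 1)) {a b : ℝ}
    (ha : a ∈ Icc (0 : ℝ) 1) (hb : b ∈ Icc (0 : ℝ) 1) : IntervalIntegrable g volume a b :=
  (hg.mono (uIcc_subset_Icc ha hb)).intervalIntegrable

lemma hasDerivWithinAt_integral {g : ℝ → ℝ} (hg : ContinuousOn g (Icc 0 1)) {x : ℝ}
    (hx : x ∈ Icc (0 : ℝ) 1) :
    HasDerivWithinAt (fun x => ∫ y in (0 : ℝ)..x, g y) (g x) (Icc 0 1) x :=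
  haveI : Fact (x ∈ Icc (0 : ℝ) 1) := ⟨hx⟩
  intervalIntegral.integral_hasDerivWithinAt_right
    (intervalIntegrable_of_continuousOn hg (left_mem_Icc.2 zero_le_one) hx)
    (hg.stronglyMeasurableAtFilter_nhdsWithin measurableSet_Icc x) (hg x hx)

lemma hasDerivWithinAt_integral_right {g : ℝ → ℝ} (hg : ContinuousOn g (Icc 0 1)) {x : ℝ}
    (hx : x ∈ Icc (0 : ℝ) 1) :
    HasDerivWithinAt (fun x => ∫ y in x..(1 : ℝ), g y) (-g x) (Icc 0 1) x :=
  haveI : Fact (x ∈ Icc (0 : ℝ) 1) := ⟨hx⟩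
  intervalIntegral.integral_hasDerivWithinAt_left
    (intervalIntegrable_of_continuousOn hg hx (right_mem_Icc.2 zero_le_one))
    (hg.stronglyMeasurableAtFilter_nhdsWithin measurableSet_Icc x) (hg x hx)

lemma eqOn_Icc_of_Ioo {g h : ℝ → ℝ} (hg : ContinuousOn g (Icc 0 1))
    (hh : ContinuousOn h (Icc 0 1)) (H : ∀ x ∈ Ioo (0 : ℝ) 1, g x = h x) :
    ∀ x ∈ Icc (0 : ℝ) 1, g x = h x :=
  EqOn.of_subset_closure (s := Ioo (0 : ℝ) 1) H hg hh Ioo_subset_Icc_self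
    (by rw [closure_Ioo zero_ne_one])

lemma deriv_eq_zero_of_nonneg_of_endpoints {E E' : ℝ → ℝ}
    (hE : ∀ x ∈ Icc (0 : ℝ) 1, HasDerivWithinAt E (E' x) (Icc 0 1) x)
    (hE' : ∀ x ∈ Icc (0 : ℝ) 1, 0 ≤ E' x) (hE0 : E 0 = 0) (hE1 : E 1 = 0) :
    ∀ x ∈ Icc (0 : ℝ) 1, E' x = 0 := by
  have hmono : MonotoneOn E (Icc 0 1) := by
    have hd : ∀ x ∈ interior (Icc (0 : ℝ) 1), HasDerivAt E (E' x) x ∧ 0 ≤ E' x := fun x hx => by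
      rw [interior_Icc] at hx
      exact ⟨(hE x (Ioo_subset_Icc_self hx)).hasDerivAt (Icc_mem_nhds hx.1 hx.2),
        hE' x (Ioo_subset_Icc_self hx)⟩
    exact monotoneOn_of_deriv_nonneg (convex_Icc 0 1) (fun x hx => (hE x hx).continuousWithinAt)
      (fun x hx => (hd x hx).1.differentiableAt.differentiableWithinAt)
      (fun x hx => (hd x hx).1.deriv ▸ (hd x hx).2)
  have hzero : EqOn E (fun _ => 0) (Icc 0 1) := fun y hy =>
    le_antisymm (hE1 ▸ hmono hy (by simp) hy.2) (hE0 ▸ hmono (by simp) hy hy.1)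
  intro x hx
  rw [← dx_eq hx (hE x hx), dx_congr hzero hx]
  exact dx_eq hx (hasDerivWithinAt_const _ _ _)

end UnitInterval

section BoundaryConstants

variable {c₁ c₂ u u' v v' : ℝ}

lemma ne_zero_or_ne_zero_of_abs_add_abs_pos (hc : 0 < |c₁| + |c₂|) : c₁ ≠ 0 ∨ c₂ ≠ 0 := by
  by_contra! h
  simp [h.1, h.2] at hc

lemma wronskian_eq_zero (hc : 0 < |c₁| + |c₂|) (hu : c₁ * u + c₂ * u' = 0)
    (hv : c₁ * v + c₂ * v' = 0) : u * v' - u' * v = 0 := by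
  rcases ne_zero_or_ne_zero_of_abs_add_abs_pos hc with h | h
  · apply mul_left_cancel₀ h
    linear_combination v' * hu - u' * hv
  · apply mul_left_cancel₀ h
    linear_combination u * hv - v * hu

-- For `c₂ = 0` (a Dirichlet condition) the junk value `c₁ / c₂ = 0` is harmless, as then `u = 0`.
lemma deriv_add_div_mul_mul_eq_zero (hc : 0 < |c₁| + |c₂|) (hu : c₁ * u + c₂ * u' = 0) :
    (u' + c₁ / c₂ * u) * u = 0 := by
  by_cases h2 : c₂ = 0
  · have h1 : c₁ ≠ 0 := (ne_zero_or_ne_zero_of_abs_add_abs_pos hc).resolve_right (by simp [h2])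
    have : u = 0 := by simpa [h2, h1] using hu
    simp [this]
  · field_simp
    linear_combination u * hu

end BoundaryConstants

namespace SLData

variable (A : SLData)

lemma p_ne {x : ℝ} (hx : x ∈ Icc (0 : ℝ) 1) : A.p x ≠ 0 := (A.p_pos x hx).ne'

lemma r_ne {x : ℝ} (hx : x ∈ Icc (0 : ℝ) 1) : A.r x ≠ 0 := (A.r_pos x hx).ne'

lemma continuousOn_inv_p : ContinuousOn (fun x => (A.p x)⁻¹) (Icc 0 1) :=
  A.p_contDiff.continuousOn.inv₀ fun _ hx => A.p_ne hx

/-- The flux `p g'` of `g`: `A g = κ g` is the first-order system for the pair of `g` and its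
flux. -/
def flux (g : ℝ → ℝ) (x : ℝ) : ℝ := A.p x * dx g x

variable {A}

lemma contDiffOn_flux {g : ℝ → ℝ} (hg : ContDiffOn ℝ 2 g (Icc 0 1)) :
    ContDiffOn ℝ 1 (A.flux g) (Icc 0 1) := A.p_contDiff.mul (contDiffOn_dx hg)

variable (A) in
lemma hasDerivWithinAt_of_flux {g : ℝ → ℝ} (hg : ContDiffOn ℝ 2 g (Icc 0 1)) {x : ℝ}
    (hx : x ∈ Icc (0 : ℝ) 1) : HasDerivWithinAt g ((A.p x)⁻¹ * A.flux g x) (Icc 0 1) x := by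
  have h := hasDerivWithinAt_dx (hg.of_le (by norm_num)) hx
  rwa [flux, inv_mul_cancel_left₀ (A.p_ne hx)]

lemma dx_flux_eq (g : ℝ → ℝ) {x : ℝ} (hx : x ∈ Icc (0 : ℝ) 1) :
    dx (A.flux g) x = A.q x * g x - A.r x * A.op g x := by
  have := A.r_ne hx
  unfold op flux
  field_simp
  ring

lemma hasDerivWithinAt_flux {g : ℝ → ℝ} (hg : ContDiffOn ℝ 2 g (Icc 0 1)) {x : ℝ}
    (hx : x ∈ Icc (0 : ℝ) 1) :
    HasDerivWithinAt (A.flux g) (A.q x * g x - A.r x * A.op g x) (Icc 0 1) x := by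
  rw [← dx_flux_eq g hx]
  exact hasDerivWithinAt_dx (contDiffOn_flux hg) hx

lemma continuousOn_op {g : ℝ → ℝ} (hg : ContDiffOn ℝ 2 g (Icc 0 1)) :
    ContinuousOn (A.op g) (Icc 0 1) := by
  have h1 : ContinuousOn (dx (A.flux g)) (Icc 0 1) := continuousOn_dx (contDiffOn_flux hg)
  have h2 := hg.continuousOn
  have h3 := A.r_cont.inv₀ fun _ hx => A.r_ne hx
  have : ContinuousOn (fun x => -(A.r x)⁻¹ * dx (A.flux g) x + A.q x * (A.r x)⁻¹ * g x)
    (Icc 0 1) := (h3.neg.mul h1).add ((A.q_cont.mul h3).mul h2)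
  refine this.congr fun x _ => ?_
  simp only [op, div_eq_mul_inv, one_mul]
  rfl

lemma contDiffOn_two_op_eq_of_flux {g z k : ℝ → ℝ}
    (hg : ∀ x ∈ Icc (0 : ℝ) 1, HasDerivWithinAt g ((A.p x)⁻¹ * z x) (Icc 0 1) x)
    (hz : ∀ x ∈ Icc (0 : ℝ) 1, HasDerivWithinAt z (A.q x * g x - A.r x * k x) (Icc 0 1) x)
    (hk : ContinuousOn k (Icc 0 1)) :
    ContDiffOn ℝ 2 g (Icc 0 1) ∧ ∀ x ∈ Icc (0 : ℝ) 1, A.op g x = k x := by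
  have hgc : ContinuousOn g (Icc 0 1) := fun x hx => (hg x hx).continuousWithinAt
  refine ⟨contDiffOn_two_of_hasDerivWithinAt hg ((A.p_contDiff.inv fun x hx => A.p_ne hx).mul
    (contDiffOn_one_of_hasDerivWithinAt hz ((A.q_cont.mul hgc).sub (A.r_cont.mul hk)))),
    fun x hx => ?_⟩
  have hflux : EqOn (A.flux g) z (Icc 0 1) := fun y hy => by
    rw [flux, dx_eq hy (hg y hy), mul_inv_cancel_left₀ (A.p_ne hy)]
  have := dx_flux_eq (A := A) g hx
  rw [dx_congr hflux hx, dx_eq hx (hz x hx)] at this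
  exact mul_left_cancel₀ (A.r_ne hx) (by linarith)

lemma op_congr {g h : ℝ → ℝ} (H : EqOn g h (Icc 0 1)) {x : ℝ} (hx : x ∈ Icc (0 : ℝ) 1) :
    A.op g x = A.op h x := by
  unfold op
  rw [dx_congr (h := fun y => A.p y * dx h y) (fun y hy => ?_) hx, H hx]
  exact congrArg (A.p y * ·) (dx_congr H hy)

lemma bc0_congr {g h : ℝ → ℝ} (H : EqOn g h (Icc 0 1)) : A.bc0 g = A.bc0 h := by
  unfold bc0
  rw [H (by simp), dx_congr H (by simp)]

lemma bc1_congr {g h : ℝ → ℝ} (H : EqOn g h (Icc 0 1)) : A.bc1 g = A.bc1 h := by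
  unfold bc1
  rw [H (by simp), dx_congr H (by simp)]

lemma dx_combo {g h : ℝ → ℝ} (hg : ContDiffOn ℝ 1 g (Icc 0 1)) (hh : ContDiffOn ℝ 1 h (Icc 0 1))
    (a b : ℝ) {x : ℝ} (hx : x ∈ Icc (0 : ℝ) 1) :
    dx (fun y => a * g y + b * h y) x = a * dx g x + b * dx h x :=
  dx_eq hx (((hasDerivWithinAt_dx hg hx).const_mul a).add ((hasDerivWithinAt_dx hh hx).const_mul b))

lemma op_combo {g h : ℝ → ℝ} (hg : ContDiffOn ℝ 2 g (Icc 0 1)) (hh : ContDiffOn ℝ 2 h (Icc 0 1))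
    (a b : ℝ) {x : ℝ} (hx : x ∈ Icc (0 : ℝ) 1) :
    A.op (fun y => a * g y + b * h y) x = a * A.op g x + b * A.op h x := by
  have h1 : dx (fun y => A.p y * dx (fun y => a * g y + b * h y) y) x
      = a * dx (A.flux g) x + b * dx (A.flux h) x := by
    rw [← dx_combo (contDiffOn_flux hg) (contDiffOn_flux hh) a b hx]
    refine dx_congr (fun y hy => ?_) hx
    simp only [flux]
    rw [dx_combo (hg.of_le (by norm_num)) (hh.of_le (by norm_num)) a b hy]
    ring
  unfold op
  rw [h1]
  unfold flux
  ring

lemma bc0_combo {g h : ℝ → ℝ} (hg : ContDiffOn ℝ 1 g (Icc 0 1)) (hh : ContDiffOn ℝ 1 h (Icc 0 1))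
    (a b : ℝ) : A.bc0 (fun y => a * g y + b * h y) = a * A.bc0 g + b * A.bc0 h := by
  unfold bc0
  rw [dx_combo hg hh a b (by simp)]
  ring

lemma bc1_combo {g h : ℝ → ℝ} (hg : ContDiffOn ℝ 1 g (Icc 0 1)) (hh : ContDiffOn ℝ 1 h (Icc 0 1))
    (a b : ℝ) : A.bc1 (fun y => a * g y + b * h y) = a * A.bc1 g + b * A.bc1 h := by
  unfold bc1
  rw [dx_combo hg hh a b (by simp)]
  ring

lemma MemDC2.combo {g h : ℝ → ℝ} (hg : A.MemDC2 g) (hh : A.MemDC2 h) (a b : ℝ) :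
    A.MemDC2 (fun y => a * g y + b * h y) := by
  refine ⟨(contDiffOn_const.mul hg.1).add (contDiffOn_const.mul hh.1), ?_, ?_⟩
  · rw [bc0_combo (hg.1.of_le (by norm_num)) (hh.1.of_le (by norm_num)), hg.2.1, hh.2.1]; ring
  · rw [bc1_combo (hg.1.of_le (by norm_num)) (hh.1.of_le (by norm_num)), hg.2.2, hh.2.2]; ring

lemma op_const_mul {g : ℝ → ℝ} (hg : ContDiffOn ℝ 2 g (Icc 0 1)) (a : ℝ) {x : ℝ}
    (hx : x ∈ Icc (0 : ℝ) 1) : A.op (fun y => a * g y) x = a * A.op g x := by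
  simpa using op_combo (A := A) hg hg a 0 hx

lemma bc0_const_mul {g : ℝ → ℝ} (hg : ContDiffOn ℝ 1 g (Icc 0 1)) (a : ℝ) :
    A.bc0 (fun y => a * g y) = a * A.bc0 g := by
  simpa using bc0_combo (A := A) hg hg a 0

lemma bc1_const_mul {g : ℝ → ℝ} (hg : ContDiffOn ℝ 1 g (Icc 0 1)) (a : ℝ) :
    A.bc1 (fun y => a * g y) = a * A.bc1 g := by
  simpa using bc1_combo (A := A) hg hg a 0

lemma MemDC2.const_mul {g : ℝ → ℝ} (hg : A.MemDC2 g) (a : ℝ) : A.MemDC2 (fun y => a * g y) := by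
  simpa using hg.combo hg a 0

lemma MemDC2.congr {g h : ℝ → ℝ} (hg : A.MemDC2 g) (H : EqOn h g (Icc 0 1)) : A.MemDC2 h :=
  ⟨hg.1.congr H, by rw [bc0_congr H, hg.2.1], by rw [bc1_congr H, hg.2.2]⟩

lemma IsEigenfunction.op_eq {μ : ℝ} {φ : ℝ → ℝ} (h : A.IsEigenfunction μ φ) :
    ∀ x ∈ Icc (0 : ℝ) 1, A.op φ x = μ * φ x :=
  eqOn_Icc_of_Ioo (continuousOn_op h.1.1) (continuousOn_const.mul h.1.1.continuousOn) h.2.1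

lemma eq_zero_of_cauchy {μ : ℝ} {g : ℝ → ℝ} (hg : ContDiffOn ℝ 2 g (Icc 0 1))
    (hop : ∀ x ∈ Icc (0 : ℝ) 1, A.op g x = μ * g x) (h0 : g 0 = 0) (h0' : dx g 0 = 0) :
    ∀ x ∈ Icc (0 : ℝ) 1, g x = 0 := by
  intro x hx
  refine (linearSystem_eq_zero (α := fun x => (A.p x)⁻¹) (β := fun x => A.q x - μ * A.r x)
    (y := g) (z := A.flux g) A.continuousOn_inv_p (A.q_cont.sub (continuousOn_const.mul A.r_cont))
    h0 (by simp [flux, h0']) (fun x hx => A.hasDerivWithinAt_of_flux hg hx) (fun x hx => ?_) x hx).1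
  refine (hasDerivWithinAt_flux hg hx).congr_deriv ?_
  rw [hop x hx]
  ring

lemma eigenspace_simple {μ : ℝ} {g h : ℝ → ℝ} (hg : A.MemDC2 g) (hh : A.MemDC2 h)
    (hgop : ∀ x ∈ Icc (0 : ℝ) 1, A.op g x = μ * g x)
    (hhop : ∀ x ∈ Icc (0 : ℝ) 1, A.op h x = μ * h x)
    (hne : ∃ x ∈ Icc (0 : ℝ) 1, h x ≠ 0) :
    ∃ a : ℝ, ∀ x ∈ Icc (0 : ℝ) 1, g x = a * h x := by
  have hcauchy : ∀ a b : ℝ, a * g 0 + b * h 0 = 0 → a * dx g 0 + b * dx h 0 = 0 →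
      ∀ x ∈ Icc (0 : ℝ) 1, a * g x + b * h x = 0 := by
    intro a b h0 h0'
    refine eq_zero_of_cauchy (A := A) (μ := μ) (g := fun y => a * g y + b * h y)
      (hg.combo hh a b).1 (fun x hx => ?_) h0 ?_
    · rw [op_combo hg.1 hh.1 a b hx, hgop x hx, hhop x hx]; ring
    · rwa [dx_combo (hg.1.of_le (by norm_num)) (hh.1.of_le (by norm_num)) a b (by simp)]
  have hwronskian : g 0 * dx h 0 - dx g 0 * h 0 = 0 := wronskian_eq_zero A.b_ne hg.2.1 hh.2.1
  have hne0 : h 0 ≠ 0 ∨ dx h 0 ≠ 0 := by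
    by_contra! hc
    obtain ⟨x, hx, hxne⟩ := hne
    exact hxne (eq_zero_of_cauchy hh.1 hhop hc.1 hc.2 x hx)
  rcases hne0 with h0 | h0
  · refine ⟨g 0 / h 0, fun x hx => ?_⟩
    have := hcauchy (h 0) (-g 0) (by ring) (by linear_combination -hwronskian) x hx
    field_simp
    linarith
  · refine ⟨dx g 0 / dx h 0, fun x hx => ?_⟩
    have := hcauchy (dx h 0) (-dx g 0) (by linear_combination hwronskian) (by ring) x hx
    field_simp
    linarith

-- Picone's trick: `σ` interpolates the boundary conditions, so that the boundary terms vanish.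
lemma hasDerivWithinAt_picone {g σ : ℝ → ℝ} {m x : ℝ} (hg : ContDiffOn ℝ 2 g (Icc 0 1))
    (hx : x ∈ Icc (0 : ℝ) 1) (hσ : HasDerivWithinAt σ m (Icc 0 1) x) :
    HasDerivWithinAt (fun x => (A.flux g x + σ x * g x) * g x)
      ((A.flux g x + σ x * g x) ^ 2 / A.p x +
        ((A.q x + m - σ x ^ 2 * (A.p x)⁻¹) * g x - A.r x * A.op g x) * g x) (Icc 0 1) x := by
  have hg' := A.hasDerivWithinAt_of_flux hg hx
  refine (((hasDerivWithinAt_flux hg hx).add (hσ.mul hg')).mul hg').congr_deriv ?_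
  have := A.p_ne hx
  simp only [Pi.add_apply, Pi.mul_apply]
  field_simp
  ring

lemma MemDC2.eq_zero_of_op_eq {g σ : ℝ → ℝ} {m μ : ℝ} (hg : A.MemDC2 g)
    (hop : ∀ x ∈ Icc (0 : ℝ) 1, A.op g x = μ * g x)
    (hσ : ∀ x ∈ Icc (0 : ℝ) 1, HasDerivWithinAt σ m (Icc 0 1) x)
    (hσ0 : σ 0 = A.p 0 * (A.b₁ / A.b₂)) (hσ1 : σ 1 = A.p 1 * (A.a₁ / A.a₂))
    (hμ : ∀ x ∈ Icc (0 : ℝ) 1, 0 < A.q x + m - σ x ^ 2 * (A.p x)⁻¹ - μ * A.r x) :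
    ∀ x ∈ Icc (0 : ℝ) 1, g x = 0 := by
  have hderiv : ∀ x ∈ Icc (0 : ℝ) 1, HasDerivWithinAt (fun x => (A.flux g x + σ x * g x) * g x)
      ((A.flux g x + σ x * g x) ^ 2 / A.p x +
        (A.q x + m - σ x ^ 2 * (A.p x)⁻¹ - μ * A.r x) * g x ^ 2) (Icc 0 1) x := fun x hx =>
    (hasDerivWithinAt_picone hg.1 hx (hσ x hx)).congr_deriv (by rw [hop x hx]; ring)
  have hsquare : ∀ x ∈ Icc (0 : ℝ) 1, 0 ≤ (A.flux g x + σ x * g x) ^ 2 / A.p x := fun x hx =>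
    div_nonneg (sq_nonneg _) (A.p_pos x hx).le
  have hpotential : ∀ x ∈ Icc (0 : ℝ) 1,
      0 ≤ (A.q x + m - σ x ^ 2 * (A.p x)⁻¹ - μ * A.r x) * g x ^ 2 := fun x hx =>
    mul_nonneg (hμ x hx).le (sq_nonneg _)
  have hzero := deriv_eq_zero_of_nonneg_of_endpoints hderiv
    (fun x hx => add_nonneg (hsquare x hx) (hpotential x hx))
    (by
      rw [flux, hσ0]
      linear_combination A.p 0 * deriv_add_div_mul_mul_eq_zero A.b_ne hg.2.1)
    (by
      rw [flux, hσ1]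
      linear_combination A.p 1 * deriv_add_div_mul_mul_eq_zero A.a_ne hg.2.2)
  intro x hx
  have hprod : (A.q x + m - σ x ^ 2 * (A.p x)⁻¹ - μ * A.r x) * g x ^ 2 = 0 := by
    linarith [hzero x hx, hsquare x hx, hpotential x hx]
  exact pow_eq_zero_iff two_ne_zero |>.1 ((mul_eq_zero.1 hprod).resolve_left (hμ x hx).ne')

variable (A)

lemma exists_lowerBound : ∃ κ₀ : ℝ, ∀ μ ≤ κ₀, ∀ g, A.MemDC2 g →
    (∀ x ∈ Icc (0 : ℝ) 1, A.op g x = μ * g x) → ∀ x ∈ Icc (0 : ℝ) 1, g x = 0 := by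
  set s₀ := A.p 0 * (A.b₁ / A.b₂)
  set s₁ := A.p 1 * (A.a₁ / A.a₂)
  let σ : ℝ → ℝ := fun x => s₀ + (s₁ - s₀) * x
  have hσ : ∀ x, HasDerivWithinAt σ (s₁ - s₀) (Icc 0 1) x := fun x =>
    (((hasDerivWithinAt_id x (Icc (0 : ℝ) 1)).const_mul (s₁ - s₀)).const_add s₀).congr_deriv
      (mul_one _)
  have hσc : ContinuousOn σ (Icc 0 1) := by fun_prop
  obtain ⟨C, -, hbd⟩ := exists_abs_le_of_continuousOn (a := 0) (b := 1)
    (g := fun x => (A.q x + (s₁ - s₀) - σ x ^ 2 * (A.p x)⁻¹) * (A.r x)⁻¹)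
    (((A.q_cont.add continuousOn_const).sub ((hσc.pow 2).mul A.continuousOn_inv_p)).mul
      (A.r_cont.inv₀ fun _ hx => A.r_ne hx))
  refine ⟨-C - 1, fun μ hμ g hg hop => hg.eq_zero_of_op_eq hop (fun x _ => hσ x) (by simp [σ, s₀])
    (by simp [σ, s₁]) fun x hx => ?_⟩
  have hr := A.r_pos x hx
  have hlower : -C * A.r x ≤ A.q x + (s₁ - s₀) - σ x ^ 2 * (A.p x)⁻¹ := by
    have := mul_le_mul_of_nonneg_right (abs_le.1 (hbd x hx)).1 hr.le
    rwa [inv_mul_cancel_right₀ hr.ne'] at this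
  nlinarith

end SLData

/-! ### The Green function -/

namespace SLData

variable (A : SLData)

lemma exists_op_eq_mul (κ a b : ℝ) : ∃ g : ℝ → ℝ, ContDiffOn ℝ 2 g (Icc 0 1) ∧
    (∀ x ∈ Icc (0 : ℝ) 1, A.op g x = κ * g x) ∧ g 0 = a ∧ dx g 0 = b := by
  obtain ⟨g, z, hg0, hz0, h⟩ := exists_linearSystem A.continuousOn_inv_p
    (β := fun x => A.q x - κ * A.r x) (A.q_cont.sub (continuousOn_const.mul A.r_cont))
    a (A.p 0 * b)
  obtain ⟨hg, hop⟩ := contDiffOn_two_op_eq_of_flux (A := A) (k := fun x => κ * g x)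
    (fun x hx => (h x hx).1) (fun x hx => (h x hx).2.congr_deriv (by ring))
    (continuousOn_const.mul fun x hx => (h x hx).1.continuousWithinAt)
  have h0 : (0 : ℝ) ∈ Icc (0 : ℝ) 1 := left_mem_Icc.2 zero_le_one
  exact ⟨g, hg, hop, hg0, by rw [dx_eq h0 (h 0 h0).1, hz0, inv_mul_cancel_left₀ (A.p_ne h0)]⟩

lemma exists_op_eq_mul_right (κ a b : ℝ) : ∃ g : ℝ → ℝ, ContDiffOn ℝ 2 g (Icc 0 1) ∧
    (∀ x ∈ Icc (0 : ℝ) 1, A.op g x = κ * g x) ∧ g 1 = a ∧ dx g 1 = b := by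
  obtain ⟨g, z, hg1, hz1, h⟩ := exists_linearSystem_right A.continuousOn_inv_p
    (β := fun x => A.q x - κ * A.r x) (A.q_cont.sub (continuousOn_const.mul A.r_cont))
    a (A.p 1 * b)
  obtain ⟨hg, hop⟩ := contDiffOn_two_op_eq_of_flux (A := A) (k := fun x => κ * g x)
    (fun x hx => (h x hx).1) (fun x hx => (h x hx).2.congr_deriv (by ring))
    (continuousOn_const.mul fun x hx => (h x hx).1.continuousWithinAt)
  have h1 : (1 : ℝ) ∈ Icc (0 : ℝ) 1 := right_mem_Icc.2 zero_le_one
  exact ⟨g, hg, hop, hg1, by rw [dx_eq h1 (h 1 h1).1, hz1, inv_mul_cancel_left₀ (A.p_ne h1)]⟩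

/-- The Wronskian `y₁ (p y₂') - (p y₁') y₂`. -/
def wronskian (y₁ y₂ : ℝ → ℝ) (x : ℝ) : ℝ := y₁ x * A.flux y₂ x - A.flux y₁ x * y₂ x

lemma wronskian_eq {κ : ℝ} {y₁ y₂ : ℝ → ℝ} (h₁ : ContDiffOn ℝ 2 y₁ (Icc 0 1))
    (h₂ : ContDiffOn ℝ 2 y₂ (Icc 0 1)) (hop₁ : ∀ x ∈ Icc (0 : ℝ) 1, A.op y₁ x = κ * y₁ x)
    (hop₂ : ∀ x ∈ Icc (0 : ℝ) 1, A.op y₂ x = κ * y₂ x) :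
    ∀ x ∈ Icc (0 : ℝ) 1, A.wronskian y₁ y₂ x = A.wronskian y₁ y₂ 0 := by
  have hd : ∀ x ∈ Icc (0 : ℝ) 1, HasDerivWithinAt (A.wronskian y₁ y₂) 0 (Icc 0 1) x := by
    intro x hx
    refine (((A.hasDerivWithinAt_of_flux h₁ hx).mul (hasDerivWithinAt_flux h₂ hx)).sub
      ((hasDerivWithinAt_flux h₁ hx).mul (A.hasDerivWithinAt_of_flux h₂ hx))).congr_deriv ?_
    rw [hop₁ x hx, hop₂ x hx]
    ring
  exact constant_of_derivWithin_zero (fun x hx => (hd x hx).differentiableWithinAt)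
    fun x hx => dx_eq (Ico_subset_Icc_self hx) (hd x (Ico_subset_Icc_self hx))

/-- Data for the Green function of `A - κ`, where `κ` lies below the spectrum of `A`: solutions
`y₁`, `y₂` of `A y = κ y` satisfying the left and the right boundary condition respectively. -/
structure Green where
  κ : ℝ
  y₁ : ℝ → ℝ
  y₂ : ℝ → ℝ
  κ_nonpos : κ ≤ 0
  eq_zero : ∀ μ ≤ κ + 1, ∀ g, A.MemDC2 g →
    (∀ x ∈ Icc (0 : ℝ) 1, A.op g x = μ * g x) → ∀ x ∈ Icc (0 : ℝ) 1, g x = 0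
  contDiffOn_y₁ : ContDiffOn ℝ 2 y₁ (Icc 0 1)
  contDiffOn_y₂ : ContDiffOn ℝ 2 y₂ (Icc 0 1)
  op_y₁ : ∀ x ∈ Icc (0 : ℝ) 1, A.op y₁ x = κ * y₁ x
  op_y₂ : ∀ x ∈ Icc (0 : ℝ) 1, A.op y₂ x = κ * y₂ x
  y₁_zero : y₁ 0 = A.b₂
  dx_y₁_zero : dx y₁ 0 = -A.b₁
  y₂_one : y₂ 1 = A.a₂
  dx_y₂_one : dx y₂ 1 = -A.a₁

lemma nonempty_green : Nonempty A.Green := by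
  obtain ⟨κ₀, hκ₀⟩ := A.exists_lowerBound
  set κ := min (κ₀ - 1) 0
  have hκ : κ + 1 ≤ κ₀ := by linarith [min_le_left (κ₀ - 1) 0]
  obtain ⟨y₁, hy₁, hop₁, h₁, h₁'⟩ := A.exists_op_eq_mul κ A.b₂ (-A.b₁)
  obtain ⟨y₂, hy₂, hop₂, h₂, h₂'⟩ := A.exists_op_eq_mul_right κ A.a₂ (-A.a₁)
  exact ⟨⟨κ, y₁, y₂, min_le_right _ _, fun μ hμ => hκ₀ μ (hμ.trans hκ), hy₁, hy₂, hop₁, hop₂, h₁,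
    h₁', h₂, h₂'⟩⟩

namespace Green

variable {A} (G : A.Green)

lemma bc0_y₁ : A.bc0 G.y₁ = 0 := by
  rw [bc0, G.y₁_zero, G.dx_y₁_zero]
  ring

lemma bc1_y₂ : A.bc1 G.y₂ = 0 := by
  rw [bc1, G.y₂_one, G.dx_y₂_one]
  ring

/-- The value of the constant Wronskian of `y₁` and `y₂`. -/
def W : ℝ := A.wronskian G.y₁ G.y₂ 0

lemma wronskian_eq_W {x : ℝ} (hx : x ∈ Icc (0 : ℝ) 1) : A.wronskian G.y₁ G.y₂ x = G.W :=
  A.wronskian_eq G.contDiffOn_y₁ G.contDiffOn_y₂ G.op_y₁ G.op_y₂ x hx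

lemma W_eq_bc0 : G.W = A.p 0 * A.bc0 G.y₂ := by
  rw [W, wronskian, flux, flux, bc0, G.y₁_zero, G.dx_y₁_zero]
  ring

lemma W_eq_bc1 : G.W = -(A.p 1 * A.bc1 G.y₁) := by
  rw [← G.wronskian_eq_W (right_mem_Icc.2 zero_le_one), wronskian, flux, flux, bc1, G.y₂_one,
    G.dx_y₂_one]
  ring

lemma W_ne : G.W ≠ 0 := by
  intro hW
  have h0 : (0 : ℝ) ∈ Icc (0 : ℝ) 1 := left_mem_Icc.2 zero_le_one
  have hbc1 : A.bc1 G.y₁ = 0 := by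
    simpa [G.W_eq_bc1, A.p_ne (right_mem_Icc.2 (zero_le_one' ℝ))] using hW
  have hzero : EqOn G.y₁ (fun _ => 0) (Icc 0 1) :=
    G.eq_zero G.κ (by linarith) G.y₁ ⟨G.contDiffOn_y₁, G.bc0_y₁, hbc1⟩ G.op_y₁
  have hb₂ : A.b₂ = 0 := by rw [← G.y₁_zero, hzero h0]
  have hb₁ : A.b₁ = 0 := by
    rw [← neg_eq_zero, ← G.dx_y₁_zero, dx_congr hzero h0]
    exact dx_eq h0 (hasDerivWithinAt_const _ _ _)
  simpa [hb₁, hb₂] using A.b_ne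

lemma bc0_y₂_ne : A.bc0 G.y₂ ≠ 0 := fun h => G.W_ne (by rw [W_eq_bc0, h, mul_zero])

lemma bc1_y₁_ne : A.bc1 G.y₁ ≠ 0 := fun h => G.W_ne (by rw [W_eq_bc1, h, mul_zero, neg_zero])

lemma exists_lift_left : ∃ g : ℝ → ℝ, ContDiffOn ℝ 2 g (Icc 0 1) ∧
    (∀ x ∈ Icc (0 : ℝ) 1, A.op g x = G.κ * g x) ∧ A.bc0 g = 1 ∧ A.bc1 g = 0 := by
  have hy := G.contDiffOn_y₂
  have hy' : ContDiffOn ℝ 1 G.y₂ (Icc 0 1) := hy.of_le (by norm_num)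
  refine ⟨fun x => (A.bc0 G.y₂)⁻¹ * G.y₂ x, contDiffOn_const.mul hy, fun x hx => ?_, ?_, ?_⟩
  · rw [op_const_mul hy _ hx, G.op_y₂ x hx]; ring
  · rw [bc0_const_mul hy', inv_mul_cancel₀ G.bc0_y₂_ne]
  · rw [bc1_const_mul hy', G.bc1_y₂, mul_zero]

lemma exists_lift_right : ∃ g : ℝ → ℝ, ContDiffOn ℝ 2 g (Icc 0 1) ∧
    (∀ x ∈ Icc (0 : ℝ) 1, A.op g x = G.κ * g x) ∧ A.bc0 g = 0 ∧ A.bc1 g = 1 := by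
  have hy := G.contDiffOn_y₁
  have hy' : ContDiffOn ℝ 1 G.y₁ (Icc 0 1) := hy.of_le (by norm_num)
  refine ⟨fun x => (A.bc1 G.y₁)⁻¹ * G.y₁ x, contDiffOn_const.mul hy, fun x hx => ?_, ?_, ?_⟩
  · rw [op_const_mul hy _ hx, G.op_y₁ x hx]; ring
  · rw [bc0_const_mul hy', G.bc0_y₁, mul_zero]
  · rw [bc1_const_mul hy', inv_mul_cancel₀ G.bc1_y₁_ne]

lemma continuousOn_y₁ : ContinuousOn G.y₁ (Icc 0 1) := G.contDiffOn_y₁.continuousOn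

lemma continuousOn_y₂ : ContinuousOn G.y₂ (Icc 0 1) := G.contDiffOn_y₂.continuousOn

/-- The resolvent `(A - κ)⁻¹`: the solution of `A g - κ g = F` with homogeneous boundary
conditions, for continuous `F`. -/
def res (F : ℝ → ℝ) (x : ℝ) : ℝ :=
  -G.W⁻¹ * (G.y₂ x * (∫ y in (0 : ℝ)..x, G.y₁ y * (A.r y * F y)) +
    G.y₁ x * ∫ y in x..(1 : ℝ), G.y₂ y * (A.r y * F y))

/-- The flux of `res F`. -/
def resFlux (F : ℝ → ℝ) (x : ℝ) : ℝ :=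
  -G.W⁻¹ * (A.flux G.y₂ x * (∫ y in (0 : ℝ)..x, G.y₁ y * (A.r y * F y)) +
    A.flux G.y₁ x * ∫ y in x..(1 : ℝ), G.y₂ y * (A.r y * F y))

section

variable {F : ℝ → ℝ} (hF : ContinuousOn F (Icc 0 1))

include hF

lemma hasDerivWithinAt_res {x : ℝ} (hx : x ∈ Icc (0 : ℝ) 1) :
    HasDerivWithinAt (G.res F) ((A.p x)⁻¹ * G.resFlux F x) (Icc 0 1) x := by
  have h₁ := hasDerivWithinAt_integral (G.continuousOn_y₁.mul (A.r_cont.mul hF)) hx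
  have h₂ := hasDerivWithinAt_integral_right (G.continuousOn_y₂.mul (A.r_cont.mul hF)) hx
  refine ((((A.hasDerivWithinAt_of_flux G.contDiffOn_y₂ hx).mul h₁).add
    ((A.hasDerivWithinAt_of_flux G.contDiffOn_y₁ hx).mul h₂)).const_mul (-G.W⁻¹)).congr_deriv ?_
  simp only [resFlux, Pi.mul_apply]
  ring

lemma hasDerivWithinAt_resFlux {x : ℝ} (hx : x ∈ Icc (0 : ℝ) 1) :
    HasDerivWithinAt (G.resFlux F) (A.q x * G.res F x - A.r x * (G.κ * G.res F x + F x))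
      (Icc 0 1) x := by
  have h₁ := hasDerivWithinAt_integral (G.continuousOn_y₁.mul (A.r_cont.mul hF)) hx
  have h₂ := hasDerivWithinAt_integral_right (G.continuousOn_y₂.mul (A.r_cont.mul hF)) hx
  refine ((((hasDerivWithinAt_flux G.contDiffOn_y₂ hx).mul h₁).add
    ((hasDerivWithinAt_flux G.contDiffOn_y₁ hx).mul h₂)).const_mul (-G.W⁻¹)).congr_deriv ?_
  have hwronskian : G.y₁ x * A.flux G.y₂ x - A.flux G.y₁ x * G.y₂ x = G.W := G.wronskian_eq_W hx
  simp only [res, Pi.mul_apply, G.op_y₁ x hx, G.op_y₂ x hx]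
  have hW := G.W_ne
  field_simp
  linear_combination (-A.r x * F x) * hwronskian

lemma continuousOn_res : ContinuousOn (G.res F) (Icc 0 1) := fun _ hx =>
  (G.hasDerivWithinAt_res hF hx).continuousWithinAt

lemma dx_res {x : ℝ} (hx : x ∈ Icc (0 : ℝ) 1) : dx (G.res F) x = (A.p x)⁻¹ * G.resFlux F x :=
  dx_eq hx (G.hasDerivWithinAt_res hF hx)

lemma contDiffOn_two_res_op_res : ContDiffOn ℝ 2 (G.res F) (Icc 0 1) ∧
    ∀ x ∈ Icc (0 : ℝ) 1, A.op (G.res F) x = G.κ * G.res F x + F x :=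
  contDiffOn_two_op_eq_of_flux (fun _ hx => G.hasDerivWithinAt_res hF hx)
    (fun _ hx => G.hasDerivWithinAt_resFlux hF hx)
    ((continuousOn_const.mul (G.continuousOn_res hF)).add hF)

lemma op_res {x : ℝ} (hx : x ∈ Icc (0 : ℝ) 1) : A.op (G.res F) x = G.κ * G.res F x + F x :=
  (G.contDiffOn_two_res_op_res hF).2 x hx

lemma memDC2_res : A.MemDC2 (G.res F) := by
  have h0 : (0 : ℝ) ∈ Icc (0 : ℝ) 1 := left_mem_Icc.2 zero_le_one
  have h1 : (1 : ℝ) ∈ Icc (0 : ℝ) 1 := right_mem_Icc.2 zero_le_one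
  refine ⟨(G.contDiffOn_two_res_op_res hF).1, ?_, ?_⟩
  · rw [bc0, G.dx_res hF h0, res, resFlux, intervalIntegral.integral_same, flux, flux]
    have hbc : A.b₁ * G.y₁ 0 + A.b₂ * dx G.y₁ 0 = 0 := G.bc0_y₁
    have := A.p_ne h0
    generalize (∫ y in (0 : ℝ)..1, G.y₂ y * (A.r y * F y)) = I
    field_simp
    linear_combination (-G.W⁻¹ * I) * hbc
  · rw [bc1, G.dx_res hF h1, res, resFlux, intervalIntegral.integral_same, flux, flux]
    have hbc : A.a₁ * G.y₂ 1 + A.a₂ * dx G.y₂ 1 = 0 := G.bc1_y₂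
    have := A.p_ne h1
    generalize (∫ y in (0 : ℝ)..1, G.y₁ y * (A.r y * F y)) = I
    field_simp
    linear_combination (-G.W⁻¹ * I) * hbc

end

lemma continuousOn_op_sub {g : ℝ → ℝ} (hg : ContDiffOn ℝ 2 g (Icc 0 1)) :
    ContinuousOn (fun y => A.op g y - G.κ * g y) (Icc 0 1) :=
  (continuousOn_op hg).sub (continuousOn_const.mul hg.continuousOn)

lemma res_op_sub {g : ℝ → ℝ} (hg : A.MemDC2 g) :
    ∀ x ∈ Icc (0 : ℝ) 1, g x = G.res (fun y => A.op g y - G.κ * g y) x := by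
  have hF := G.continuousOn_op_sub hg.1
  intro x hx
  have hdiff := G.eq_zero G.κ (by linarith) _ (hg.combo (G.memDC2_res hF) 1 (-1)) (fun x hx => by
    rw [op_combo hg.1 (G.memDC2_res hF).1 1 (-1) hx, G.op_res hF hx]
    ring) x hx
  linarith

end Green

end SLData

/-! ### The weighted `L²` space -/

namespace SLData

variable (A : SLData)

lemma aemeasurable_density :
    AEMeasurable (fun x => ENNReal.ofReal (A.r x)) (volume.restrict (Icc (0 : ℝ) 1)) :=
  (A.r_cont.aemeasurable measurableSet_Icc).ennreal_ofReal

lemma wt_absolutelyContinuous : A.wt ≪ volume.restrict (Icc (0 : ℝ) 1) :=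
  withDensity_absolutelyContinuous _ _

lemma absolutelyContinuous_wt : volume.restrict (Icc (0 : ℝ) 1) ≪ A.wt := by
  refine withDensity_absolutelyContinuous' A.aemeasurable_density ?_
  filter_upwards [ae_restrict_mem measurableSet_Icc] with x hx
  simpa using A.r_pos x hx

lemma ae_wt_mem_Ioo : ∀ᵐ x ∂A.wt, x ∈ Ioo (0 : ℝ) 1 := by
  refine A.wt_absolutelyContinuous.ae_le ?_
  rw [← restrict_Ioo_eq_restrict_Icc]
  exact ae_restrict_mem measurableSet_Ioo

lemma ae_wt_mem : ∀ᵐ x ∂A.wt, x ∈ Icc (0 : ℝ) 1 :=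
  A.ae_wt_mem_Ioo.mono fun _ hx => Ioo_subset_Icc_self hx

instance : IsFiniteMeasure A.wt := by
  obtain ⟨C, -, hb⟩ := exists_abs_le_of_continuousOn A.r_cont
  refine isFiniteMeasure_withDensity (ne_of_lt ?_)
  calc ∫⁻ x in Icc (0 : ℝ) 1, ENNReal.ofReal (A.r x)
      ≤ ∫⁻ _ in Icc (0 : ℝ) 1, ENNReal.ofReal C :=
        setLIntegral_mono' measurableSet_Icc fun _ hx =>
          ENNReal.ofReal_le_ofReal ((le_abs_self _).trans (hb _ hx))
    _ < ⊤ := by simp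

lemma integral_wt (g : ℝ → ℝ) : ∫ x, g x ∂A.wt = ∫ x in (0 : ℝ)..1, A.r x * g x := by
  rw [wt, integral_withDensity_eq_integral_toReal_smul₀ A.aemeasurable_density (by simp),
    intervalIntegral.integral_of_le zero_le_one, ← integral_Icc_eq_integral_Ioc]
  refine setIntegral_congr_fun measurableSet_Icc fun x hx => ?_
  simp [(A.r_pos x hx).le]

variable {A}

lemma aestronglyMeasurable_wt {g : ℝ → ℝ} (hg : ContinuousOn g (Icc 0 1)) :
    AEStronglyMeasurable g A.wt :=
  (hg.aestronglyMeasurable measurableSet_Icc).mono_ac A.wt_absolutelyContinuous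

lemma memLp_wt {g : ℝ → ℝ} (hg : ContinuousOn g (Icc 0 1)) : MemLp g 2 A.wt := by
  obtain ⟨C, -, hb⟩ := exists_abs_le_of_continuousOn hg
  exact MemLp.of_bound (aestronglyMeasurable_wt hg) C (A.ae_wt_mem.mono fun x hx => hb x hx)

lemma integrable_wt {g : ℝ → ℝ} (hg : ContinuousOn g (Icc 0 1)) : Integrable g A.wt :=
  (memLp_wt hg).integrable (by norm_num)

lemma eqOn_of_ae_wt {g h : ℝ → ℝ} (H : g =ᵐ[A.wt] h) (hg : ContinuousOn g (Icc 0 1))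
    (hh : ContinuousOn h (Icc 0 1)) : EqOn g h (Icc 0 1) :=
  Measure.eqOn_Icc_of_ae_eq volume zero_ne_one (A.absolutelyContinuous_wt.ae_le H) hg hh

lemma ae_wt_of_eqOn {g h : ℝ → ℝ} (H : EqOn g h (Icc 0 1)) : g =ᵐ[A.wt] h :=
  A.ae_wt_mem.mono fun _ hx => H hx

variable (A)

/-- The Hilbert space `L²_r(0,1)`. -/
abbrev L2 := Lp ℝ 2 A.wt

open scoped Classical in
/-- The class in `L²_r(0,1)` of a function (`0` if it is not square integrable). -/
def cls (g : ℝ → ℝ) : A.L2 := if h : MemLp g 2 A.wt then h.toLp g else 0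

variable {A}

lemma cls_of_memLp {g : ℝ → ℝ} (hg : MemLp g 2 A.wt) : A.cls g = hg.toLp g := by
  simp [cls, hg]

lemma coeFn_cls {g : ℝ → ℝ} (hg : MemLp g 2 A.wt) : A.cls g =ᵐ[A.wt] g := by
  rw [cls_of_memLp hg]
  exact hg.coeFn_toLp

lemma cls_congr {g h : ℝ → ℝ} (hg : MemLp g 2 A.wt) (H : g =ᵐ[A.wt] h) : A.cls g = A.cls h := by
  have hh : MemLp h 2 A.wt := hg.ae_eq H
  rw [cls_of_memLp hg, cls_of_memLp hh]
  exact MemLp.toLp_congr _ _ H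

lemma eq_ae_of_cls_eq {g h : ℝ → ℝ} (hg : MemLp g 2 A.wt) (hh : MemLp h 2 A.wt)
    (H : A.cls g = A.cls h) : g =ᵐ[A.wt] h :=
  (coeFn_cls hg).symm.trans (H ▸ coeFn_cls hh)

lemma cls_smul {g : ℝ → ℝ} (hg : MemLp g 2 A.wt) (a : ℝ) :
    A.cls (fun x => a * g x) = a • A.cls g := by
  have h : MemLp (fun x => a * g x) 2 A.wt := hg.const_mul a
  rw [cls_of_memLp hg, cls_of_memLp h]
  rfl

lemma cls_sub {g h : ℝ → ℝ} (hg : MemLp g 2 A.wt) (hh : MemLp h 2 A.wt) :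
    A.cls (g - h) = A.cls g - A.cls h := by
  rw [cls_of_memLp hg, cls_of_memLp hh, cls_of_memLp (hg.sub hh)]
  rfl

lemma inner_cls_left {g : ℝ → ℝ} (hg : MemLp g 2 A.wt) (F : A.L2) :
    inner ℝ (A.cls g) F = ∫ x, g x * F x ∂A.wt := by
  rw [L2.inner_def]
  refine integral_congr_ae ?_
  filter_upwards [coeFn_cls hg] with x hx
  simp [hx, mul_comm]

lemma inner_cls {g h : ℝ → ℝ} (hg : MemLp g 2 A.wt) (hh : MemLp h 2 A.wt) :
    inner ℝ (A.cls g) (A.cls h) = ∫ x, g x * h x ∂A.wt := by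
  rw [inner_cls_left hg]
  refine integral_congr_ae ?_
  filter_upwards [coeFn_cls hh] with x hx
  rw [hx]

lemma norm_cls_sq {g : ℝ → ℝ} (hg : MemLp g 2 A.wt) :
    ‖A.cls g‖ ^ 2 = ∫ x, g x ^ 2 ∂A.wt := by
  rw [← real_inner_self_eq_norm_sq, inner_cls hg hg]
  simp [pow_two]

lemma norm_cls_le {g : ℝ → ℝ} (hg : MemLp g 2 A.wt) {C : ℝ} (hC : 0 ≤ C)
    (hb : ∀ x ∈ Icc (0 : ℝ) 1, |g x| ≤ C) :
    ‖A.cls g‖ ≤ (measureUnivNNReal A.wt : ℝ) ^ ((2 : ℝ)⁻¹) * C := by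
  have := Lp.norm_le_of_ae_bound (f := A.cls g) hC (by
    filter_upwards [coeFn_cls hg, A.ae_wt_mem] with x hx hx'
    rw [hx]
    exact hb x hx')
  simpa using this

lemma continuousOn_IccExtend (g : C(Icc (0 : ℝ) 1, ℝ)) :
    ContinuousOn (IccExtend (zero_le_one' ℝ) g) (Icc 0 1) :=
  (g.continuous.Icc_extend' (h := zero_le_one' ℝ)).continuousOn

variable (A)

/-- The embedding of `C([0,1])` into `L²_r(0,1)`. -/
def ofCont : C(Icc (0 : ℝ) 1, ℝ) →L[ℝ] A.L2 :=
  LinearMap.mkContinuous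
    { toFun := fun g => A.cls (IccExtend (zero_le_one' ℝ) g)
      map_add' := fun g h => by
        have hg := memLp_wt (A := A) (continuousOn_IccExtend g)
        have hh := memLp_wt (A := A) (continuousOn_IccExtend h)
        rw [cls_of_memLp hg, cls_of_memLp hh, ← MemLp.toLp_add,
          cls_of_memLp (memLp_wt (A := A) (continuousOn_IccExtend (g + h)))]
        rfl
      map_smul' := fun a g => by
        have hg := memLp_wt (A := A) (continuousOn_IccExtend g)
        exact cls_smul hg a }
    ((measureUnivNNReal A.wt : ℝ) ^ ((2 : ℝ)⁻¹))
    (fun g => norm_cls_le (memLp_wt (A := A) (continuousOn_IccExtend g)) (norm_nonneg _)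
      fun x _ => g.norm_coe_le_norm _)

lemma ofCont_apply (g : C(Icc (0 : ℝ) 1, ℝ)) :
    A.ofCont g = A.cls (IccExtend (zero_le_one' ℝ) g) := rfl

lemma ofCont_eq_cls {g : C(Icc (0 : ℝ) 1, ℝ)} {h : ℝ → ℝ} (H : ∀ x, g x = h x) :
    A.ofCont g = A.cls h := by
  rw [ofCont_apply]
  refine cls_congr (memLp_wt (A := A) (continuousOn_IccExtend g)) (ae_wt_of_eqOn fun x hx => ?_)
  rw [IccExtend_of_mem _ _ hx, H]

end SLData

/-! ### The resolvent and the eigenfunction basis -/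

namespace SLData

variable {A : SLData}

lemma memDC2_of_tsupport_subset {ψ : ℝ → ℝ} (hψ : ContDiff ℝ 2 ψ)
    (hs : tsupport ψ ⊆ Ioo (0 : ℝ) 1) : A.MemDC2 ψ := by
  have hzero : ∀ x ∉ Ioo (0 : ℝ) 1, ψ x = 0 ∧ HasDerivAt ψ 0 x := fun x hx => by
    have he : ψ =ᶠ[𝓝 x] fun _ => 0 := notMem_tsupport_iff_eventuallyEq.1 fun h => hx (hs h)
    exact ⟨he.self_of_nhds, (hasDerivAt_const x 0).congr_of_eventuallyEq he⟩
  refine ⟨hψ.contDiffOn, ?_, ?_⟩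
  · obtain ⟨hval, hderiv⟩ := hzero 0 (by simp)
    rw [bc0, hval, dx_eq (by simp) hderiv.hasDerivWithinAt]; simp
  · obtain ⟨hval, hderiv⟩ := hzero 1 (by simp)
    rw [bc1, hval, dx_eq (by simp) hderiv.hasDerivWithinAt]; simp

namespace Green

variable (G : A.Green)

/-- The projection of the real line onto `[0,1]`. -/
def unitProj (x : ℝ) : ℝ := projIcc 0 1 zero_le_one x

lemma continuous_unitProj : Continuous unitProj := continuous_subtype_val.comp continuous_projIcc

lemma unitProj_mem (x : ℝ) : unitProj x ∈ Icc (0 : ℝ) 1 := (projIcc 0 1 zero_le_one x).2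

lemma unitProj_of_mem {x : ℝ} (hx : x ∈ Icc (0 : ℝ) 1) : unitProj x = x := by
  simp [unitProj, projIcc_of_mem zero_le_one hx]

lemma continuous_comp_unitProj {g : ℝ → ℝ} (hg : ContinuousOn g (Icc 0 1)) :
    Continuous (fun x => g (unitProj x)) :=
  hg.comp_continuous continuous_unitProj unitProj_mem

/-- The Green function of `A - κ`. -/
def ker (x y : ℝ) : ℝ := -G.W⁻¹ * (G.y₁ (unitProj (min x y)) * G.y₂ (unitProj (max x y)))

lemma continuous_ker : Continuous (fun z : ℝ × ℝ => G.ker z.1 z.2) :=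
  continuous_const.mul
    (((continuous_comp_unitProj G.continuousOn_y₁).comp (continuous_fst.min continuous_snd)).mul
      ((continuous_comp_unitProj G.continuousOn_y₂).comp (continuous_fst.max continuous_snd)))

lemma ker_comm (x y : ℝ) : G.ker x y = G.ker y x := by
  unfold ker
  rw [min_comm, max_comm]

lemma exists_ker_bound : ∃ C, 0 < C ∧ ∀ x y, |G.ker x y| ≤ C := by
  obtain ⟨C₁, h₁, hb₁⟩ := exists_abs_le_of_continuousOn G.continuousOn_y₁
  obtain ⟨C₂, h₂, hb₂⟩ := exists_abs_le_of_continuousOn G.continuousOn_y₂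
  have hW := G.W_ne
  refine ⟨|G.W⁻¹| * (C₁ * C₂), by positivity, fun x y => ?_⟩
  rw [ker, abs_mul, abs_neg, abs_mul]
  gcongr
  · exact hb₁ _ (unitProj_mem _)
  · exact hb₂ _ (unitProj_mem _)

/-- The Green function as a continuous family of continuous functions. -/
def kerC : C(Icc (0 : ℝ) 1, C(Icc (0 : ℝ) 1, ℝ)) :=
  ContinuousMap.curry ⟨fun z => G.ker z.1 z.2, G.continuous_ker.comp
    ((continuous_subtype_val.comp continuous_fst).prodMk
      (continuous_subtype_val.comp continuous_snd))⟩

lemma continuous_ker_right (x : ℝ) : Continuous (G.ker x) :=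
  G.continuous_ker.comp (continuous_const.prodMk continuous_id)

lemma ofCont_kerC (x : Icc (0 : ℝ) 1) : A.ofCont (G.kerC x) = A.cls (G.ker x) :=
  A.ofCont_eq_cls fun _ => rfl

lemma continuous_section : Continuous (fun x : Icc (0 : ℝ) 1 => A.cls (G.ker x)) := by
  have : Continuous (fun x : Icc (0 : ℝ) 1 => A.ofCont (G.kerC x)) :=
    A.ofCont.continuous.comp G.kerC.continuous
  simpa only [ofCont_kerC] using this

lemma exists_section_bound : ∃ C, 0 < C ∧ ∀ x, ‖A.cls (G.ker x)‖ ≤ C := by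
  obtain ⟨C, hC, hb⟩ := G.exists_ker_bound
  refine ⟨(measureUnivNNReal A.wt : ℝ) ^ ((2 : ℝ)⁻¹) * C + 1, by positivity, fun x => ?_⟩
  have := norm_cls_le (memLp_wt (A := A) (G.continuous_ker_right x).continuousOn) hC.le
    fun y _ => hb x y
  linarith

/-- The integral operator with the Green function as its kernel, into `C([0,1])`. -/
def toCont : A.L2 →L[ℝ] C(Icc (0 : ℝ) 1, ℝ) :=
  LinearMap.mkContinuous
    { toFun := fun F => ⟨fun x => inner ℝ (A.cls (G.ker x)) F,
        G.continuous_section.inner continuous_const⟩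
      map_add' := fun F H => by ext x; simp [inner_add_right]
      map_smul' := fun a F => by ext x; simp [inner_smul_right] }
    G.exists_section_bound.choose
    (fun F => by
      obtain ⟨h0, hb⟩ := G.exists_section_bound.choose_spec
      refine (ContinuousMap.norm_le _ (by positivity)).2 fun x => ?_
      exact (norm_inner_le_norm _ _).trans (mul_le_mul_of_nonneg_right (hb x) (norm_nonneg _)))

lemma toCont_apply (F : A.L2) (x : Icc (0 : ℝ) 1) :
    G.toCont F x = inner ℝ (A.cls (G.ker x)) F := rfl

/-- The resolvent `(A - κ)⁻¹` on `L²_r(0,1)`. -/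
def resL : A.L2 →L[ℝ] A.L2 := A.ofCont ∘L G.toCont

lemma exists_abs_toCont_le : ∃ C, ∀ (F : A.L2) x, |G.toCont F x| ≤ C * ‖F‖ := by
  obtain ⟨C, -, hb⟩ := G.exists_section_bound
  exact ⟨C, fun F x => (abs_real_inner_le_norm _ _).trans
    (mul_le_mul_of_nonneg_right (hb x) (norm_nonneg _))⟩

lemma dist_toCont_le (F : A.L2) (x y : Icc (0 : ℝ) 1) :
    dist (G.toCont F x) (G.toCont F y) ≤ dist (A.cls (G.ker x)) (A.cls (G.ker y)) * ‖F‖ := by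
  rw [toCont_apply, toCont_apply, dist_eq_norm, dist_eq_norm, ← inner_sub_left]
  exact norm_inner_le_norm _ _

lemma isCompactOperator_toCont : IsCompactOperator G.toCont := by
  let L := (ContinuousMap.linearIsometryBoundedOfCompact (Icc (0 : ℝ) 1) ℝ
    ℝ).toContinuousLinearEquiv
  let J : A.L2 →L[ℝ] BoundedContinuousFunction (Icc (0 : ℝ) 1) ℝ :=
    (L : C(Icc (0 : ℝ) 1, ℝ) →L[ℝ] _) ∘L G.toCont
  have hJ : IsCompactOperator J := by
    obtain ⟨C, hb⟩ := G.exists_abs_toCont_le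
    refine (isCompactOperator_iff_isCompact_closure_image_closedBall J.toLinearMap
      zero_lt_one).2 (BoundedContinuousFunction.arzela_ascoli (Metric.closedBall 0 (|C|))
        (isCompact_closedBall 0 (|C|)) _ ?_ fun x₀ => ?_)
    · rintro _ x ⟨F, hF, rfl⟩
      rw [mem_closedBall_zero_iff] at hF ⊢
      exact (hb F x).trans ((mul_le_mul_of_nonneg_right (le_abs_self C) (norm_nonneg F)).trans
        (mul_le_of_le_one_right (abs_nonneg C) hF))
    · refine Metric.equicontinuousAt_of_continuity_modulus
        (fun x : Icc (0 : ℝ) 1 => dist (A.cls (G.ker x₀)) (A.cls (G.ker x))) ?_ _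
        (Eventually.of_forall fun x => ?_)
      · have h : Tendsto (fun x : Icc (0 : ℝ) 1 => dist (A.cls (G.ker x₀)) (A.cls (G.ker x)))
            (𝓝 x₀) (𝓝 (dist (A.cls (G.ker x₀)) (A.cls (G.ker x₀)))) :=
          (continuous_const.dist G.continuous_section).continuousAt
        simpa using h
      · rintro ⟨_, F, hF, rfl⟩
        rw [mem_closedBall_zero_iff] at hF
        exact (G.dist_toCont_le F x₀ x).trans (mul_le_of_le_one_right dist_nonneg hF)
  exact hJ.clm_comp (L.symm : _ →L[ℝ] C(Icc (0 : ℝ) 1, ℝ))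

lemma isCompactOperator_resL : IsCompactOperator G.resL :=
  G.isCompactOperator_toCont.clm_comp A.ofCont

lemma resL_coeFn (F : A.L2) : G.resL F =ᵐ[A.wt] fun x => ∫ y, G.ker x y * F y ∂A.wt := by
  have h1 := coeFn_cls (memLp_wt (A := A) (continuousOn_IccExtend (G.toCont F)))
  filter_upwards [h1, A.ae_wt_mem] with x hx hx'
  change A.ofCont (G.toCont F) x = _
  rw [ofCont_apply, hx, IccExtend_of_mem _ _ hx', toCont_apply,
    inner_cls_left (memLp_wt (G.continuous_ker_right x).continuousOn)]

lemma resL_isSymmetric : (G.resL : A.L2 →ₗ[ℝ] A.L2).IsSymmetric := by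
  intro F H
  change inner ℝ (G.resL F) H = inner ℝ F (G.resL H)
  rw [L2.inner_def, L2.inner_def]
  have hF : Integrable F A.wt := (Lp.memLp F).integrable (by norm_num)
  have hH : Integrable H A.wt := (Lp.memLp H).integrable (by norm_num)
  obtain ⟨C, -, hb⟩ := G.exists_ker_bound
  have hinteg : Integrable (Function.uncurry fun x y => G.ker x y * (H x * F y))
      (A.wt.prod A.wt) :=
    (hH.mul_prod hF).bdd_mul (c := C) G.continuous_ker.aestronglyMeasurable
      (Eventually.of_forall fun z => hb z.1 z.2)
  calc ∫ x, inner ℝ (G.resL F x) (H x) ∂A.wt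
      = ∫ x, ∫ y, G.ker x y * (H x * F y) ∂A.wt ∂A.wt := by
        refine integral_congr_ae ?_
        filter_upwards [G.resL_coeFn F] with x hx
        rw [hx]
        simp only [RCLike.inner_apply, conj_trivial]
        rw [← integral_const_mul]
        congr 1; ext y; ring
    _ = ∫ y, ∫ x, G.ker x y * (H x * F y) ∂A.wt ∂A.wt := integral_integral_swap hinteg
    _ = ∫ y, inner ℝ (F y) (G.resL H y) ∂A.wt := by
        refine integral_congr_ae ?_
        filter_upwards [G.resL_coeFn H] with y hy
        rw [hy]
        simp only [RCLike.inner_apply, conj_trivial]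
        rw [← integral_mul_const]
        congr 1; ext x; rw [G.ker_comm x y]; ring

lemma res_eq_integral {F : ℝ → ℝ} (hF : ContinuousOn F (Icc 0 1)) {x : ℝ}
    (hx : x ∈ Icc (0 : ℝ) 1) : G.res F x = ∫ y, G.ker x y * F y ∂A.wt := by
  rw [integral_wt]
  have hc : ContinuousOn (fun y => A.r y * (G.ker x y * F y)) (Icc 0 1) :=
    A.r_cont.mul ((G.continuous_ker_right x).continuousOn.mul hF)
  rw [← intervalIntegral.integral_add_adjacent_intervals
    (intervalIntegrable_of_continuousOn hc (left_mem_Icc.2 zero_le_one) hx)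
    (intervalIntegrable_of_continuousOn hc hx (right_mem_Icc.2 zero_le_one)), res, mul_add,
    ← intervalIntegral.integral_const_mul, ← intervalIntegral.integral_const_mul,
    ← intervalIntegral.integral_const_mul, ← intervalIntegral.integral_const_mul]
  congr 1
  · refine intervalIntegral.integral_congr fun y hy => ?_
    rw [uIcc_of_le hx.1] at hy
    simp only [ker]
    rw [min_eq_right hy.2, max_eq_left hy.2, unitProj_of_mem hx,
      unitProj_of_mem ⟨hy.1, hy.2.trans hx.2⟩]
    ring
  · refine intervalIntegral.integral_congr fun y hy => ?_
    rw [uIcc_of_le hx.2] at hy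
    simp only [ker]
    rw [min_eq_left hy.1, max_eq_right hy.1, unitProj_of_mem hx,
      unitProj_of_mem ⟨hx.1.trans hy.1, hy.2⟩]
    ring

lemma res_eq_inner {F : ℝ → ℝ} (hF : ContinuousOn F (Icc 0 1)) {x : ℝ}
    (hx : x ∈ Icc (0 : ℝ) 1) : G.res F x = inner ℝ (A.cls (G.ker x)) (A.cls F) := by
  rw [G.res_eq_integral hF hx, inner_cls (memLp_wt (G.continuous_ker_right x).continuousOn)
    (memLp_wt hF)]

lemma resL_cls {F : ℝ → ℝ} (hF : ContinuousOn F (Icc 0 1)) :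
    G.resL (A.cls F) = A.cls (G.res F) :=
  A.ofCont_eq_cls fun x => (G.res_eq_inner hF x.2).symm

lemma eq_inner_of_memDC2 {g : ℝ → ℝ} (hg : A.MemDC2 g) {x : ℝ} (hx : x ∈ Icc (0 : ℝ) 1) :
    g x = inner ℝ (A.cls (G.ker x)) (A.cls (fun y => A.op g y - G.κ * g y)) := by
  rw [← G.res_eq_inner (G.continuousOn_op_sub hg.1) hx]
  exact G.res_op_sub hg x hx

lemma inner_resL_left (F H : A.L2) : inner ℝ (G.resL F) H = inner ℝ F (G.resL H) :=
  G.resL_isSymmetric F H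

lemma cls_eq_resL {g : ℝ → ℝ} (hg : A.MemDC2 g) :
    A.cls g = G.resL (A.cls fun y => A.op g y - G.κ * g y) := by
  rw [G.resL_cls (G.continuousOn_op_sub hg.1)]
  exact cls_congr (memLp_wt hg.1.continuousOn) (ae_wt_of_eqOn (G.res_op_sub hg))

lemma eq_zero_of_resL_eq_zero {F : A.L2} (hF : G.resL F = 0) : F = 0 := by
  have hloc : LocallyIntegrable F A.wt :=
    ((Lp.memLp F).integrable (by norm_num)).locallyIntegrable
  have horth : ∀ ψ : ℝ → ℝ, A.MemDC2 ψ → ∫ x, ψ x * F x ∂A.wt = 0 := fun ψ hψ => by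
    rw [← inner_cls_left (memLp_wt hψ.1.continuousOn), G.cls_eq_resL hψ, inner_resL_left, hF,
      inner_zero_right]
  have hae := isOpen_Ioo.ae_eq_zero_of_integral_contDiff_smul_eq_zero
    (hloc.locallyIntegrableOn (Ioo (0 : ℝ) 1)) (μ := A.wt)
    (fun ψ hψ _ hs => horth ψ (memDC2_of_tsupport_subset (contDiff_infty.1 hψ 2) hs))
  rw [Lp.eq_zero_iff_ae_eq_zero]
  filter_upwards [hae, A.ae_wt_mem_Ioo] with x hx hx'
  exact hx hx'

lemma lt_of_isEigenfunction {μ : ℝ} {φ : ℝ → ℝ} (h : A.IsEigenfunction μ φ) : G.κ + 1 < μ := by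
  by_contra! hc
  have hz := G.eq_zero μ hc φ h.1 h.op_eq
  have h1 := h.2.2
  rw [intervalIntegral.integral_congr (g := fun _ => (0 : ℝ))] at h1
  · simp at h1
  · intro x hx
    rw [uIcc_of_le zero_le_one] at hx
    simp [hz x hx]

lemma resL_eigenfunction {μ : ℝ} {φ : ℝ → ℝ} (h : A.IsEigenfunction μ φ) :
    G.resL (A.cls φ) = (μ - G.κ)⁻¹ • A.cls φ := by
  have hne : μ - G.κ ≠ 0 := by linarith [G.lt_of_isEigenfunction h]
  have hφ : MemLp φ 2 A.wt := memLp_wt h.1.1.continuousOn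
  have hop : A.cls (fun y => A.op φ y - G.κ * φ y) = (μ - G.κ) • A.cls φ := by
    rw [← cls_smul hφ]
    refine cls_congr (memLp_wt (G.continuousOn_op_sub h.1.1)) (ae_wt_of_eqOn fun y hy => ?_)
    simp only [h.op_eq y hy]
    ring
  rw [eq_inv_smul_iff₀ hne, ← map_smul, ← hop, ← G.cls_eq_resL h.1]

lemma norm_cls_eigenfunction {μ : ℝ} {φ : ℝ → ℝ} (h : A.IsEigenfunction μ φ) :
    ‖A.cls φ‖ = 1 := by
  have := norm_cls_sq (memLp_wt (A := A) h.1.1.continuousOn)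
  rw [integral_wt, h.2.2] at this
  nlinarith [norm_nonneg (A.cls φ)]

lemma exists_memDC2_of_resL_eq_smul {F : A.L2} {θ : ℝ} (hθ : θ ≠ 0) (hF : G.resL F = θ • F) :
    ∃ g, A.MemDC2 g ∧ (∀ x ∈ Icc (0 : ℝ) 1, A.op g x = (G.κ + θ⁻¹) * g x) ∧ F = A.cls g := by
  set g : ℝ → ℝ := fun x => θ⁻¹ * IccExtend (zero_le_one' ℝ) (G.toCont F) x with hg
  have hgc : ContinuousOn g (Icc 0 1) := continuousOn_const.mul (continuousOn_IccExtend _)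
  have hFg : F = A.cls g := by
    rw [hg, cls_smul (memLp_wt (continuousOn_IccExtend _)), ← ofCont_apply]
    change F = θ⁻¹ • G.resL F
    rw [hF, inv_smul_smul₀ hθ]
  have hres : EqOn (G.res g) (fun x => θ * g x) (Icc 0 1) := by
    refine eqOn_of_ae_wt (A := A) (eq_ae_of_cls_eq (memLp_wt (G.continuousOn_res hgc))
      (memLp_wt (continuousOn_const.mul hgc)) ?_) (G.continuousOn_res hgc)
      (continuousOn_const.mul hgc)
    rw [← G.resL_cls hgc, cls_smul (memLp_wt hgc), ← hFg, hF]
  have hgeq : EqOn g (fun x => θ⁻¹ * G.res g x) (Icc 0 1) := fun x hx => by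
    simp only [hres hx, inv_mul_cancel_left₀ hθ]
  have hmem := G.memDC2_res hgc
  refine ⟨g, (hmem.const_mul θ⁻¹).congr hgeq, fun x hx => ?_, hFg⟩
  rw [op_congr hgeq hx, op_const_mul hmem.1 _ hx, G.op_res hgc hx, hres hx]
  field_simp

lemma exists_eigenfunction_of_resL {F : A.L2} {θ : ℝ} (hθ : θ ≠ 0) (hF : G.resL F = θ • F)
    (hF0 : F ≠ 0) : ∃ μ φ, A.IsEigenfunction μ φ ∧ F ∈ Submodule.span ℝ {A.cls φ} := by
  obtain ⟨g, hg, hop, rfl⟩ := G.exists_memDC2_of_resL_eq_smul hθ hF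
  have hN : ‖A.cls g‖ ≠ 0 := norm_ne_zero_iff.2 hF0
  have hgL : MemLp g 2 A.wt := memLp_wt hg.1.continuousOn
  refine ⟨G.κ + θ⁻¹, fun x => ‖A.cls g‖⁻¹ * g x, ⟨hg.const_mul _, fun x hx => ?_, ?_⟩,
    Submodule.mem_span_singleton.2 ⟨‖A.cls g‖, by rw [cls_smul hgL, smul_inv_smul₀ hN]⟩⟩
  · rw [op_const_mul hg.1 _ (Ioo_subset_Icc_self hx), hop x (Ioo_subset_Icc_self hx)]
    ring
  · simp_rw [← integral_wt, mul_pow, integral_const_mul, ← norm_cls_sq hgL]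
    field_simp

include G in
lemma orthonormal_eigenfunctions {φ : ℝ → ℝ → ℝ}
    (hφ : ∀ μ, A.IsEigenvalue μ → A.IsEigenfunction μ (φ μ)) :
    Orthonormal ℝ (fun μ : {μ : ℝ // A.IsEigenvalue μ} => A.cls (φ μ)) := by
  refine ⟨fun μ => norm_cls_eigenfunction (hφ μ μ.2), fun μ ν hne => ?_⟩
  have h := G.inner_resL_left (A.cls (φ μ)) (A.cls (φ ν))
  rw [G.resL_eigenfunction (hφ μ μ.2), G.resL_eigenfunction (hφ ν ν.2), real_inner_smul_left,
    real_inner_smul_right] at h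
  by_contra hc
  have := inv_injective (mul_right_cancel₀ hc h)
  exact hne (Subtype.ext (by linarith))

lemma cls_mem_span_of_isEigenfunction {μ : ℝ} {φ ψ : ℝ → ℝ} (hφ : A.IsEigenfunction μ φ)
    (hψ : A.IsEigenfunction μ ψ) : A.cls ψ ∈ Submodule.span ℝ {A.cls φ} := by
  have hφL : MemLp φ 2 A.wt := memLp_wt hφ.1.1.continuousOn
  have hne : ∃ x ∈ Icc (0 : ℝ) 1, φ x ≠ 0 := by
    by_contra! hzero
    have h1 := norm_cls_eigenfunction hφ
    rw [cls_congr (h := fun x => 0 * φ x) hφL (ae_wt_of_eqOn fun x hx => by simp [hzero x hx]),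
      cls_smul hφL, zero_smul, norm_zero] at h1
    exact zero_ne_one h1
  obtain ⟨b, hb⟩ := eigenspace_simple hψ.1 hφ.1 hψ.op_eq hφ.op_eq hne
  refine Submodule.mem_span_singleton.2 ⟨b, ?_⟩
  rw [← cls_smul hφL]
  exact (cls_congr (memLp_wt hψ.1.1.continuousOn) (ae_wt_of_eqOn hb)).symm

include G in
lemma orthogonal_span_eigenfunctions {φ : ℝ → ℝ → ℝ}
    (hφ : ∀ μ, A.IsEigenvalue μ → A.IsEigenfunction μ (φ μ)) :
    (Submodule.span ℝ (range fun μ : {μ : ℝ // A.IsEigenvalue μ} => A.cls (φ μ)))ᗮ = ⊥ := by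
  rw [eq_bot_iff, ← ContinuousLinearMap.orthogonalComplement_iSup_eigenspaces_eq_bot
    G.isCompactOperator_resL G.resL_isSymmetric]
  refine Submodule.orthogonal_le (iSup_le fun θ F hF => ?_)
  replace hF : G.resL F = θ • F := Module.End.mem_eigenspace_iff.1 hF
  rcases eq_or_ne F 0 with rfl | hF0
  · exact Submodule.zero_mem _
  have hθ : θ ≠ 0 := by
    rintro rfl
    exact hF0 (G.eq_zero_of_resL_eq_zero (by rw [hF, zero_smul]))
  obtain ⟨μ, ψ, hψ, hFψ⟩ := G.exists_eigenfunction_of_resL hθ hF hF0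
  have hψφ := cls_mem_span_of_isEigenfunction (hφ μ ⟨ψ, hψ⟩) hψ
  have hle : Submodule.span ℝ {A.cls ψ} ≤ Submodule.span ℝ {A.cls (φ μ)} :=
    (Submodule.span_singleton_le_iff_mem _ _).2 hψφ
  exact Submodule.span_mono (singleton_subset_iff.2
    (mem_range_self (⟨μ, ψ, hψ⟩ : {μ : ℝ // A.IsEigenvalue μ}))) (hle hFψ)

/-- The eigenfunctions form a Hilbert basis of `L²_r(0,1)`. -/
def basis {φ : ℝ → ℝ → ℝ} (hφ : ∀ μ, A.IsEigenvalue μ → A.IsEigenfunction μ (φ μ)) :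
    HilbertBasis {μ : ℝ // A.IsEigenvalue μ} ℝ A.L2 :=
  HilbertBasis.mkOfOrthogonalEqBot (G.orthonormal_eigenfunctions hφ)
    (G.orthogonal_span_eigenfunctions hφ)

lemma basis_apply {φ : ℝ → ℝ → ℝ} (hφ : ∀ μ, A.IsEigenvalue μ → A.IsEigenfunction μ (φ μ))
    (μ : {μ : ℝ // A.IsEigenvalue μ}) : G.basis hφ μ = A.cls (φ μ) := by
  simp [basis]

end Green

end SLData
namespace SLData

variable (A : SLData)

/-- The type of eigenvalues of `A`, the index set of the eigenfunction expansions. -/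
abbrev Eig := {μ : ℝ // A.IsEigenvalue μ}

/-- Maximum of `|g|` on `[0,1]`. -/
def supAbs (g : ℝ → ℝ) : ℝ := sSup ((fun x => |g x|) '' Icc 0 1)

/-- Green function data, normalized eigenfunctions and the summability of
`max |φ_μ| / (μ - κ)` over all eigenvalues. -/
structure Spectral where
  G : A.Green
  φ : ℝ → ℝ → ℝ
  isEigenfunction_φ : ∀ μ, A.IsEigenvalue μ → A.IsEigenfunction μ (φ μ)
  summable_sup : Summable fun μ : A.Eig => (μ - G.κ)⁻¹ * supAbs (φ μ)

variable {A}

lemma abs_le_supAbs {g : ℝ → ℝ} (hg : ContinuousOn g (Icc 0 1)) {x : ℝ}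
    (hx : x ∈ Icc (0 : ℝ) 1) : |g x| ≤ supAbs g :=
  le_csSup (isCompact_Icc.bddAbove_image hg.abs) (mem_image_of_mem _ hx)

lemma supAbs_nonneg (g : ℝ → ℝ) : 0 ≤ supAbs g :=
  Real.sSup_nonneg (by rintro _ ⟨x, _, rfl⟩; exact abs_nonneg _)

namespace Green

variable (G : A.Green)

lemma res_eigenfunction {μ : ℝ} {φ : ℝ → ℝ} (h : A.IsEigenfunction μ φ) :
    ∀ x ∈ Icc (0 : ℝ) 1, G.res φ x = (μ - G.κ)⁻¹ * φ x := by
  have hc := h.1.1.continuousOn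
  refine eqOn_of_ae_wt (A := A) (eq_ae_of_cls_eq (memLp_wt (G.continuousOn_res hc))
    (memLp_wt (continuousOn_const.mul hc)) ?_) (G.continuousOn_res hc) (continuousOn_const.mul hc)
  rw [cls_smul (memLp_wt hc), ← G.resL_cls hc, G.resL_eigenfunction h]

lemma sum_sq_eigenfunction_le {φ : ℝ → ℝ → ℝ}
    (hφ : ∀ μ, A.IsEigenvalue μ → A.IsEigenfunction μ (φ μ)) (S : Finset A.Eig) {x : ℝ}
    (hx : x ∈ Icc (0 : ℝ) 1) :
    ∑ μ ∈ S, ((μ - G.κ)⁻¹ * φ μ x) ^ 2 ≤ ‖A.cls (G.ker x)‖ ^ 2 := by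
  refine le_trans (Finset.sum_congr rfl fun μ _ => ?_).le
    ((G.orthonormal_eigenfunctions hφ).sum_inner_products_le (A.cls (G.ker x)) (s := S))
  rw [real_inner_comm, ← G.res_eq_inner (hφ μ μ.2).1.1.continuousOn hx,
    G.res_eigenfunction (hφ μ μ.2) x hx, Real.norm_eq_abs, sq_abs]

lemma summable_inv_sq {φ : ℝ → ℝ → ℝ} (hφ : ∀ μ, A.IsEigenvalue μ → A.IsEigenfunction μ (φ μ)) :
    Summable fun μ : A.Eig => ((μ - G.κ)⁻¹) ^ 2 := by
  obtain ⟨C, -, hb⟩ := G.exists_section_bound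
  have hc : ∀ μ : A.Eig, ContinuousOn (fun x => ((μ - G.κ)⁻¹ * φ μ x) ^ 2) (Icc 0 1) := fun μ =>
    (continuousOn_const.mul (hφ μ μ.2).1.1.continuousOn).pow 2
  refine summable_of_sum_le (c := ∫ _, C ^ 2 ∂A.wt) (fun μ => sq_nonneg _) fun S => ?_
  calc ∑ μ ∈ S, ((μ - G.κ)⁻¹) ^ 2
      = ∑ μ ∈ S, ∫ x, ((μ - G.κ)⁻¹ * φ μ x) ^ 2 ∂A.wt := by
        refine Finset.sum_congr rfl fun μ _ => ?_
        simp_rw [mul_pow, integral_const_mul,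
          ← norm_cls_sq (memLp_wt (A := A) (hφ μ μ.2).1.1.continuousOn),
          norm_cls_eigenfunction (hφ μ μ.2), one_pow, mul_one]
    _ = ∫ x, ∑ μ ∈ S, ((μ - G.κ)⁻¹ * φ μ x) ^ 2 ∂A.wt :=
        (integral_finsetSum _ fun μ _ => integrable_wt (hc μ)).symm
    _ ≤ ∫ _, C ^ 2 ∂A.wt :=
        integral_mono_ae (integrable_finsetSum _ fun μ _ => integrable_wt (hc μ))
          (integrable_const _) (A.ae_wt_mem.mono fun x hx =>
            (G.sum_sq_eigenfunction_le hφ S hx).trans (pow_le_pow_left₀ (norm_nonneg _) (hb x) 2))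

include G in
lemma finite_eig_lt {φ : ℝ → ℝ → ℝ} (hφ : ∀ μ, A.IsEigenvalue μ → A.IsEigenfunction μ (φ μ))
    (Λ : ℝ) : {μ : A.Eig | (μ : ℝ) < Λ}.Finite := by
  have hlt : ∀ μ : A.Eig, G.κ + 1 < μ := fun μ => G.lt_of_isEigenfunction (hφ μ μ.2)
  rcases le_or_gt Λ G.κ with hΛ | hΛ
  · exact finite_empty.subset fun μ hμ => by linarith [hlt μ, show (μ : ℝ) < Λ from hμ]
  have hsmall := (G.summable_inv_sq hφ).tendsto_cofinite_zero.eventually_lt_const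
    (u := ((Λ - G.κ)⁻¹) ^ 2) (by have := sub_pos.2 hΛ; positivity)
  refine (eventually_cofinite.1 hsmall).subset fun μ hμ => not_lt.2 ?_
  have : 0 < (μ : ℝ) - G.κ := by linarith [hlt μ]
  have hμΛ : (μ : ℝ) < Λ := hμ
  gcongr

end Green

lemma nonempty_spectral (hH : A.AssumptionH) : Nonempty A.Spectral := by
  obtain ⟨G⟩ := A.nonempty_green
  obtain ⟨φ, hφ, Λ, -, hΛ0, hs⟩ := hH
  refine ⟨⟨G, φ, hφ, ?_⟩⟩
  rw [← (G.finite_eig_lt hφ Λ).summable_compl_iff]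
  let e : ↥({μ : A.Eig | (μ : ℝ) < Λ}ᶜ) ≃ {μ : ℝ // A.IsEigenvalue μ ∧ Λ ≤ μ} :=
    { toFun := fun μ => ⟨μ.1, μ.1.2, not_lt.1 μ.2⟩
      invFun := fun μ => ⟨⟨μ.1, μ.2.1⟩, not_lt.2 μ.2.2⟩
      left_inv := fun _ => rfl
      right_inv := fun _ => rfl }
  refine (e.summable_iff.2 hs).of_nonneg_of_le (fun μ => ?_) fun μ => ?_
  · have := G.lt_of_isEigenfunction (hφ μ.1 μ.1.2)
    exact mul_nonneg (inv_nonneg.2 (by linarith)) (supAbs_nonneg _)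
  · have hle : Λ ≤ ((μ : A.Eig) : ℝ) := not_lt.1 μ.2
    have hκ := G.κ_nonpos
    change _ ≤ ((μ : A.Eig) : ℝ)⁻¹ * supAbs (φ μ)
    exact mul_le_mul_of_nonneg_right (inv_anti₀ (by linarith) (by linarith)) (supAbs_nonneg _)

namespace Spectral

variable (S : A.Spectral)

/-- The distance of an eigenvalue to `κ`. -/
def ω (μ : A.Eig) : ℝ := μ - S.G.κ

lemma one_lt_ω (μ : A.Eig) : 1 < S.ω μ := by
  rw [ω]
  linarith [S.G.lt_of_isEigenfunction (S.isEigenfunction_φ μ μ.2)]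

lemma ω_pos (μ : A.Eig) : 0 < S.ω μ := zero_lt_one.trans (S.one_lt_ω μ)

lemma continuousOn_φ (μ : A.Eig) : ContinuousOn (S.φ μ) (Icc 0 1) :=
  (S.isEigenfunction_φ μ μ.2).1.1.continuousOn

include S in
lemma countable_eig : Countable A.Eig := by
  have h := (S.G.summable_inv_sq S.isEigenfunction_φ).countable_support
  refine Set.countable_univ_iff.1 (h.mono fun μ _ => ?_)
  have := S.ω_pos μ
  unfold ω at this
  simp only [Function.mem_support]
  positivity

lemma summable_inv_ω_sq : Summable fun μ : A.Eig => ((S.ω μ)⁻¹) ^ 2 :=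
  S.G.summable_inv_sq S.isEigenfunction_φ

lemma summable_inv_ω_mul : Summable fun μ : A.Eig => (S.ω μ)⁻¹ * supAbs (S.φ μ) := S.summable_sup

/-- The coefficients in the eigenfunction expansion. -/
def coef (g : ℝ → ℝ) (μ : A.Eig) : ℝ := ∫ x, g x * S.φ μ x ∂A.wt

lemma coef_eq_inner {g : ℝ → ℝ} (hg : MemLp g 2 A.wt) (μ : A.Eig) :
    S.coef g μ = inner ℝ (A.cls (S.φ μ)) (A.cls g) := by
  rw [inner_cls (memLp_wt (S.continuousOn_φ μ)) hg, coef]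
  simp only [mul_comm]

lemma abs_coef_le {g : ℝ → ℝ} (hg : MemLp g 2 A.wt) (μ : A.Eig) :
    |S.coef g μ| ≤ ‖A.cls g‖ := by
  rw [S.coef_eq_inner hg]
  refine (abs_real_inner_le_norm _ _).trans ?_
  rw [Green.norm_cls_eigenfunction (S.isEigenfunction_φ μ μ.2), one_mul]

lemma hasSum_coef_sq {g : ℝ → ℝ} (hg : MemLp g 2 A.wt) :
    HasSum (fun μ => S.coef g μ ^ 2) (‖A.cls g‖ ^ 2) := by
  have := (S.G.basis S.isEigenfunction_φ).hasSum_inner_mul_inner (A.cls g) (A.cls g)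
  rw [real_inner_self_eq_norm_sq] at this
  refine this.congr_fun fun μ => ?_
  rw [S.coef_eq_inner hg, S.G.basis_apply, real_inner_comm (A.cls g), pow_two]

lemma coef_congr {g h : ℝ → ℝ} (H : EqOn g h (Icc 0 1)) (μ : A.Eig) : S.coef g μ = S.coef h μ :=
  integral_congr_ae (A.ae_wt_mem.mono fun x hx => by simp only [H hx])

lemma coef_combo {g h : ℝ → ℝ} (hg : MemLp g 2 A.wt) (hh : MemLp h 2 A.wt) (a b : ℝ)
    (μ : A.Eig) : S.coef (fun x => a * g x + b * h x) μ = a * S.coef g μ + b * S.coef h μ := by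
  have hφ := memLp_wt (A := A) (S.continuousOn_φ μ)
  unfold coef
  rw [← integral_const_mul, ← integral_const_mul, ← integral_add]
  · congr 1; ext x; ring
  · exact (hg.integrable_mul hφ).const_mul a
  · exact (hh.integrable_mul hφ).const_mul b

lemma coef_sub {g h : ℝ → ℝ} (hg : MemLp g 2 A.wt) (hh : MemLp h 2 A.wt) (μ : A.Eig) :
    S.coef (g - h) μ = S.coef g μ - S.coef h μ := by
  have := S.coef_combo hg hh 1 (-1) μ
  rw [one_mul, neg_one_mul, ← sub_eq_add_neg] at this
  rw [← this]
  congr 1; ext x; simp; ring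

lemma ae_eq_zero_of_coef {g : ℝ → ℝ} (hg : MemLp g 2 A.wt) (H : ∀ μ, S.coef g μ = 0) :
    g =ᵐ[A.wt] 0 := by
  have h1 := S.hasSum_coef_sq hg
  simp only [H, ne_eq, OfNat.ofNat_ne_zero, not_false_eq_true, zero_pow] at h1
  have h2 : A.cls g = 0 := by simpa using h1.unique hasSum_zero
  have h3 := coeFn_cls hg
  rw [h2] at h3
  exact h3.symm.trans (Lp.coeFn_zero _ _ _)

lemma eqOn_of_coef {g h : ℝ → ℝ} (hg : ContinuousOn g (Icc 0 1)) (hh : ContinuousOn h (Icc 0 1))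
    (H : ∀ μ, S.coef g μ = S.coef h μ) : EqOn g h (Icc 0 1) := by
  have h1 := S.ae_eq_zero_of_coef ((memLp_wt (A := A) hg).sub (memLp_wt hh))
    (fun μ => by rw [S.coef_sub (memLp_wt hg) (memLp_wt hh), H, sub_self])
  refine eqOn_of_ae_wt (A := A) (h1.mono fun x hx => ?_) hg hh
  exact sub_eq_zero.1 hx

lemma coef_res {g : ℝ → ℝ} (hg : ContinuousOn g (Icc 0 1)) (μ : A.Eig) :
    S.coef (S.G.res g) μ = (S.ω μ)⁻¹ * S.coef g μ := by
  rw [S.coef_eq_inner (memLp_wt (S.G.continuousOn_res hg)), S.coef_eq_inner (memLp_wt hg),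
    ← S.G.resL_cls hg]
  rw [← Green.inner_resL_left, S.G.resL_eigenfunction (S.isEigenfunction_φ μ μ.2),
    real_inner_smul_left]
  rfl

lemma coef_op {g : ℝ → ℝ} (hg : A.MemDC2 g) (μ : A.Eig) :
    S.coef (A.op g) μ = μ * S.coef g μ := by
  have hc := continuousOn_op (A := A) hg.1
  have h1 := S.coef_congr (S.G.res_op_sub hg) μ
  rw [S.coef_res (S.G.continuousOn_op_sub hg.1)] at h1
  have h2 : S.coef (fun y => A.op g y - S.G.κ * g y) μ =
      S.coef (A.op g) μ - S.G.κ * S.coef g μ := by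
    have := S.coef_combo (memLp_wt hc) (memLp_wt hg.1.continuousOn) 1 (-S.G.κ) μ
    rw [one_mul] at this
    rw [sub_eq_add_neg, ← neg_mul, ← this]
    congr 1; ext x; ring
  have hω := (S.ω_pos μ).ne'
  rw [h2, eq_inv_mul_iff_mul_eq₀ hω] at h1
  unfold ω at h1
  linarith

lemma coef_φ (μ ν : A.Eig) : S.coef (S.φ ν) μ = if ν = μ then 1 else 0 := by
  classical
  rw [S.coef_eq_inner (memLp_wt (S.continuousOn_φ ν))]
  have := orthonormal_iff_ite.1 (S.G.orthonormal_eigenfunctions S.isEigenfunction_φ) μ ν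
  rw [this]
  simp only [eq_comm]

lemma coef_tsum {c : A.Eig → ℝ} (hc : Summable fun μ => |c μ| * supAbs (S.φ μ)) (μ : A.Eig) :
    S.coef (fun x => ∑' ν, c ν * S.φ ν x) μ = c μ := by
  have := S.countable_eig
  obtain ⟨C, -, hb⟩ := exists_abs_le_of_continuousOn (S.continuousOn_φ μ)
  have hcont : ∀ ν, ContinuousOn (fun x => c ν * (S.φ ν x * S.φ μ x)) (Icc 0 1) := fun ν =>
    continuousOn_const.mul ((S.continuousOn_φ ν).mul (S.continuousOn_φ μ))
  have hsum : Summable fun ν => ∫ x, ‖c ν * (S.φ ν x * S.φ μ x)‖ ∂A.wt := by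
    refine (hc.mul_right (∫ _, C ∂A.wt)).of_nonneg_of_le
      (fun ν => integral_nonneg fun x => norm_nonneg _) fun ν => ?_
    rw [← integral_const_mul]
    refine integral_mono_ae (integrable_wt (hcont ν)).norm (integrable_const _) ?_
    filter_upwards [A.ae_wt_mem] with x hx
    rw [norm_mul, norm_mul, ← mul_assoc]
    exact mul_le_mul (mul_le_mul_of_nonneg_left (abs_le_supAbs (S.continuousOn_φ ν) hx)
      (abs_nonneg _)) (hb x hx) (norm_nonneg _) (mul_nonneg (abs_nonneg _) (supAbs_nonneg _))
  have horth : ∀ ν, ∫ x, c ν * (S.φ ν x * S.φ μ x) ∂A.wt = if ν = μ then c ν else 0 := fun ν => by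
    rw [integral_const_mul, ← coef, S.coef_φ, mul_ite, mul_one, mul_zero]
  calc S.coef (fun x => ∑' ν, c ν * S.φ ν x) μ
      = ∫ x, ∑' ν, c ν * (S.φ ν x * S.φ μ x) ∂A.wt := by
        simp only [coef, ← tsum_mul_right, mul_assoc]
    _ = ∑' ν, ∫ x, c ν * (S.φ ν x * S.φ μ x) ∂A.wt :=
        (integral_tsum_of_summable_integral_norm (fun ν => integrable_wt (hcont ν)) hsum).symm
    _ = c μ := by simp only [horth, tsum_ite_eq]

end Spectral

end SLData

/-! ### Mode equations -/

lemma sub_le_of_deriv_le {Y B Y' B' : ℝ → ℝ} {a b : ℝ} (hY : ContinuousOn Y (Icc a b))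
    (hB : ContinuousOn B (Icc a b)) (hY' : ∀ t ∈ Ioo a b, HasDerivAt Y (Y' t) t)
    (hB' : ∀ t ∈ Ioo a b, HasDerivAt B (B' t) t) (h : ∀ t ∈ Ioo a b, Y' t ≤ B' t) {t : ℝ}
    (ht : t ∈ Icc a b) : Y t - Y a ≤ B t - B a := by
  have hmono : MonotoneOn (B - Y) (Icc a b) := by
    refine monotoneOn_of_deriv_nonneg (convex_Icc a b) (hB.sub hY) ?_ ?_ <;> rw [interior_Icc]
    · exact fun x hx => ((hB' x hx).sub (hY' x hx)).differentiableAt.differentiableWithinAt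
    · exact fun x hx => ((hB' x hx).sub (hY' x hx)).deriv.symm ▸ sub_nonneg.2 (h x hx)
  have := hmono (left_mem_Icc.2 (ht.1.trans ht.2)) ht ht.1
  simp only [Pi.sub_apply] at this
  linarith

lemma abs_le_add_of_abs_deriv_le {Y B Y' B' : ℝ → ℝ} {a b : ℝ} (hY : ContinuousOn Y (Icc a b))
    (hB : ContinuousOn B (Icc a b)) (hY' : ∀ t ∈ Ioo a b, HasDerivAt Y (Y' t) t)
    (hB' : ∀ t ∈ Ioo a b, HasDerivAt B (B' t) t) (h : ∀ t ∈ Ioo a b, |Y' t| ≤ B' t) {t : ℝ}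
    (ht : t ∈ Icc a b) : |Y t| ≤ |Y a| + (B t - B a) := by
  have hpos := sub_le_of_deriv_le hY hB hY' hB' (fun t ht => (le_abs_self _).trans (h t ht)) ht
  have hneg := sub_le_of_deriv_le hY.neg hB (fun t ht => (hY' t ht).neg) hB'
    (fun t ht => (neg_le_abs _).trans (h t ht)) ht
  simp only [Pi.neg_apply] at hneg
  rw [abs_le]
  constructor
  · linarith [neg_abs_le (Y a)]
  · linarith [le_abs_self (Y a)]

lemma hasDerivAt_exp_mul_sub (ν a t : ℝ) :
    HasDerivAt (fun t => Real.exp (ν * (t - a))) (ν * Real.exp (ν * (t - a))) t :=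
  (((hasDerivAt_id t).sub_const a).const_mul ν).exp.congr_deriv (by simp [mul_comm])

lemma abs_le_of_mode {y g : ℝ → ℝ} {a b μ κ M : ℝ} (hκ : κ ≤ 0) (hω : 0 < μ - κ) (hM : 0 ≤ M)
    (hy : ContinuousOn y (Icc a b)) (hy' : ∀ t ∈ Ioo a b, HasDerivAt y (-μ * y t + g t) t)
    (hg : ∀ t ∈ Ioo a b, |g t| ≤ M) {t : ℝ} (ht : t ∈ Icc a b) :
    |y t| ≤ Real.exp (-κ * (t - a)) * (Real.exp (-(μ - κ) * (t - a)) * |y a| + M / (μ - κ)) := by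
  let Y : ℝ → ℝ := fun t => Real.exp (μ * (t - a)) * y t
  let B : ℝ → ℝ := fun t => M / (μ - κ) * Real.exp ((μ - κ) * (t - a))
  have hY' : ∀ t ∈ Ioo a b, HasDerivAt Y (Real.exp (μ * (t - a)) * g t) t := fun t ht =>
    ((hasDerivAt_exp_mul_sub μ a t).mul (hy' t ht)).congr_deriv (by ring)
  have hB' : ∀ t ∈ Ioo a b, HasDerivAt B (M * Real.exp ((μ - κ) * (t - a))) t := fun t _ =>
    ((hasDerivAt_exp_mul_sub (μ - κ) a t).const_mul (M / (μ - κ))).congr_deriv (by field_simp)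
  have hle : ∀ t ∈ Ioo a b, |Real.exp (μ * (t - a)) * g t| ≤ M * Real.exp ((μ - κ) * (t - a)) := by
    intro t ht
    rw [abs_mul, Real.abs_exp, mul_comm]
    refine mul_le_mul (hg t ht) (Real.exp_le_exp.2 ?_) (Real.exp_pos _).le hM
    nlinarith [ht.1]
  have hYt : |Y t| ≤ |y a| + B t := by
    have hYB := abs_le_add_of_abs_deriv_le (Y := Y) (B := B) (ContinuousOn.mul (by fun_prop) hy)
      (by fun_prop) hY' hB' hle ht
    have hYa : Y a = y a := by simp [Y]
    have hBa : 0 ≤ B a := mul_nonneg (div_nonneg hM hω.le) (Real.exp_pos _).le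
    rw [hYa] at hYB
    linarith
  have hexp : Real.exp (-μ * (t - a)) =
      Real.exp (-κ * (t - a)) * Real.exp (-(μ - κ) * (t - a)) := by
    rw [← Real.exp_add]; ring_nf
  calc |y t| = Real.exp (-μ * (t - a)) * |Y t| := by
        rw [abs_mul, Real.abs_exp, ← mul_assoc, ← Real.exp_add]
        simp
    _ ≤ Real.exp (-μ * (t - a)) * (|y a| + B t) := by gcongr
    _ = Real.exp (-κ * (t - a)) * (Real.exp (-(μ - κ) * (t - a)) * |y a| + M / (μ - κ) *
          (Real.exp (-(μ - κ) * (t - a)) * Real.exp ((μ - κ) * (t - a)))) := by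
        rw [hexp]; ring
    _ = _ := by
        rw [← Real.exp_add, neg_mul (μ - κ), neg_add_cancel, Real.exp_zero, mul_one]

lemma integrableOn_of_continuousOn_of_abs_le {h : ℝ → ℝ} {s T M : ℝ}
    (hh : ContinuousOn h (Ioc s T)) (hM : ∀ t ∈ Ioc s T, |h t| ≤ M) : IntegrableOn h (Ioc s T) :=
  Integrable.of_bound (hh.aestronglyMeasurable measurableSet_Ioc) M
    ((ae_restrict_mem measurableSet_Ioc).mono fun t ht => hM t ht)

lemma exists_mode {h : ℝ → ℝ} {s T M : ℝ} (hsT : s < T) (hh : ContinuousOn h (Ioc s T))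
    (hM : ∀ t ∈ Ioc s T, |h t| ≤ M) (μ c₀ : ℝ) :
    ∃ c : ℝ → ℝ, c s = c₀ ∧ ContinuousOn c (Icc s T) ∧
      ∀ t ∈ Ioo s T, HasDerivAt c (-μ * c t + h t) t := by
  let w : ℝ → ℝ := fun σ => Real.exp (μ * (σ - s)) * h σ
  have hw : ContinuousOn w (Ioc s T) := ContinuousOn.mul (by fun_prop) hh
  have hwi : IntervalIntegrable w volume s T := by
    obtain ⟨C, -, hC⟩ := exists_abs_le_of_continuousOn
      (show ContinuousOn (fun σ => Real.exp (μ * (σ - s))) (Icc s T) by fun_prop)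
    refine (intervalIntegrable_iff_integrableOn_Ioc_of_le hsT.le).2
      (integrableOn_of_continuousOn_of_abs_le (M := C * M) hw fun t ht => ?_)
    have hCt := hC t (Ioc_subset_Icc_self ht)
    rw [abs_mul]
    exact mul_le_mul hCt (hM t ht) (abs_nonneg _) ((abs_nonneg _).trans hCt)
  refine ⟨fun t => Real.exp (-μ * (t - s)) * (c₀ + ∫ σ in s..t, w σ), by simp, ?_, fun t ht => ?_⟩
  · refine ContinuousOn.mul (by fun_prop) (continuousOn_const.add ?_)
    simpa only [uIcc_of_le hsT.le] using
      intervalIntegral.continuousOn_primitive_interval' hwi left_mem_uIcc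
  · have hwo := hw.mono Ioo_subset_Ioc_self
    have hprim : HasDerivAt (fun t => ∫ σ in s..t, w σ) (w t) t := by
      refine intervalIntegral.integral_hasDerivAt_right (hwi.mono_set ?_)
        (hwo.stronglyMeasurableAtFilter isOpen_Ioo t ht)
        (hwo.continuousAt (Ioo_mem_nhds ht.1 ht.2))
      rw [uIcc_of_le ht.1.le, uIcc_of_le hsT.le]
      exact Icc_subset_Icc_right ht.2.le
    refine ((hasDerivAt_exp_mul_sub (-μ) s t).mul (hprim.const_add c₀)).congr_deriv ?_
    have hinv : Real.exp (-μ * (t - s)) * Real.exp (μ * (t - s)) = 1 := by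
      rw [← Real.exp_add]; simp
    linear_combination h t * hinv

lemma exp_neg_le_inv {x : ℝ} (hx : 0 < x) : Real.exp (-x) ≤ x⁻¹ := by
  rw [Real.exp_neg]
  exact inv_anti₀ hx (by linarith [Real.add_one_le_exp x])

lemma exp_neg_le_inv_sq {x : ℝ} (hx : 0 < x) : Real.exp (-x) ≤ 2 * (x⁻¹) ^ 2 := by
  rw [Real.exp_neg, show (2 : ℝ) * (x⁻¹) ^ 2 = (x ^ 2 / 2)⁻¹ by field_simp]
  exact inv_anti₀ (by positivity) (by linarith [Real.quadratic_le_exp_of_nonneg hx.le])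

/-- A solution `c` of the mode equation `c' = -μ c + h₁ + h₂` on `(s, T)`, with a uniform bound
`C₀` at time `s`, a source `h₁` bounded by `M` whose derivative `h₁'` is bounded by `M'` after
time `s₁`, and a source `h₂` bounded by `M / (μ - κ)`. -/
structure IsMode (s s₁ T κ C₀ M M' μ : ℝ) (c h₁ h₂ h₁' : ℝ → ℝ) : Prop where
  one_le : 1 ≤ μ - κ
  abs_initial_le : |c s| ≤ C₀
  continuousOn : ContinuousOn c (Icc s T)
  continuousOn_source : ContinuousOn h₁ (Ioc s T)
  hasDerivAt : ∀ t ∈ Ioo s T, HasDerivAt c (-μ * c t + (h₁ t + h₂ t)) t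
  abs_source_le : ∀ t ∈ Ioc s T, |h₁ t| ≤ M
  abs_source_le_inv : ∀ t ∈ Ioc s T, |h₂ t| ≤ M * (μ - κ)⁻¹
  hasDerivAt_source : ∀ t ∈ Ioo s₁ T, HasDerivAt h₁ (h₁' t) t
  abs_deriv_source_le : ∀ t ∈ Ioo s₁ T, |h₁' t| ≤ M'

namespace IsMode

variable {s s₁ s₂ T κ C₀ M M' : ℝ}

lemma exists_abs_le (h01 : s < s₁) (hκ : κ ≤ 0) (hC₀ : 0 ≤ C₀) (hM : 0 ≤ M) :
    ∃ C, 0 ≤ C ∧ ∀ {μ : ℝ} {c h₁ h₂ h₁' : ℝ → ℝ}, IsMode s s₁ T κ C₀ M M' μ c h₁ h₂ h₁' →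
      ∀ t ∈ Icc s₁ T, |c t| ≤ C * (μ - κ)⁻¹ := by
  have hδ : 0 < s₁ - s := sub_pos.2 h01
  refine ⟨Real.exp (-κ * (T - s)) * ((s₁ - s)⁻¹ * C₀ + (M + M)), by positivity, ?_⟩
  intro μ c h₁ h₂ h₁' hc t ht
  have hω : 0 < μ - κ := zero_lt_one.trans_le hc.one_le
  have hsource : ∀ t ∈ Ioo s T, |h₁ t + h₂ t| ≤ M + M := fun t ht =>
    (abs_add_le _ _).trans (add_le_add (hc.abs_source_le t (Ioo_subset_Ioc_self ht))
      ((hc.abs_source_le_inv t (Ioo_subset_Ioc_self ht)).trans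
        (mul_le_of_le_one_right hM (inv_le_one_of_one_le₀ hc.one_le))))
  have hdecay : Real.exp (-(μ - κ) * (t - s)) ≤ (s₁ - s)⁻¹ * (μ - κ)⁻¹ := by
    refine (Real.exp_le_exp.2 ?_).trans
      ((exp_neg_le_inv (mul_pos hω hδ)).trans_eq ?_)
    · nlinarith [ht.1]
    · rw [mul_inv, mul_comm]
  calc |c t| ≤ Real.exp (-κ * (t - s)) *
        (Real.exp (-(μ - κ) * (t - s)) * |c s| + (M + M) / (μ - κ)) :=
        abs_le_of_mode hκ hω (by positivity) hc.continuousOn hc.hasDerivAt hsource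
          ⟨h01.le.trans ht.1, ht.2⟩
    _ ≤ Real.exp (-κ * (T - s)) *
        ((s₁ - s)⁻¹ * (μ - κ)⁻¹ * C₀ + (M + M) / (μ - κ)) := by
        gcongr
        · linarith
        · exact ht.2
        · exact hc.abs_initial_le
    _ = _ := by ring

lemma hasDerivAt_corrected {μ : ℝ} {c h₁ h₂ h₁' : ℝ → ℝ}
    (hc : IsMode s s₁ T κ C₀ M M' μ c h₁ h₂ h₁') (h01 : s ≤ s₁) {t : ℝ} (ht : t ∈ Ioo s₁ T) :
    HasDerivAt (fun t => c t - (μ - κ)⁻¹ * h₁ t) (-μ * (c t - (μ - κ)⁻¹ * h₁ t) +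
      (-κ * h₁ t * (μ - κ)⁻¹ + h₂ t - (μ - κ)⁻¹ * h₁' t)) t := by
  have hω : μ - κ ≠ 0 := (zero_lt_one.trans_le hc.one_le).ne'
  refine ((hc.hasDerivAt t ⟨h01.trans_lt ht.1, ht.2⟩).sub
    ((hc.hasDerivAt_source t ht).const_mul (μ - κ)⁻¹)).congr_deriv ?_
  field_simp
  ring

lemma abs_corrected_source_le {μ : ℝ} {c h₁ h₂ h₁' : ℝ → ℝ}
    (hc : IsMode s s₁ T κ C₀ M M' μ c h₁ h₂ h₁') (h01 : s ≤ s₁) (hκ : κ ≤ 0) {t : ℝ}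
    (ht : t ∈ Ioo s₁ T) : |-κ * h₁ t * (μ - κ)⁻¹ + h₂ t - (μ - κ)⁻¹ * h₁' t| ≤
      (-κ * M + M + M') * (μ - κ)⁻¹ := by
  have hω : 0 < (μ - κ)⁻¹ := inv_pos.2 (zero_lt_one.trans_le hc.one_le)
  have ht' : t ∈ Ioc s T := ⟨h01.trans_lt ht.1, ht.2.le⟩
  have hκ' : 0 ≤ -κ := neg_nonneg.2 hκ
  calc _ ≤ |-κ * h₁ t * (μ - κ)⁻¹| + |h₂ t| + |(μ - κ)⁻¹ * h₁' t| :=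
        (abs_sub _ _).trans (add_le_add_left (abs_add_le _ _) _)
    _ ≤ -κ * M * (μ - κ)⁻¹ + M * (μ - κ)⁻¹ + (μ - κ)⁻¹ * M' := by
        rw [abs_mul, abs_mul, abs_mul, abs_of_nonneg hκ', abs_of_pos hω]
        gcongr
        · exact hc.abs_source_le t ht'
        · exact hc.abs_source_le_inv t ht'
        · exact hc.abs_deriv_source_le t ht
    _ = _ := by ring

/-- Subtracting `h₁ / (μ - κ)` turns the source into one of size `1 / (μ - κ)`, which gains a
second power of `μ - κ`. -/
lemma exists_abs_corrected_le (h01 : s < s₁) (h12 : s₁ < s₂) (hκ : κ ≤ 0) (hC₀ : 0 ≤ C₀)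
    (hM : 0 ≤ M) (hM' : 0 ≤ M') :
    ∃ C, 0 ≤ C ∧ ∀ {μ : ℝ} {c h₁ h₂ h₁' : ℝ → ℝ}, IsMode s s₁ T κ C₀ M M' μ c h₁ h₂ h₁' →
      ∀ t ∈ Icc s₂ T, |c t - (μ - κ)⁻¹ * h₁ t| ≤ C * ((μ - κ)⁻¹) ^ 2 := by
  obtain ⟨C₁, hC₁, hb⟩ := exists_abs_le (T := T) (M' := M') h01 hκ hC₀ hM
  have hδ : 0 < s₂ - s₁ := sub_pos.2 h12
  have hκ' : 0 ≤ -κ := neg_nonneg.2 hκ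
  refine ⟨Real.exp (-κ * (T - s)) * (2 * ((s₂ - s₁)⁻¹) ^ 2 * (C₁ + M) + (-κ * M + M + M')),
    by positivity, ?_⟩
  intro μ c h₁ h₂ h₁' hc t ht
  have hω : 0 < μ - κ := zero_lt_one.trans_le hc.one_le
  have hω1 : (μ - κ)⁻¹ ≤ 1 := inv_le_one_of_one_le₀ hc.one_le
  have hsT : s₁ ≤ T := h12.le.trans (ht.1.trans ht.2)
  have hcont : ContinuousOn (fun t => c t - (μ - κ)⁻¹ * h₁ t) (Icc s₁ T) :=
    (hc.continuousOn.mono (Icc_subset_Icc_left h01.le)).sub (continuousOn_const.mul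
      (hc.continuousOn_source.mono fun x hx => ⟨h01.trans_le hx.1, hx.2⟩))
  have hinitial : |c s₁ - (μ - κ)⁻¹ * h₁ s₁| ≤ C₁ + M := by
    refine (abs_sub _ _).trans (add_le_add ((hb hc s₁ ⟨le_rfl, hsT⟩).trans
      (mul_le_of_le_one_right hC₁ hω1)) ?_)
    rw [abs_mul, abs_of_pos (inv_pos.2 hω)]
    exact (mul_le_of_le_one_left (abs_nonneg _) hω1).trans (hc.abs_source_le s₁ ⟨h01, hsT⟩)
  have hdecay : Real.exp (-(μ - κ) * (t - s₁)) ≤ 2 * ((s₂ - s₁)⁻¹) ^ 2 * ((μ - κ)⁻¹) ^ 2 := by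
    refine (Real.exp_le_exp.2 ?_).trans
      ((exp_neg_le_inv_sq (mul_pos hω hδ)).trans_eq ?_)
    · nlinarith [ht.1]
    · rw [mul_inv]; ring
  calc |c t - (μ - κ)⁻¹ * h₁ t| ≤ Real.exp (-κ * (t - s₁)) *
        (Real.exp (-(μ - κ) * (t - s₁)) * |c s₁ - (μ - κ)⁻¹ * h₁ s₁| +
          (-κ * M + M + M') * (μ - κ)⁻¹ / (μ - κ)) :=
        abs_le_of_mode hκ hω (by positivity) hcont (fun t => hc.hasDerivAt_corrected h01.le)
          (fun t => hc.abs_corrected_source_le h01.le hκ) ⟨h12.le.trans ht.1, ht.2⟩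
    _ ≤ Real.exp (-κ * (T - s)) * (2 * ((s₂ - s₁)⁻¹) ^ 2 * ((μ - κ)⁻¹) ^ 2 * (C₁ + M) +
          (-κ * M + M + M') * (μ - κ)⁻¹ / (μ - κ)) := by
        gcongr
        exact ht.2
    _ = _ := by ring

lemma exists_abs_deriv_le (h01 : s < s₁) (h12 : s₁ < s₂) (hκ : κ ≤ 0) (hC₀ : 0 ≤ C₀)
    (hM : 0 ≤ M) (hM' : 0 ≤ M') :
    ∃ C, 0 ≤ C ∧ ∀ {μ : ℝ} {c h₁ h₂ h₁' : ℝ → ℝ}, IsMode s s₁ T κ C₀ M M' μ c h₁ h₂ h₁' →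
      ∀ t ∈ Icc s₂ T, |-μ * c t + (h₁ t + h₂ t)| ≤ C * (μ - κ)⁻¹ := by
  obtain ⟨C₂, hC₂, hb⟩ := exists_abs_corrected_le (T := T) h01 h12 hκ hC₀ hM hM'
  have hκ' : 0 ≤ -κ := neg_nonneg.2 hκ
  refine ⟨(1 + -κ) * C₂ + (-κ * M + M), by positivity, ?_⟩
  intro μ c h₁ h₂ h₁' hc t ht
  have hω : 0 < μ - κ := zero_lt_one.trans_le hc.one_le
  have ht' : t ∈ Ioc s T := ⟨h01.trans (h12.trans_le ht.1), ht.2⟩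
  have hμ : |μ| ≤ (1 + -κ) * (μ - κ) := by
    rw [abs_le]
    constructor <;> nlinarith [hc.one_le]
  calc |-μ * c t + (h₁ t + h₂ t)|
      = |-μ * (c t - (μ - κ)⁻¹ * h₁ t) + -κ * h₁ t * (μ - κ)⁻¹ + h₂ t| := by
        congr 1
        field_simp
        ring
    _ ≤ |-μ * (c t - (μ - κ)⁻¹ * h₁ t)| + |-κ * h₁ t * (μ - κ)⁻¹| + |h₂ t| :=
        (abs_add_le _ _).trans (add_le_add_left (abs_add_le _ _) _)
    _ ≤ (1 + -κ) * (μ - κ) * (C₂ * ((μ - κ)⁻¹) ^ 2) + -κ * M * (μ - κ)⁻¹ + M * (μ - κ)⁻¹ := by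
        rw [abs_mul, abs_mul, abs_mul, abs_neg, abs_of_nonneg hκ', abs_of_pos (inv_pos.2 hω)]
        gcongr
        · exact hb hc t ht
        · exact hc.abs_source_le t ht'
        · exact hc.abs_source_le_inv t ht'
    _ = _ := by
        field_simp
        ring

end IsMode

/-! ### Eigenfunction series -/

section UnitStrip

variable {F : ℝ → ℝ → ℝ} {J : Set ℝ}

lemma continuousOn_slice (hF : ContinuousOn (fun z : ℝ × ℝ => F z.1 z.2) (J ×ˢ Icc 0 1)) {t : ℝ}
    (ht : t ∈ J) : ContinuousOn (F t) (Icc 0 1) :=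
  hF.comp (f := fun x : ℝ => (t, x)) (by fun_prop) fun _ hx => ⟨ht, hx⟩

lemma continuousOn_time (hF : ContinuousOn (fun z : ℝ × ℝ => F z.1 z.2) (J ×ˢ Icc 0 1)) {x : ℝ}
    (hx : x ∈ Icc (0 : ℝ) 1) : ContinuousOn (fun t => F t x) J :=
  hF.comp (f := fun t : ℝ => (t, x)) (by fun_prop) fun _ ht => ⟨ht, hx⟩

lemma continuousOn_mul_strip {D g : ℝ → ℝ} (hD : ContinuousOn D J)
    (hg : ContinuousOn g (Icc 0 1)) :
    ContinuousOn (fun z : ℝ × ℝ => D z.1 * g z.2) (J ×ˢ Icc 0 1) :=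
  (hD.comp continuousOn_fst fun _ hz => hz.1).mul (hg.comp continuousOn_snd fun _ hz => hz.2)

lemma exists_abs_le_of_continuousOn_strip {a b : ℝ}
    (hF : ContinuousOn (fun z : ℝ × ℝ => F z.1 z.2) (Icc a b ×ˢ Icc 0 1)) :
    ∃ C, 0 < C ∧ ∀ t ∈ Icc a b, ∀ x ∈ Icc (0 : ℝ) 1, |F t x| ≤ C := by
  obtain ⟨C, hC⟩ := (isCompact_Icc.prod isCompact_Icc).exists_bound_of_continuousOn hF
  exact ⟨max C 1, by positivity, fun t ht x hx => (hC (t, x) ⟨ht, hx⟩).trans (le_max_left _ _)⟩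

end UnitStrip

namespace SLData

variable {A : SLData}

lemma continuousOn_cls {F : ℝ → ℝ → ℝ} {J : Set ℝ}
    (hF : ContinuousOn (fun z : ℝ × ℝ => F z.1 z.2) (J ×ˢ Icc 0 1)) :
    ContinuousOn (fun t => A.cls (F t)) J := by
  have hc : Continuous (fun z : J × Icc (0 : ℝ) 1 => F z.1 z.2) :=
    hF.comp_continuous (f := fun z : J × Icc (0 : ℝ) 1 => ((z.1 : ℝ), (z.2 : ℝ)))
      (by fun_prop) fun z => ⟨z.1.2, z.2.2⟩
  rw [continuousOn_iff_continuous_domRestrict]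
  exact (A.ofCont.continuous.comp (ContinuousMap.curry ⟨_, hc⟩).continuous).congr fun t =>
    A.ofCont_eq_cls fun _ => rfl

lemma eLpNorm_sub_eq {g h : ℝ → ℝ} (hg : MemLp g 2 A.wt) (hh : MemLp h 2 A.wt) :
    eLpNorm (g - h) 2 A.wt = ENNReal.ofReal ‖A.cls g - A.cls h‖ := by
  rw [← cls_sub hg hh, cls_of_memLp (hg.sub hh), Lp.norm_toLp,
    ENNReal.ofReal_toReal (hg.sub hh).eLpNorm_ne_top]

lemma tendsto_eLpNorm_iff {ι : Type*} {l : Filter ι} {u : ι → ℝ → ℝ} {g : ℝ → ℝ}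
    (hu : ∀ᶠ t in l, MemLp (u t) 2 A.wt) (hg : MemLp g 2 A.wt) :
    Tendsto (fun t => eLpNorm (u t - g) 2 A.wt) l (𝓝 0) ↔
      Tendsto (fun t => A.cls (u t)) l (𝓝 (A.cls g)) := by
  have hnorm : (fun t => eLpNorm (u t - g) 2 A.wt) =ᶠ[l]
      fun t => ENNReal.ofReal ‖A.cls (u t) - A.cls g‖ :=
    hu.mono fun t ht => eLpNorm_sub_eq ht hg
  rw [tendsto_iff_norm_sub_tendsto_zero, tendsto_congr' hnorm]
  refine ⟨fun h => ?_, fun h => ?_⟩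
  · simpa [Function.comp_def] using (ENNReal.tendsto_toReal ENNReal.zero_ne_top).comp h
  · simpa using ENNReal.tendsto_ofReal h

lemma cls_add {g h : ℝ → ℝ} (hg : MemLp g 2 A.wt) (hh : MemLp h 2 A.wt) :
    A.cls (g + h) = A.cls g + A.cls h := by
  rw [cls_of_memLp hg, cls_of_memLp hh, cls_of_memLp (hg.add hh), MemLp.toLp_add]

lemma cls_op_sub {g : ℝ → ℝ} (hg : ContDiffOn ℝ 2 g (Icc 0 1)) (κ : ℝ) :
    A.cls (fun y => A.op g y - κ * g y) = A.cls (A.op g) - κ • A.cls g := by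
  have hg2 := memLp_wt (A := A) hg.continuousOn
  rw [← cls_smul hg2, ← cls_sub (memLp_wt (continuousOn_op hg)) (hg2.const_mul κ)]
  rfl

lemma norm_cls_op_sub_le {g : ℝ → ℝ} (hg : ContDiffOn ℝ 2 g (Icc 0 1)) (κ : ℝ) :
    ‖A.cls (fun y => A.op g y - κ * g y)‖ ≤ ‖A.cls (A.op g)‖ + |κ| * ‖A.cls g‖ := by
  rw [cls_op_sub hg, ← Real.norm_eq_abs, ← norm_smul]
  exact norm_sub_le _ _

namespace Spectral

variable (S : A.Spectral)

lemma continuousOn_coef {F : ℝ → ℝ → ℝ} {J : Set ℝ}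
    (hF : ContinuousOn (fun z : ℝ × ℝ => F z.1 z.2) (J ×ˢ Icc 0 1)) (μ : A.Eig) :
    ContinuousOn (fun t => S.coef (F t) μ) J :=
  (ContinuousOn.inner (𝕜 := ℝ) continuousOn_const (continuousOn_cls hF)).congr fun _ ht =>
    S.coef_eq_inner (memLp_wt (continuousOn_slice hF ht)) μ

lemma coef_add {g h : ℝ → ℝ} (hg : MemLp g 2 A.wt) (hh : MemLp h 2 A.wt) (μ : A.Eig) :
    S.coef (fun x => g x + h x) μ = S.coef g μ + S.coef h μ := by
  simpa using S.coef_combo hg hh 1 1 μ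

lemma abs_coef_le_of_memDC2 {g : ℝ → ℝ} (hg : A.MemDC2 g) (μ : A.Eig) :
    |S.coef g μ| ≤ (‖A.cls (A.op g)‖ + |S.G.κ| * ‖A.cls g‖) * (S.ω μ)⁻¹ := by
  have hF := S.G.continuousOn_op_sub hg.1
  have hω := inv_pos.2 (S.ω_pos μ)
  rw [S.coef_congr (S.G.res_op_sub hg) μ, S.coef_res hF, abs_mul, abs_of_pos hω, mul_comm]
  exact mul_le_mul_of_nonneg_right
    ((S.abs_coef_le (memLp_wt hF) μ).trans (norm_cls_op_sub_le hg.1 _)) hω.le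

lemma hasDerivAt_coef {g g' : ℝ → ℝ → ℝ} {s T : ℝ}
    (hg : ContinuousOn (fun z : ℝ × ℝ => g z.1 z.2) (Ioo s T ×ˢ Icc 0 1))
    (hg' : ContinuousOn (fun z : ℝ × ℝ => g' z.1 z.2) (Ioo s T ×ˢ Icc 0 1))
    (hd : ∀ t ∈ Ioo s T, ∀ x ∈ Icc (0 : ℝ) 1, HasDerivAt (fun t => g t x) (g' t x) t)
    (μ : A.Eig) {t : ℝ} (ht : t ∈ Ioo s T) :
    HasDerivAt (fun t => S.coef (g t) μ) (S.coef (g' t) μ) t := by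
  obtain ⟨a, ha1, ha2⟩ := exists_between ht.1
  obtain ⟨b, hb1, hb2⟩ := exists_between ht.2
  have hsub : Icc a b ⊆ Ioo s T := fun x hx => ⟨ha1.trans_le hx.1, hx.2.trans_lt hb2⟩
  obtain ⟨C, hC, hbC⟩ := exists_abs_le_of_continuousOn_strip
    (hg'.mono (prod_mono hsub (Subset.refl _)))
  obtain ⟨C', -, hbC'⟩ := exists_abs_le_of_continuousOn (S.continuousOn_φ μ)
  have hmul : ∀ {f : ℝ → ℝ}, ContinuousOn f (Icc 0 1) →
      ContinuousOn (fun x => f x * S.φ μ x) (Icc 0 1) := fun hf => hf.mul (S.continuousOn_φ μ)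
  refine (hasDerivAt_integral_of_dominated_loc_of_deriv_le (μ := A.wt)
    (F := fun t x => g t x * S.φ μ x) (F' := fun t x => g' t x * S.φ μ x)
    (bound := fun _ => C * C') (Ioo_mem_nhds ha2 hb1) ?_ ?_ ?_ ?_ (integrable_const _) ?_).2
  · filter_upwards [Ioo_mem_nhds ht.1 ht.2] with τ hτ
    exact aestronglyMeasurable_wt (hmul (continuousOn_slice hg hτ))
  · exact integrable_wt (hmul (continuousOn_slice hg ht))
  · exact aestronglyMeasurable_wt (hmul (continuousOn_slice hg' ht))
  · filter_upwards [A.ae_wt_mem] with x hx τ hτ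
    rw [norm_mul]
    exact mul_le_mul (hbC τ (Ioo_subset_Icc_self hτ) x hx) (hbC' x hx) (abs_nonneg _) hC.le
  · filter_upwards [A.ae_wt_mem] with x hx τ hτ
    exact (hd τ (hsub (Ioo_subset_Icc_self hτ)) x hx).mul_const _

/-- Time-dependent coefficients that are `O(1/ω)` locally uniformly on `(s, T]`; by (H) their
eigenfunction series converge locally uniformly. -/
structure Decays (s T : ℝ) (c : A.Eig → ℝ → ℝ) : Prop where
  continuousOn : ∀ μ, ContinuousOn (c μ) (Ioc s T)
  exists_abs_le : ∀ s₂ ∈ Ioo s T, ∃ C, 0 ≤ C ∧ ∀ μ, ∀ t ∈ Icc s₂ T, |c μ t| ≤ C * (S.ω μ)⁻¹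

/-- The function `∑ c_μ(t) φ_μ(x)` with the time-dependent coefficients `c`. -/
def series (c : A.Eig → ℝ → ℝ) (t x : ℝ) : ℝ := ∑' μ, c μ t * S.φ μ x

variable {S}

lemma abs_mul_φ_le {a C : ℝ} {μ : A.Eig} (hC : 0 ≤ C) (ha : |a| ≤ C * (S.ω μ)⁻¹) {x : ℝ}
    (hx : x ∈ Icc (0 : ℝ) 1) : ‖a * S.φ μ x‖ ≤ C * ((S.ω μ)⁻¹ * supAbs (S.φ μ)) := by
  rw [norm_mul, ← mul_assoc]
  exact mul_le_mul ha (abs_le_supAbs (S.continuousOn_φ μ) hx) (abs_nonneg _)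
    (mul_nonneg hC (inv_nonneg.2 (S.ω_pos μ).le))

namespace Decays

variable {s T : ℝ} {c c' : A.Eig → ℝ → ℝ}

lemma continuousOn_series (hc : S.Decays s T c) :
    ContinuousOn (fun z : ℝ × ℝ => S.series c z.1 z.2) (Ioc s T ×ˢ Icc 0 1) := by
  rintro ⟨t, x⟩ ⟨ht, hx⟩
  obtain ⟨s₂, hs₂, hs₂t⟩ := exists_between ht.1
  obtain ⟨C, hC, hbC⟩ := hc.exists_abs_le s₂ ⟨hs₂, hs₂t.trans_le ht.2⟩
  have hcont : ContinuousOn (fun z : ℝ × ℝ => S.series c z.1 z.2) (Icc s₂ T ×ˢ Icc 0 1) :=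
    continuousOn_tsum
      (fun μ => continuousOn_mul_strip ((hc.continuousOn μ).mono fun t ht =>
        ⟨hs₂.trans_le ht.1, ht.2⟩) (S.continuousOn_φ μ))
      (S.summable_inv_ω_mul.mul_left C) fun μ z hz => abs_mul_φ_le hC (hbC μ z.1 hz.1) hz.2
  refine (hcont (t, x) ⟨⟨hs₂t.le, ht.2⟩, hx⟩).mono_of_mem_nhdsWithin ?_
  have hnhds : (Ioi s₂ ×ˢ (univ : Set ℝ)) ∈ 𝓝 (t, x) :=
    prod_mem_nhds (Ioi_mem_nhds hs₂t) univ_mem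
  filter_upwards [mem_nhdsWithin_of_mem_nhds hnhds, self_mem_nhdsWithin] with z hz₁ hz₂
  exact ⟨⟨le_of_lt hz₁.1, hz₂.1.2⟩, hz₂.2⟩

lemma exists_abs_le_at (hc : S.Decays s T c) {t : ℝ} (ht : t ∈ Ioc s T) :
    ∃ C, 0 ≤ C ∧ ∀ μ, |c μ t| ≤ C * (S.ω μ)⁻¹ := by
  obtain ⟨s₂, hs₂, hs₂t⟩ := exists_between ht.1
  obtain ⟨C, hC, hbC⟩ := hc.exists_abs_le s₂ ⟨hs₂, hs₂t.trans_le ht.2⟩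
  exact ⟨C, hC, fun μ => hbC μ t ⟨hs₂t.le, ht.2⟩⟩

lemma coef_series (hc : S.Decays s T c) {t : ℝ} (ht : t ∈ Ioc s T) (μ : A.Eig) :
    S.coef (S.series c t) μ = c μ t := by
  obtain ⟨C, -, hbC⟩ := hc.exists_abs_le_at ht
  refine S.coef_tsum (c := fun ν => c ν t) ((S.summable_inv_ω_mul.mul_left C).of_nonneg_of_le
    (fun ν => mul_nonneg (abs_nonneg _) (supAbs_nonneg _)) fun ν => ?_) μ
  rw [← mul_assoc]
  exact mul_le_mul_of_nonneg_right (hbC ν) (supAbs_nonneg _)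

lemma hasDerivAt_series (hc : S.Decays s T c) (hc' : S.Decays s T c')
    (hd : ∀ μ, ∀ t ∈ Ioo s T, HasDerivAt (c μ) (c' μ t) t) {t x : ℝ} (ht : t ∈ Ioo s T)
    (hx : x ∈ Icc (0 : ℝ) 1) : HasDerivAt (fun t => S.series c t x) (S.series c' t x) t := by
  obtain ⟨s₂, hs₂, hs₂t⟩ := exists_between ht.1
  obtain ⟨C', hC', hbC'⟩ := hc'.exists_abs_le s₂ ⟨hs₂, hs₂t.trans ht.2⟩
  obtain ⟨C, hC, hbC⟩ := hc.exists_abs_le_at (Ioo_subset_Ioc_self ht)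
  have hmem : t ∈ Ioo s₂ T := ⟨hs₂t, ht.2⟩
  exact hasDerivAt_tsum_of_isPreconnected (g := fun μ t => c μ t * S.φ μ x)
    (g' := fun μ t => c' μ t * S.φ μ x) (S.summable_inv_ω_mul.mul_left C') isOpen_Ioo
    isPreconnected_Ioo (fun μ y hy => (hd μ y ⟨hs₂.trans hy.1, hy.2⟩).mul_const _)
    (fun μ y hy => abs_mul_φ_le hC' (hbC' μ y (Ioo_subset_Icc_self hy)) hx) hmem
    (.of_norm_bounded (S.summable_inv_ω_mul.mul_left C) fun μ => abs_mul_φ_le hC (hbC μ) hx) hmem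

end Decays

end Spectral

end SLData

namespace SLData

variable (A : SLData)

/-- Sources on `(s, T]` of the first kind (`f₁` in the class `GD`): continuous, bounded in
`L²_r`, with time derivative `F'`, which is bounded in `L²_r` away from `s`. -/
structure TimeRegular (s T : ℝ) (F F' : ℝ → ℝ → ℝ) : Prop where
  continuousOn : ContinuousOn (fun z : ℝ × ℝ => F z.1 z.2) (Ioc s T ×ˢ Icc 0 1)
  continuousOn_deriv : ContinuousOn (fun z : ℝ × ℝ => F' z.1 z.2) (Ioo s T ×ˢ Icc 0 1)
  hasDerivAt : ∀ t ∈ Ioo s T, ∀ x ∈ Icc (0 : ℝ) 1, HasDerivAt (fun t => F t x) (F' t x) t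
  exists_norm_le : ∃ N, ∀ t ∈ Ioc s T, ‖A.cls (F t)‖ ≤ N
  exists_norm_deriv_le : ∀ s₁ ∈ Ioo s T, ∃ N, ∀ t ∈ Ioo s₁ T, ‖A.cls (F' t)‖ ≤ N

/-- Sources on `(s, T]` of the second kind (`f₂` in the class `GD`): continuous, with values in
`D ∩ C²([0,1])`, and bounded in `L²_r` together with their image under `A`. -/
structure DomainValued (s T : ℝ) (F : ℝ → ℝ → ℝ) : Prop where
  continuousOn : ContinuousOn (fun z : ℝ × ℝ => F z.1 z.2) (Ioc s T ×ˢ Icc 0 1)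
  memDC2 : ∀ t ∈ Ioc s T, A.MemDC2 (F t)
  exists_norm_le : ∃ N, ∀ t ∈ Ioc s T, ‖A.cls (F t)‖ ≤ N
  exists_norm_op_le : ∃ N, ∀ t ∈ Ioc s T, ‖A.cls (A.op (F t))‖ ≤ N

/-- `u` is a classical solution of `u_t + A u = F` on `(s, T]`, with time derivative `u'`, boundary
values `D₀`, `D₁`, and initial value `u₀` in the sense of `L²_r`. At `t = T` the function `u'`
is the left limit of the time derivative. -/
structure IntervalSol (s T : ℝ) (F : ℝ → ℝ → ℝ) (D₀ D₁ : ℝ → ℝ) (u₀ : ℝ → ℝ)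
    (u u' : ℝ → ℝ → ℝ) : Prop where
  continuousOn : ContinuousOn (fun z : ℝ × ℝ => u z.1 z.2) (Ioc s T ×ˢ Icc 0 1)
  continuousOn_dx : ContinuousOn (fun z : ℝ × ℝ => dx (u z.1) z.2) (Ioc s T ×ˢ Icc 0 1)
  continuousOn_dt : ContinuousOn (fun z : ℝ × ℝ => u' z.1 z.2) (Ioc s T ×ˢ Icc 0 1)
  contDiffOn_two : ∀ t ∈ Ioc s T, ContDiffOn ℝ 2 (u t) (Icc 0 1)
  hasDerivAt : ∀ t ∈ Ioo s T, ∀ x ∈ Icc (0 : ℝ) 1, HasDerivAt (fun t => u t x) (u' t x) t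
  equation : ∀ t ∈ Ioc s T, ∀ x ∈ Icc (0 : ℝ) 1, u' t x = -A.op (u t) x + F t x
  bc0 : ∀ t ∈ Ioc s T, A.bc0 (u t) = D₀ t
  bc1 : ∀ t ∈ Ioc s T, A.bc1 (u t) = D₁ t
  tendsto_initial : Tendsto (fun t => A.cls (u t)) (𝓝[Ioc s T] s) (𝓝 (A.cls u₀))

variable {A}

namespace TimeRegular

variable {s T : ℝ} {F F' H H' : ℝ → ℝ → ℝ}

lemma sub (hF : A.TimeRegular s T F F') (hH : A.TimeRegular s T H H') :
    A.TimeRegular s T (fun t x => F t x - H t x) (fun t x => F' t x - H' t x) where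
  continuousOn := hF.continuousOn.sub hH.continuousOn
  continuousOn_deriv := hF.continuousOn_deriv.sub hH.continuousOn_deriv
  hasDerivAt t ht x hx := (hF.hasDerivAt t ht x hx).sub (hH.hasDerivAt t ht x hx)
  exists_norm_le := by
    obtain ⟨N, hN⟩ := hF.exists_norm_le
    obtain ⟨N', hN'⟩ := hH.exists_norm_le
    refine ⟨N + N', fun t ht => ?_⟩
    have hsub := cls_sub (memLp_wt (A := A) (continuousOn_slice hF.continuousOn ht))
      (memLp_wt (continuousOn_slice hH.continuousOn ht))
    exact (congrArg norm hsub).trans_le ((norm_sub_le _ _).trans (add_le_add (hN t ht) (hN' t ht)))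
  exists_norm_deriv_le s₁ hs₁ := by
    obtain ⟨N, hN⟩ := hF.exists_norm_deriv_le s₁ hs₁
    obtain ⟨N', hN'⟩ := hH.exists_norm_deriv_le s₁ hs₁
    refine ⟨N + N', fun t ht => ?_⟩
    have hmem : t ∈ Ioo s T := ⟨hs₁.1.trans ht.1, ht.2⟩
    have hsub := cls_sub (memLp_wt (A := A) (continuousOn_slice hF.continuousOn_deriv hmem))
      (memLp_wt (continuousOn_slice hH.continuousOn_deriv hmem))
    exact (congrArg norm hsub).trans_le ((norm_sub_le _ _).trans (add_le_add (hN t ht) (hN' t ht)))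

lemma of_mul {D D' g : ℝ → ℝ} (hg : ContinuousOn g (Icc 0 1)) (hD : ContinuousOn D (Ioc s T))
    (hD' : ContinuousOn D' (Ioo s T)) (hd : ∀ t ∈ Ioo s T, HasDerivAt D (D' t) t)
    (hb : ∃ N, ∀ t ∈ Ioc s T, |D t| ≤ N)
    (hb' : ∀ s₁ ∈ Ioo s T, ∃ N, ∀ t ∈ Ioo s₁ T, |D' t| ≤ N) :
    A.TimeRegular s T (fun t x => D t * g x) (fun t x => D' t * g x) := by
  have hnorm (a : ℝ) : ‖A.cls (fun x => a * g x)‖ = |a| * ‖A.cls g‖ := by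
    rw [cls_smul (memLp_wt hg), norm_smul, Real.norm_eq_abs]
  refine ⟨continuousOn_mul_strip hD hg, continuousOn_mul_strip hD' hg,
    fun t ht x _ => (hd t ht).mul_const _, ?_, fun s₁ hs₁ => ?_⟩
  · obtain ⟨N, hN⟩ := hb
    exact ⟨N * ‖A.cls g‖, fun t ht =>
      (hnorm _).trans_le (mul_le_mul_of_nonneg_right (hN t ht) (norm_nonneg _))⟩
  · obtain ⟨N, hN⟩ := hb' s₁ hs₁
    exact ⟨N * ‖A.cls g‖, fun t ht =>
      (hnorm _).trans_le (mul_le_mul_of_nonneg_right (hN t ht) (norm_nonneg _))⟩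

end TimeRegular

namespace Spectral

variable (S : A.Spectral) {s T : ℝ}

lemma exists_abs_coef_le {F F' H : ℝ → ℝ → ℝ} (hF : A.TimeRegular s T F F')
    (hH : A.DomainValued s T H) :
    ∃ M, 0 ≤ M ∧ ∀ μ, ∀ t ∈ Ioc s T, |S.coef (F t) μ| ≤ M ∧
      |S.coef (H t) μ| ≤ M * (S.ω μ)⁻¹ := by
  obtain ⟨N₁, hN₁⟩ := hF.exists_norm_le
  obtain ⟨N₂, hN₂⟩ := hH.exists_norm_le
  obtain ⟨N₃, hN₃⟩ := hH.exists_norm_op_le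
  have hcls (t : ℝ) (ht : t ∈ Ioc s T) :
      ‖A.cls (A.op (H t))‖ + |S.G.κ| * ‖A.cls (H t)‖ ≤ N₃ + |S.G.κ| * N₂ :=
    add_le_add (hN₃ t ht) (mul_le_mul_of_nonneg_left (hN₂ t ht) (abs_nonneg _))
  refine ⟨max 0 (max N₁ (N₃ + |S.G.κ| * N₂)), le_max_left _ _, fun μ t ht => ⟨?_, ?_⟩⟩
  · exact (S.abs_coef_le (memLp_wt (continuousOn_slice hF.continuousOn ht)) μ).trans
      ((hN₁ t ht).trans ((le_max_left _ _).trans (le_max_right _ _)))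
  · exact (S.abs_coef_le_of_memDC2 (hH.memDC2 t ht) μ).trans (mul_le_mul_of_nonneg_right
      ((hcls t ht).trans ((le_max_right _ _).trans (le_max_right _ _)))
      (inv_nonneg.2 (S.ω_pos μ).le))

/-- The right-hand side `-μ c_μ + ⟨F, φ_μ⟩` of the mode equations. -/
def rate (F : ℝ → ℝ → ℝ) (c : A.Eig → ℝ → ℝ) (μ : A.Eig) (t : ℝ) : ℝ :=
  -μ * c μ t + S.coef (F t) μ

/-- `c` consists of the eigenfunction coefficients of a solution of `w_t + A w = F` with
homogeneous boundary conditions and initial value `w₀`. -/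
structure Modes (s T : ℝ) (F : ℝ → ℝ → ℝ) (w₀ : ℝ → ℝ) (c : A.Eig → ℝ → ℝ) : Prop where
  initial : ∀ μ, c μ s = S.coef w₀ μ
  continuousOn : ∀ μ, ContinuousOn (c μ) (Icc s T)
  hasDerivAt : ∀ μ, ∀ t ∈ Ioo s T, HasDerivAt (c μ) (S.rate F c μ t) t
  decays : S.Decays s T c
  decays_rate : S.Decays s T (S.rate F c)
  exists_abs_source_le : ∃ M, 0 ≤ M ∧ ∀ μ, ∀ t ∈ Ioc s T, |S.coef (F t) μ| ≤ M

variable {S}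

lemma isMode_of_initial {F F' H : ℝ → ℝ → ℝ} {w₀ : ℝ → ℝ} {M M' s₁ : ℝ} {μ : A.Eig} {c : ℝ → ℝ}
    (hF : A.TimeRegular s T F F') (hH : A.DomainValued s T H)
    (hM : ∀ t ∈ Ioc s T, |S.coef (F t) μ| ≤ M ∧ |S.coef (H t) μ| ≤ M * (S.ω μ)⁻¹)
    (hs₁ : s < s₁) (hM' : ∀ t ∈ Ioo s₁ T, ‖A.cls (F' t)‖ ≤ M') (hw₀ : MemLp w₀ 2 A.wt)
    (hc₀ : c s = S.coef w₀ μ) (hc : ContinuousOn c (Icc s T))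
    (hd : ∀ t ∈ Ioo s T, HasDerivAt c (-μ * c t + S.coef (fun x => F t x + H t x) μ) t) :
    IsMode s s₁ T S.G.κ ‖A.cls w₀‖ M M' μ c (fun t => S.coef (F t) μ) (fun t => S.coef (H t) μ)
      (fun t => S.coef (F' t) μ) where
  one_le := (S.one_lt_ω μ).le
  abs_initial_le := hc₀ ▸ S.abs_coef_le hw₀ μ
  continuousOn := hc
  continuousOn_source := S.continuousOn_coef hF.continuousOn μ
  hasDerivAt t ht := by
    have ht' := Ioo_subset_Ioc_self ht
    rw [← S.coef_add (memLp_wt (continuousOn_slice hF.continuousOn ht'))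
      (memLp_wt (continuousOn_slice hH.continuousOn ht'))]
    exact hd t ht
  abs_source_le t ht := (hM t ht).1
  abs_source_le_inv t ht := (hM t ht).2
  hasDerivAt_source t ht :=
    S.hasDerivAt_coef (hF.continuousOn.mono (prod_mono Ioo_subset_Ioc_self (Subset.refl _)))
      hF.continuousOn_deriv hF.hasDerivAt μ ⟨hs₁.trans ht.1, ht.2⟩
  abs_deriv_source_le t ht :=
    (S.abs_coef_le (memLp_wt (continuousOn_slice hF.continuousOn_deriv
      ⟨hs₁.trans ht.1, ht.2⟩)) μ).trans (hM' t ht)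

lemma abs_coef_add_le {g h : ℝ → ℝ} {M : ℝ} {μ : A.Eig} (hM : 0 ≤ M)
    (hg : ContinuousOn g (Icc 0 1)) (hh : ContinuousOn h (Icc 0 1))
    (hb : |S.coef g μ| ≤ M ∧ |S.coef h μ| ≤ M * (S.ω μ)⁻¹) :
    |S.coef (fun x => g x + h x) μ| ≤ M + M := by
  rw [S.coef_add (memLp_wt hg) (memLp_wt hh)]
  exact (abs_add_le _ _).trans (add_le_add hb.1 (hb.2.trans
    (mul_le_of_le_one_right hM (inv_le_one_of_one_le₀ (S.one_lt_ω μ).le))))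

lemma exists_modes (hsT : s < T) {F F' H : ℝ → ℝ → ℝ} (hF : A.TimeRegular s T F F')
    (hH : A.DomainValued s T H) {w₀ : ℝ → ℝ} (hw₀ : MemLp w₀ 2 A.wt) :
    ∃ c, S.Modes s T (fun t x => F t x + H t x) w₀ c := by
  obtain ⟨M, hM, hcoef⟩ := S.exists_abs_coef_le hF hH
  have hFH : ContinuousOn (fun z : ℝ × ℝ => F z.1 z.2 + H z.1 z.2) (Ioc s T ×ˢ Icc 0 1) :=
    hF.continuousOn.add hH.continuousOn
  have hsource := S.continuousOn_coef (F := fun t x => F t x + H t x) hFH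
  have hsum (μ : A.Eig) (t : ℝ) (ht : t ∈ Ioc s T) :=
    abs_coef_add_le hM (continuousOn_slice hF.continuousOn ht)
      (continuousOn_slice hH.continuousOn ht) (hcoef μ t ht)
  choose c hc₀ hc hd using fun μ : A.Eig =>
    exists_mode hsT (hsource μ) (hsum μ) μ (S.coef w₀ μ)
  have hc' (μ : A.Eig) : ContinuousOn (c μ) (Ioc s T) := (hc μ).mono Ioc_subset_Icc_self
  have hmode {s₁ : ℝ} (hs₁ : s₁ ∈ Ioo s T) : ∃ M', 0 ≤ M' ∧ ∀ μ : A.Eig,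
      IsMode s s₁ T S.G.κ ‖A.cls w₀‖ M M' μ (c μ) (fun t => S.coef (F t) μ)
        (fun t => S.coef (H t) μ) (fun t => S.coef (F' t) μ) := by
    obtain ⟨M', hM'⟩ := hF.exists_norm_deriv_le s₁ hs₁
    exact ⟨max 0 M', le_max_left _ _, fun μ => isMode_of_initial hF hH (hcoef μ) hs₁.1
      (fun t ht => (hM' t ht).trans (le_max_right _ _)) hw₀ (hc₀ μ) (hc μ) (hd μ)⟩
  refine ⟨c, hc₀, hc, hd, ⟨hc', fun s₂ hs₂ => ?_⟩,
    ⟨fun μ => (continuousOn_const.mul (hc' μ)).add (hsource μ), fun s₂ hs₂ => ?_⟩,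
    ⟨M + M, by positivity, hsum⟩⟩
  · obtain ⟨M', -, hmode⟩ := hmode hs₂
    obtain ⟨C, hC, hbC⟩ :=
      IsMode.exists_abs_le (T := T) (M' := M') hs₂.1 S.G.κ_nonpos (norm_nonneg (A.cls w₀)) hM
    exact ⟨C, hC, fun μ => hbC (hmode μ)⟩
  · obtain ⟨s₁, hss₁, hs₁s₂⟩ := exists_between hs₂.1
    obtain ⟨M', hM', hmode⟩ := hmode ⟨hss₁, hs₁s₂.trans hs₂.2⟩
    obtain ⟨C, hC, hbC⟩ := IsMode.exists_abs_deriv_le (T := T) hss₁ hs₁s₂ S.G.κ_nonpos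
      (norm_nonneg (A.cls w₀)) hM hM'
    refine ⟨C, hC, fun μ t ht => ?_⟩
    have ht' : t ∈ Ioc s T := ⟨hs₂.1.trans_le ht.1, ht.2⟩
    rw [rate, S.coef_add (memLp_wt (continuousOn_slice hF.continuousOn ht'))
      (memLp_wt (continuousOn_slice hH.continuousOn ht'))]
    exact hbC (hmode μ) t ht

end Spectral

end SLData

namespace SLData

variable {A : SLData}

namespace Green

lemma continuousOn_integral_zero_left {k : ℝ → ℝ} {F : ℝ → ℝ → ℝ} {J : Set ℝ}
    (hk : ContinuousOn k (Icc 0 1))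
    (hF : ContinuousOn (fun z : ℝ × ℝ => F z.1 z.2) (J ×ˢ Icc 0 1)) :
    ContinuousOn (fun z : ℝ × ℝ => ∫ y in (0 : ℝ)..z.2, k y * F z.1 y) (J ×ˢ Icc 0 1) := by
  rw [continuousOn_iff_continuous_domRestrict]
  have hF' : Continuous fun q : ↥(J ×ˢ Icc (0 : ℝ) 1) × ℝ => F q.1.1.1 (unitProj q.2) :=
    hF.comp_continuous (f := fun q : ↥(J ×ˢ Icc (0 : ℝ) 1) × ℝ => (q.1.1.1, unitProj q.2))
      ((by fun_prop : Continuous fun q : ↥(J ×ˢ Icc (0 : ℝ) 1) × ℝ => q.1.1.1).prodMk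
        (continuous_unitProj.comp continuous_snd)) fun q => ⟨q.1.2.1, unitProj_mem _⟩
  have hcont := intervalIntegral.continuous_parametric_intervalIntegral_of_continuous
    (μ := volume) (a₀ := 0)
    (f := fun (z : ↥(J ×ˢ Icc (0 : ℝ) 1)) y => k (unitProj y) * F z.1.1 (unitProj y))
    (((continuous_comp_unitProj hk).comp continuous_snd).mul hF')
    (s := fun z => z.1.2) (by fun_prop)
  refine hcont.congr fun z => intervalIntegral.integral_congr fun y hy => ?_
  rw [uIcc_of_le z.2.2.1] at hy
  simp only [unitProj_of_mem (⟨hy.1, hy.2.trans z.2.2.2⟩ : y ∈ Icc (0 : ℝ) 1)]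

lemma continuousOn_integral_one_right {k : ℝ → ℝ} {F : ℝ → ℝ → ℝ} {J : Set ℝ}
    (hk : ContinuousOn k (Icc 0 1))
    (hF : ContinuousOn (fun z : ℝ × ℝ => F z.1 z.2) (J ×ˢ Icc 0 1)) :
    ContinuousOn (fun z : ℝ × ℝ => ∫ y in z.2..(1 : ℝ), k y * F z.1 y) (J ×ˢ Icc 0 1) := by
  have hleft := continuousOn_integral_zero_left hk hF
  have htotal : ContinuousOn (fun z : ℝ × ℝ => ∫ y in (0 : ℝ)..1, k y * F z.1 y) (J ×ˢ Icc 0 1) :=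
    hleft.comp (f := fun z : ℝ × ℝ => (z.1, (1 : ℝ))) (by fun_prop)
      fun z hz => ⟨hz.1, right_mem_Icc.2 zero_le_one⟩
  refine (htotal.sub hleft).congr fun z hz => eq_sub_of_add_eq' ?_
  have hprod : ContinuousOn (fun y => k y * F z.1 y) (Icc 0 1) :=
    hk.mul (continuousOn_slice hF hz.1)
  exact intervalIntegral.integral_add_adjacent_intervals
    (intervalIntegrable_of_continuousOn hprod (left_mem_Icc.2 zero_le_one) hz.2)
    (intervalIntegrable_of_continuousOn hprod hz.2 (right_mem_Icc.2 zero_le_one))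

variable (G : A.Green)

lemma continuousOn_resFlux_strip {F : ℝ → ℝ → ℝ} {J : Set ℝ}
    (hF : ContinuousOn (fun z : ℝ × ℝ => F z.1 z.2) (J ×ˢ Icc 0 1)) :
    ContinuousOn (fun z : ℝ × ℝ => G.resFlux (F z.1) z.2) (J ×ˢ Icc 0 1) := by
  have hsnd {k : ℝ → ℝ} (hk : ContinuousOn k (Icc 0 1)) :
      ContinuousOn (fun z : ℝ × ℝ => k z.2) (J ×ˢ Icc 0 1) :=
    hk.comp continuousOn_snd fun _ hz => hz.2
  have hrF : ContinuousOn (fun z : ℝ × ℝ => A.r z.2 * F z.1 z.2) (J ×ˢ Icc 0 1) :=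
    (hsnd A.r_cont).mul hF
  exact continuousOn_const.mul
    (((hsnd (contDiffOn_flux G.contDiffOn_y₂).continuousOn).mul
        (continuousOn_integral_zero_left (F := fun t y => A.r y * F t y) G.continuousOn_y₁ hrF)).add
      ((hsnd (contDiffOn_flux G.contDiffOn_y₁).continuousOn).mul
        (continuousOn_integral_one_right (F := fun t y => A.r y * F t y) G.continuousOn_y₂ hrF)))

lemma continuousOn_dx_of_eqOn_res {F u : ℝ → ℝ → ℝ} {J : Set ℝ}
    (hF : ContinuousOn (fun z : ℝ × ℝ => F z.1 z.2) (J ×ˢ Icc 0 1))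
    (hu : ∀ t ∈ J, EqOn (u t) (G.res (F t)) (Icc 0 1)) :
    ContinuousOn (fun z : ℝ × ℝ => dx (u z.1) z.2) (J ×ˢ Icc 0 1) := by
  have hp : ContinuousOn (fun z : ℝ × ℝ => (A.p z.2)⁻¹) (J ×ˢ Icc 0 1) :=
    A.continuousOn_inv_p.comp continuousOn_snd fun _ hz => hz.2
  refine (hp.mul (G.continuousOn_resFlux_strip hF)).congr fun z hz => ?_
  rw [dx_congr (hu z.1 hz.1) hz.2, G.dx_res (continuousOn_slice hF hz.1) hz.2]
  rfl

end Green

namespace Spectral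

variable {S : A.Spectral} {s T : ℝ} {F : ℝ → ℝ → ℝ} {w₀ : ℝ → ℝ} {c : A.Eig → ℝ → ℝ}

namespace Modes

variable (S F c) in
/-- The function `F - w_t - κ w`, where `w` is the series with coefficients `c`: the argument of
the resolvent `(A - κ)⁻¹` in the equation for `w`. -/
def residual (t x : ℝ) : ℝ :=
  F t x - S.series (S.rate F c) t x - S.G.κ * S.series c t x

lemma continuousOn_residual (hc : S.Modes s T F w₀ c)
    (hF : ContinuousOn (fun z : ℝ × ℝ => F z.1 z.2) (Ioc s T ×ˢ Icc 0 1)) :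
    ContinuousOn (fun z : ℝ × ℝ => residual S F c z.1 z.2) (Ioc s T ×ˢ Icc 0 1) :=
  (hF.sub hc.decays_rate.continuousOn_series).sub
    (continuousOn_const.mul hc.decays.continuousOn_series)

lemma coef_residual (hc : S.Modes s T F w₀ c)
    (hF : ContinuousOn (fun z : ℝ × ℝ => F z.1 z.2) (Ioc s T ×ˢ Icc 0 1)) {t : ℝ}
    (ht : t ∈ Ioc s T) (μ : A.Eig) : S.coef (residual S F c t) μ = S.ω μ * c μ t := by
  have hFt := memLp_wt (A := A) (continuousOn_slice hF ht)
  have hw := memLp_wt (A := A) (continuousOn_slice hc.decays.continuousOn_series ht)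
  have hw' := memLp_wt (A := A) (continuousOn_slice hc.decays_rate.continuousOn_series ht)
  have hcombo := S.coef_combo (hFt.sub hw') hw 1 (-S.G.κ) μ
  have hres : residual S F c t = fun x =>
      1 * (F t - S.series (S.rate F c) t) x + -S.G.κ * S.series c t x := by
    ext x
    simp only [residual, Pi.sub_apply]
    ring
  rw [hres, hcombo, S.coef_sub hFt hw', hc.decays.coef_series ht, hc.decays_rate.coef_series ht,
    rate, ω]
  ring

lemma eqOn_res (hc : S.Modes s T F w₀ c)
    (hF : ContinuousOn (fun z : ℝ × ℝ => F z.1 z.2) (Ioc s T ×ˢ Icc 0 1)) {t : ℝ}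
    (ht : t ∈ Ioc s T) : EqOn (S.series c t) (S.G.res (residual S F c t)) (Icc 0 1) := by
  have hR := continuousOn_slice (hc.continuousOn_residual hF) ht
  refine S.eqOn_of_coef (continuousOn_slice hc.decays.continuousOn_series ht)
    (S.G.continuousOn_res hR) fun μ => ?_
  rw [S.coef_res hR, hc.coef_residual hF ht, hc.decays.coef_series ht,
    inv_mul_cancel_left₀ (S.ω_pos μ).ne']

lemma exists_abs_sub_initial_le (hc : S.Modes s T F w₀ c) :
    ∃ R, 0 ≤ R ∧ ∀ μ, ∀ t ∈ Ioc s T,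
      |c μ t - S.coef w₀ μ| ≤ R * (|S.coef w₀ μ| + (S.ω μ)⁻¹) := by
  obtain ⟨M, hM, hbM⟩ := hc.exists_abs_source_le
  set R := Real.exp (-S.G.κ * (T - s))
  refine ⟨R + 1 + R * M, by positivity, fun μ t ht => ?_⟩
  have hω := S.ω_pos μ
  have hmode := abs_le_of_mode S.G.κ_nonpos hω hM (hc.continuousOn μ) (hc.hasDerivAt μ)
    (fun t ht => hbM μ t (Ioo_subset_Ioc_self ht)) (Ioc_subset_Icc_self ht)
  rw [hc.initial] at hmode
  have hdecay : Real.exp (-S.ω μ * (t - s)) * |S.coef w₀ μ| ≤ |S.coef w₀ μ| :=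
    mul_le_of_le_one_left (abs_nonneg _) (Real.exp_le_one_iff.2
      (mul_nonpos_of_nonpos_of_nonneg (neg_nonpos.2 hω.le) (sub_nonneg.2 ht.1.le)))
  have hexp : Real.exp (-S.G.κ * (t - s)) ≤ R := Real.exp_le_exp.2
    (mul_le_mul_of_nonneg_left (sub_le_sub_right ht.2 s) (neg_nonneg.2 S.G.κ_nonpos))
  have hcμ : |c μ t| ≤ R * (|S.coef w₀ μ| + M * (S.ω μ)⁻¹) :=
    hmode.trans (mul_le_mul hexp (add_le_add hdecay le_rfl)
      (add_nonneg (by positivity) (div_nonneg hM hω.le)) (Real.exp_pos _).le)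
  have hR : 0 ≤ R := (Real.exp_pos _).le
  have hinv := (inv_pos.2 hω).le
  have h₀ := abs_nonneg (S.coef w₀ μ)
  nlinarith [abs_sub (c μ t) (S.coef w₀ μ), mul_nonneg (mul_nonneg hR hM) h₀, mul_nonneg hR hinv]

lemma tendsto_tsum_sq (hsT : s < T) (hc : S.Modes s T F w₀ c) (hw₀ : MemLp w₀ 2 A.wt) :
    Tendsto (fun t => ∑' μ, (c μ t - S.coef w₀ μ) ^ 2) (𝓝[Ioc s T] s) (𝓝 0) := by
  obtain ⟨R, -, hR⟩ := hc.exists_abs_sub_initial_le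
  have hsum : Summable fun μ : A.Eig => 2 * (R ^ 2 * S.coef w₀ μ ^ 2) +
      2 * (R ^ 2 * ((S.ω μ)⁻¹) ^ 2) :=
    (((S.hasSum_coef_sq hw₀).summable.mul_left _).mul_left _).add
      ((S.summable_inv_ω_sq.mul_left _).mul_left _)
  rw [← tsum_zero (β := A.Eig)]
  refine tendsto_tsum_of_dominated_convergence hsum (fun μ => ?_) ?_
  · have hlim : Tendsto (c μ) (𝓝[Ioc s T] s) (𝓝 (c μ s)) :=
      (hc.continuousOn μ s (left_mem_Icc.2 hsT.le)).mono_left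
        (nhdsWithin_mono _ Ioc_subset_Icc_self)
    simpa [hc.initial] using (hlim.sub_const (S.coef w₀ μ)).pow 2
  · filter_upwards [self_mem_nhdsWithin] with t ht μ
    rw [Real.norm_eq_abs, abs_pow, ← sq_abs (S.coef w₀ μ)]
    refine (pow_le_pow_left₀ (abs_nonneg _) (hR μ t ht) 2).trans ?_
    nlinarith [mul_nonneg (sq_nonneg R) (sq_nonneg (|S.coef w₀ μ| - (S.ω μ)⁻¹))]

lemma tendsto_cls_series (hsT : s < T) (hc : S.Modes s T F w₀ c) (hw₀ : MemLp w₀ 2 A.wt) :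
    Tendsto (fun t => A.cls (S.series c t)) (𝓝[Ioc s T] s) (𝓝 (A.cls w₀)) := by
  have hparseval : (fun t => ∑' μ, (c μ t - S.coef w₀ μ) ^ 2) =ᶠ[𝓝[Ioc s T] s]
      fun t => ‖A.cls (S.series c t) - A.cls w₀‖ ^ 2 := by
    filter_upwards [self_mem_nhdsWithin] with t ht
    have hw := memLp_wt (A := A) (continuousOn_slice hc.decays.continuousOn_series ht)
    rw [← cls_sub hw hw₀, ← (S.hasSum_coef_sq (hw.sub hw₀)).tsum_eq]
    exact tsum_congr fun μ => by rw [S.coef_sub hw hw₀, hc.decays.coef_series ht]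
  rw [tendsto_iff_norm_sub_tendsto_zero]
  simpa using ((hc.tendsto_tsum_sq hsT hw₀).congr' hparseval).sqrt

lemma intervalSol (hsT : s < T) (hc : S.Modes s T F w₀ c) (hw₀ : MemLp w₀ 2 A.wt)
    (hF : ContinuousOn (fun z : ℝ × ℝ => F z.1 z.2) (Ioc s T ×ˢ Icc 0 1)) :
    A.IntervalSol s T F 0 0 w₀ (S.series c) (S.series (S.rate F c)) := by
  have hR (t : ℝ) (ht : t ∈ Ioc s T) := continuousOn_slice (hc.continuousOn_residual hF) ht
  have hmem (t : ℝ) (ht : t ∈ Ioc s T) : A.MemDC2 (S.series c t) :=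
    (S.G.memDC2_res (hR t ht)).congr (hc.eqOn_res hF ht)
  refine ⟨hc.decays.continuousOn_series,
    S.G.continuousOn_dx_of_eqOn_res (hc.continuousOn_residual hF) fun t => hc.eqOn_res hF,
    hc.decays_rate.continuousOn_series, fun t ht => (hmem t ht).1,
    fun t ht x => hc.decays.hasDerivAt_series hc.decays_rate hc.hasDerivAt ht,
    fun t ht x hx => ?_, fun t ht => (hmem t ht).2.1, fun t ht => (hmem t ht).2.2,
    hc.tendsto_cls_series hsT hw₀⟩
  rw [op_congr (hc.eqOn_res hF ht) hx, S.G.op_res (hR t ht) hx, ← hc.eqOn_res hF ht hx, residual]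
  ring

end Modes

theorem exists_intervalSol_homogeneous (S : A.Spectral) (hsT : s < T) {F' H : ℝ → ℝ → ℝ}
    (hF : A.TimeRegular s T F F') (hH : A.DomainValued s T H) (hw₀ : MemLp w₀ 2 A.wt) :
    ∃ w w', A.IntervalSol s T (fun t x => F t x + H t x) 0 0 w₀ w w' := by
  obtain ⟨c, hc⟩ := exists_modes (S := S) hsT hF hH hw₀
  exact ⟨_, _, hc.intervalSol hsT hw₀ (hF.continuousOn.add hH.continuousOn)⟩

end Spectral

end SLData

/-! ### Solutions on one time interval -/

/-- Boundary data on `[s, T]` with their first two derivatives `D'`, `D''`; at `T` the function `D'`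
is the left limit of the derivative. -/
structure BoundaryDatum (s T : ℝ) (D D' D'' : ℝ → ℝ) : Prop where
  continuousOn : ContinuousOn D (Icc s T)
  continuousOn_deriv : ContinuousOn D' (Ioc s T)
  continuousOn_deriv2 : ContinuousOn D'' (Ioo s T)
  hasDerivAt : ∀ t ∈ Ioo s T, HasDerivAt D (D' t) t
  hasDerivAt_deriv : ∀ t ∈ Ioo s T, HasDerivAt D' (D'' t) t
  exists_abs_deriv_le : ∃ M, ∀ t ∈ Ioc s T, |D' t| ≤ M
  exists_abs_deriv2_le : ∀ s₁ ∈ Ioo s T, ∃ M, ∀ t ∈ Ioo s₁ T, |D'' t| ≤ M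

/-- On `(s, T)` the function `d` agrees with boundary data for which the boundary problem can be
solved up to the end point `T`. -/
def BoundaryOn (s T : ℝ) (d : ℝ → ℝ) : Prop :=
  ∃ D D' D'', EqOn d D (Ioo s T) ∧ BoundaryDatum s T D D' D''

namespace SLData

variable {A : SLData} {s T : ℝ}

lemma IntervalSol.add {F H : ℝ → ℝ → ℝ} {D₀ D₁ E₀ E₁ u₀ v₀ : ℝ → ℝ} {u u' v v' : ℝ → ℝ → ℝ}
    (hu : A.IntervalSol s T F D₀ D₁ u₀ u u') (hv : A.IntervalSol s T H E₀ E₁ v₀ v v')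
    (hu₀ : MemLp u₀ 2 A.wt) (hv₀ : MemLp v₀ 2 A.wt) :
    A.IntervalSol s T (fun t x => F t x + H t x) (fun t => D₀ t + E₀ t) (fun t => D₁ t + E₁ t)
      (u₀ + v₀) (fun t => u t + v t) (fun t x => u' t x + v' t x) := by
  have hone {g : ℝ → ℝ} (hg : ContDiffOn ℝ 2 g (Icc 0 1)) : ContDiffOn ℝ 1 g (Icc 0 1) :=
    hg.of_le (by norm_num)
  have hadd (t : ℝ) : u t + v t = fun x => 1 * u t x + 1 * v t x := by
    ext x
    simp
  refine ⟨hu.continuousOn.add hv.continuousOn,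
    (hu.continuousOn_dx.add hv.continuousOn_dx).congr fun z hz => ?_,
    hu.continuousOn_dt.add hv.continuousOn_dt,
    fun t ht => (hu.contDiffOn_two t ht).add (hv.contDiffOn_two t ht),
    fun t ht x hx => (hu.hasDerivAt t ht x hx).add (hv.hasDerivAt t ht x hx),
    fun t ht x hx => ?_, fun t ht => ?_, fun t ht => ?_, ?_⟩
  · rw [hadd, dx_combo (hone (hu.contDiffOn_two _ hz.1)) (hone (hv.contDiffOn_two _ hz.1)) 1 1 hz.2,
      one_mul, one_mul]
    rfl
  · rw [hadd, op_combo (hu.contDiffOn_two t ht) (hv.contDiffOn_two t ht) 1 1 hx,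
      hu.equation t ht x hx, hv.equation t ht x hx]
    ring
  · rw [hadd, bc0_combo (hone (hu.contDiffOn_two t ht)) (hone (hv.contDiffOn_two t ht)),
      hu.bc0 t ht, hv.bc0 t ht, one_mul, one_mul]
  · rw [hadd, bc1_combo (hone (hu.contDiffOn_two t ht)) (hone (hv.contDiffOn_two t ht)),
      hu.bc1 t ht, hv.bc1 t ht, one_mul, one_mul]
  · rw [cls_add hu₀ hv₀]
    refine (hu.tendsto_initial.add hv.tendsto_initial).congr' ?_
    filter_upwards [self_mem_nhdsWithin] with t ht
    exact (cls_add (memLp_wt (hu.contDiffOn_two t ht).continuousOn)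
      (memLp_wt (hv.contDiffOn_two t ht).continuousOn)).symm

lemma intervalSol_of_op_eq {κ : ℝ} {g : ℝ → ℝ} (hg : ContDiffOn ℝ 2 g (Icc 0 1))
    (hop : ∀ x ∈ Icc (0 : ℝ) 1, A.op g x = κ * g x) {D D' D'' : ℝ → ℝ} (hsT : s < T)
    (hD : BoundaryDatum s T D D' D'') :
    A.IntervalSol s T (fun t x => (D' t + κ * D t) * g x) (fun t => D t * A.bc0 g)
      (fun t => D t * A.bc1 g) (fun x => D s * g x) (fun t x => D t * g x)
      (fun t x => D' t * g x) := by
  have hone : ContDiffOn ℝ 1 g (Icc 0 1) := hg.of_le (by norm_num)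
  have hDc : ContinuousOn D (Ioc s T) := hD.continuousOn.mono Ioc_subset_Icc_self
  refine ⟨continuousOn_mul_strip hDc hg.continuousOn,
    (continuousOn_mul_strip hDc (continuousOn_dx hone)).congr fun z hz => ?_,
    continuousOn_mul_strip hD.continuousOn_deriv hg.continuousOn,
    fun t _ => contDiffOn_const.mul hg,
    fun t ht x _ => (hD.hasDerivAt t ht).mul_const _, fun t _ x hx => ?_,
    fun t _ => bc0_const_mul hone _, fun t _ => bc1_const_mul hone _, ?_⟩
  · simpa using dx_combo hone hone (D z.1) 0 hz.2
  · rw [op_const_mul hg _ hx, hop x hx]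
    ring
  · simp only [cls_smul (memLp_wt hg.continuousOn)]
    exact ((hD.continuousOn s (left_mem_Icc.2 hsT.le)).mono_left
      (nhdsWithin_mono _ Ioc_subset_Icc_self)).smul_const _

lemma timeRegular_of_boundaryDatum {D D' D'' : ℝ → ℝ} (hD : BoundaryDatum s T D D' D'') (κ : ℝ)
    {g : ℝ → ℝ} (hg : ContinuousOn g (Icc 0 1)) :
    A.TimeRegular s T (fun t x => (D' t + κ * D t) * g x)
      (fun t x => (D'' t + κ * D' t) * g x) := by
  obtain ⟨M, hM⟩ := exists_abs_le_of_continuousOn hD.continuousOn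
  obtain ⟨M', hM'⟩ := hD.exists_abs_deriv_le
  have habs {a b N N' : ℝ} (ha : |a| ≤ N) (hb : |b| ≤ N') : |a + κ * b| ≤ N + |κ| * N' :=
    (abs_add_le _ _).trans (add_le_add ha
      ((abs_mul κ b).trans_le (mul_le_mul_of_nonneg_left hb (abs_nonneg κ))))
  refine .of_mul hg
    (hD.continuousOn_deriv.add (continuousOn_const.mul (hD.continuousOn.mono Ioc_subset_Icc_self)))
    (hD.continuousOn_deriv2.add
      (continuousOn_const.mul (hD.continuousOn_deriv.mono Ioo_subset_Ioc_self)))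
    (fun t ht => (hD.hasDerivAt_deriv t ht).add ((hD.hasDerivAt t ht).const_mul κ))
    ⟨M' + |κ| * M, fun t ht => habs (hM' t ht) (hM.2 t (Ioc_subset_Icc_self ht))⟩
    fun s₁ hs₁ => ?_
  obtain ⟨M'', hM''⟩ := hD.exists_abs_deriv2_le s₁ hs₁
  exact ⟨M'' + |κ| * M', fun t ht => habs (hM'' t ht) (hM' t ⟨hs₁.1.trans ht.1, ht.2.le⟩)⟩

theorem Spectral.exists_intervalSol (S : A.Spectral) (hsT : s < T) {F F' H : ℝ → ℝ → ℝ}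
    (hF : A.TimeRegular s T F F') (hH : A.DomainValued s T H) {D₀ D₀' D₀'' D₁ D₁' D₁'' : ℝ → ℝ}
    (hD₀ : BoundaryDatum s T D₀ D₀' D₀'') (hD₁ : BoundaryDatum s T D₁ D₁' D₁'') {u₀ : ℝ → ℝ}
    (hu₀ : MemLp u₀ 2 A.wt) :
    ∃ u u', A.IntervalSol s T (fun t x => F t x + H t x) D₀ D₁ u₀ u u' := by
  obtain ⟨g₀, hg₀, hop₀, h₀₀, h₀₁⟩ := S.G.exists_lift_left
  obtain ⟨g₁, hg₁, hop₁, h₁₀, h₁₁⟩ := S.G.exists_lift_right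
  have hv₀ := intervalSol_of_op_eq hg₀ hop₀ hsT hD₀
  have hv₁ := intervalSol_of_op_eq hg₁ hop₁ hsT hD₁
  have hm₀ := (memLp_wt (A := A) hg₀.continuousOn).const_mul (D₀ s)
  have hm₁ := (memLp_wt (A := A) hg₁.continuousOn).const_mul (D₁ s)
  have hw₀ := (hu₀.sub hm₀).sub hm₁
  have hsource := (hF.sub (timeRegular_of_boundaryDatum hD₀ S.G.κ hg₀.continuousOn)).sub
    (timeRegular_of_boundaryDatum hD₁ S.G.κ hg₁.continuousOn)
  obtain ⟨w, w', hw⟩ := S.exists_intervalSol_homogeneous hsT hsource hH hw₀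
  have hu := (hw.add hv₀ hw₀ hm₀).add hv₁ (hw₀.add hm₀) hm₁
  simp only [h₀₀, h₀₁, h₁₀, h₁₁, mul_one, mul_zero, add_zero, zero_add, Pi.zero_apply] at hu
  refine ⟨fun t => w t + (fun x => D₀ t * g₀ x) + fun x => D₁ t * g₁ x,
    fun t x => w' t x + D₀' t * g₀ x + D₁' t * g₁ x, ?_⟩
  convert hu using 1
  · ext t x
    ring
  · ext x
    simp only [Pi.add_apply, Pi.sub_apply]
    ring

end SLData

section LeftLimits

variable {s T : ℝ}

lemma continuousOn_update_Ioc {d : ℝ → ℝ} {L : ℝ} (hd : ContinuousOn d (Ioo s T))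
    (hL : Tendsto d (𝓝[<] T) (𝓝 L)) : ContinuousOn (Function.update d T L) (Ioc s T) := by
  refine continuousOn_update_iff.2 ⟨hd.mono Ioc_sdiff_right.subset, fun _ => ?_⟩
  exact hL.mono_left (nhdsWithin_mono _ fun y hy => lt_of_le_of_ne hy.1.2 hy.2)

lemma update_eventuallyEq_of_lt {E : Type*} (g : ℝ → E) (L : E) {t : ℝ} (ht : t < T) :
    Function.update g T L =ᶠ[𝓝 t] g := by
  filter_upwards [Iio_mem_nhds ht] with y hy
  exact Function.update_of_ne hy.ne _ _

lemma forall_update_Ioc {E : Type*} {P : E → Prop} {g : ℝ → E} {L : E}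
    (hg : ∀ t ∈ Ioo s T, P (g t)) (hL : P L) : ∀ t ∈ Ioc s T, P (Function.update g T L t) := by
  intro t ht
  rcases eq_or_lt_of_le ht.2 with rfl | hlt
  · rwa [Function.update_self]
  · rw [Function.update_of_ne hlt.ne]
    exact hg t ⟨ht.1, hlt⟩

lemma boundaryOn_of_contDiffOn {d : ℝ → ℝ} {L L' L'' : ℝ} (hsT : s < T)
    (hs : ContinuousWithinAt d (Ici s) s) (hd : ContDiffOn ℝ 2 d (Ioo s T))
    (hL : Tendsto d (𝓝[<] T) (𝓝 L)) (hL' : Tendsto (deriv d) (𝓝[<] T) (𝓝 L'))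
    (hL'' : Tendsto (deriv (deriv d)) (𝓝[<] T) (𝓝 L''))
    (hM : ∃ M, ∀ t ∈ Ioo s T, |deriv d t| ≤ M) : BoundaryOn s T d := by
  have hd' : ContDiffOn ℝ 1 (deriv d) (Ioo s T) := hd.deriv_of_isOpen isOpen_Ioo (by norm_num)
  have hd'' : ContinuousOn (deriv (deriv d)) (Ioo s T) :=
    hd'.continuousOn_deriv_of_isOpen isOpen_Ioo le_rfl
  have hderiv {g : ℝ → ℝ} {n : WithTop ℕ∞} (hg : ContDiffOn ℝ n g (Ioo s T)) (hn : n ≠ 0) (ℓ : ℝ)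
      {t : ℝ} (ht : t ∈ Ioo s T) : HasDerivAt (Function.update g T ℓ) (deriv g t) t :=
    ((hg.differentiableOn hn).differentiableAt (Ioo_mem_nhds ht.1 ht.2)).hasDerivAt
      |>.congr_of_eventuallyEq (update_eventuallyEq_of_lt g ℓ ht.2)
  obtain ⟨M, hM⟩ := hM
  refine ⟨Function.update d T L, Function.update (deriv d) T L', deriv (deriv d),
    fun t ht => (Function.update_of_ne ht.2.ne _ _).symm, ?_,
    continuousOn_update_Ioc hd'.continuousOn hL', hd'', fun t ht => ?_,
    fun t ht => hderiv hd' one_ne_zero L' ht, ⟨max M |L'|, ?_⟩, fun s₁ hs₁ => ?_⟩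
  · intro t ht
    rcases eq_or_lt_of_le ht.1 with rfl | hlt
    · exact (hs.mono Icc_subset_Ici_self).congr_of_eventuallyEq
        ((update_eventuallyEq_of_lt d L hsT).filter_mono nhdsWithin_le_nhds)
        (Function.update_of_ne hsT.ne _ _)
    · refine (continuousOn_update_Ioc hd.continuousOn hL t ⟨hlt, ht.2⟩).mono_of_mem_nhdsWithin ?_
      filter_upwards [mem_nhdsWithin_of_mem_nhds (Ioi_mem_nhds hlt), self_mem_nhdsWithin]
        with y hy hy'
      exact ⟨hy, hy'.2⟩
  · rw [Function.update_of_ne ht.2.ne]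
    exact hderiv hd two_ne_zero L ht
  · exact forall_update_Ioc (P := fun y => |y| ≤ max M |L'|)
      (fun t ht => (hM t ht).trans (le_max_left _ _)) (le_max_right _ _)
  · obtain ⟨M'', -, hM''⟩ := exists_abs_le_of_continuousOn
      ((continuousOn_update_Ioc hd'' hL'').mono (Icc_subset_Ioc hs₁.1 le_rfl))
    refine ⟨M'', fun t ht => ?_⟩
    simpa only [Function.update_of_ne ht.2.ne] using hM'' t (Ioo_subset_Icc_self ht)

lemma continuousOn_update_strip {g : ℝ → ℝ → ℝ} {gT : ℝ → ℝ}
    (hg : ContinuousOn (fun z : ℝ × ℝ => g z.1 z.2) (Ioo s T ×ˢ Icc 0 1))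
    (hgT : ContinuousOn gT (Icc 0 1))
    (hlim : ∀ x ∈ Icc (0 : ℝ) 1, Tendsto (fun z : ℝ × ℝ => g z.1 z.2)
      (𝓝[Ioo s T ×ˢ Icc 0 1] (T, x)) (𝓝 (gT x))) :
    ContinuousOn (fun z : ℝ × ℝ => Function.update g T gT z.1 z.2) (Ioc s T ×ˢ Icc 0 1) := by
  rintro ⟨t, x⟩ ⟨ht : t ∈ Ioc s T, hx : x ∈ Icc (0 : ℝ) 1⟩
  rcases eq_or_lt_of_le ht.2 with rfl | hlt
  · rw [← Ioo_union_right ht.1, union_prod]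
    refine .union ?_ ?_
    · refine Tendsto.congr' ?_ (by simpa using hlim x hx)
      filter_upwards [self_mem_nhdsWithin] with z hz
      rw [Function.update_of_ne hz.1.2.ne]
    · have hc : ContinuousWithinAt (fun z : ℝ × ℝ => gT z.2) ({t} ×ˢ Icc (0 : ℝ) 1) (t, x) :=
        (hgT.comp continuousOn_snd fun z hz => hz.2) (t, x) ⟨rfl, hx⟩
      refine hc.congr (fun z hz => ?_) (by simp)
      rw [show z.1 = t from hz.1, Function.update_self]
  · have hnear : Iio T ×ˢ (univ : Set ℝ) ∈ 𝓝[Ioc s T ×ˢ Icc 0 1] (t, x) :=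
      mem_nhdsWithin_of_mem_nhds (prod_mem_nhds (Iio_mem_nhds hlt) univ_mem)
    have hc : ContinuousWithinAt (fun z : ℝ × ℝ => g z.1 z.2) (Ioc s T ×ˢ Icc 0 1) (t, x) := by
      refine (hg (t, x) ⟨⟨ht.1, hlt⟩, hx⟩).mono_of_mem_nhdsWithin ?_
      filter_upwards [hnear, self_mem_nhdsWithin] with z hz hz'
      exact ⟨⟨hz'.1.1, hz.1⟩, hz'.2⟩
    refine hc.congr_of_eventuallyEq ?_ (by rw [Function.update_of_ne hlt.ne])
    filter_upwards [hnear] with z hz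
    rw [Function.update_of_ne (ne_of_lt hz.1)]

lemma tendsto_fst_strip (s T x : ℝ) :
    Tendsto Prod.fst (𝓝[Ioo s T ×ˢ Icc (0 : ℝ) 1] (T, x)) (𝓝[<] T) := by
  refine tendsto_nhdsWithin_iff.2 ⟨(continuous_fst.tendsto (T, x)).mono_left nhdsWithin_le_nhds, ?_⟩
  filter_upwards [self_mem_nhdsWithin] with z hz
  exact hz.1.2

lemma tendsto_snd_strip (s T x : ℝ) :
    Tendsto Prod.snd (𝓝[Ioo s T ×ˢ Icc (0 : ℝ) 1] (T, x)) (𝓝[Icc 0 1] x) := by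
  refine tendsto_nhdsWithin_iff.2 ⟨(continuous_snd.tendsto (T, x)).mono_left nhdsWithin_le_nhds, ?_⟩
  filter_upwards [self_mem_nhdsWithin] with z hz
  exact hz.2

lemma tendsto_strip_of_tendstoUniformlyOn {g : ℝ → ℝ → ℝ} {gT : ℝ → ℝ}
    (hgT : ContinuousOn gT (Icc 0 1)) (h : TendstoUniformlyOn g gT (𝓝[<] T) (Icc 0 1)) {x : ℝ}
    (hx : x ∈ Icc (0 : ℝ) 1) : Tendsto (fun z : ℝ × ℝ => g z.1 z.2)
      (𝓝[Ioo s T ×ˢ Icc 0 1] (T, x)) (𝓝 (gT x)) := by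
  rw [Metric.tendsto_nhds]
  intro ε hε
  have hg := (tendsto_fst_strip s T x).eventually
    (Metric.tendstoUniformlyOn_iff.1 h (ε / 2) (by positivity))
  have hgT := (tendsto_snd_strip s T x).eventually
    (Metric.tendsto_nhds.1 (hgT x hx) (ε / 2) (by positivity))
  filter_upwards [hg, hgT, self_mem_nhdsWithin] with z hz₁ hz₂ hz
  have := dist_comm (gT z.2) (g z.1 z.2) ▸ hz₁ z.2 hz.2
  linarith [dist_triangle (g z.1 z.2) (gT z.2) (gT x)]

lemma tendstoUniformlyOn_of_abs_deriv_le {g g' : ℝ → ℝ → ℝ} {gT : ℝ → ℝ} {B : ℝ} {X : Set ℝ}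
    (hsT : s < T) (hd : ∀ t ∈ Ioo s T, ∀ x ∈ X, HasDerivAt (fun t => g t x) (g' t x) t)
    (hb : ∀ t ∈ Ioo s T, ∀ x ∈ X, |g' t x| ≤ B)
    (hlim : ∀ x ∈ X, Tendsto (fun t => g t x) (𝓝[<] T) (𝓝 (gT x))) :
    TendstoUniformlyOn g gT (𝓝[<] T) X := by
  have hle : ∀ t ∈ Ioo s T, ∀ x ∈ X, |gT x - g t x| ≤ B * (T - t) := by
    intro t ht x hx
    have hr : Tendsto (fun t' => B * (t' - t)) (𝓝[<] T) (𝓝 (B * (T - t))) :=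
      (Continuous.tendsto (by fun_prop) T).mono_left nhdsWithin_le_nhds
    refine le_of_tendsto_of_tendsto ((hlim x hx).sub_const (g t x)).abs hr ?_
    filter_upwards [Ioo_mem_nhdsLT ht.2] with t' ht'
    have := (convex_Ioo s T).norm_image_sub_le_of_norm_hasDerivWithin_le
      (fun τ hτ => (hd τ hτ x hx).hasDerivWithinAt) (fun τ hτ => hb τ hτ x hx) ht
      ⟨ht.1.trans ht'.1, ht'.2⟩
    simpa [Real.norm_eq_abs, abs_of_pos (sub_pos.2 ht'.1)] using this
  rw [Metric.tendstoUniformlyOn_iff]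
  intro ε hε
  have hzero : Tendsto (fun t => B * (T - t)) (𝓝[<] T) (𝓝 0) := by
    have := (by fun_prop : Continuous fun t => B * (T - t)).tendsto T
    simpa using this.mono_left nhdsWithin_le_nhds
  filter_upwards [hzero.eventually_lt_const hε, Ioo_mem_nhdsLT hsT] with t ht ht' x hx
  exact (Real.dist_eq (gT x) (g t x)).trans_lt ((hle t ht' x hx).trans_lt ht)

end LeftLimits

namespace SLData

variable {A : SLData} {s T : ℝ}

lemma norm_cls_le_sqrt {g h : ℝ → ℝ} {M : ℝ} (hg : ContinuousOn g (Icc 0 1))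
    (hh : ContinuousOn h (Icc 0 1)) (hle : ∀ x ∈ Icc (0 : ℝ) 1, g x ^ 2 ≤ h x)
    (hM : ∫ x in (0 : ℝ)..1, A.r x * h x ≤ M) : ‖A.cls g‖ ≤ √M := by
  refine Real.le_sqrt_of_sq_le ?_
  rw [norm_cls_sq (memLp_wt hg), integral_wt]
  refine le_trans (intervalIntegral.integral_mono_on zero_le_one ?_ ?_ fun x hx => ?_) hM
  · exact intervalIntegrable_of_continuousOn (A.r_cont.mul (hg.pow 2)) (by simp) (by simp)
  · exact intervalIntegrable_of_continuousOn (A.r_cont.mul hh) (by simp) (by simp)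
  · exact mul_le_mul_of_nonneg_left (hle x hx) (A.r_pos x hx).le

lemma norm_cls_le_of_integral_le {g h : ℝ → ℝ} {M : ℝ} (hg : ContinuousOn g (Icc 0 1))
    (hh : A.MemDC2 h)
    (hM : ∫ x in (0 : ℝ)..1, A.r x * (|g x| ^ 2 + |h x| ^ 2 + |A.op h x| ^ 2) ≤ M) :
    ‖A.cls g‖ ≤ √M ∧ ‖A.cls h‖ ≤ √M ∧ ‖A.cls (A.op h)‖ ≤ √M := by
  have hhc := hh.1.continuousOn
  have hop := continuousOn_op (A := A) hh.1
  have hsum : ContinuousOn (fun x => |g x| ^ 2 + |h x| ^ 2 + |A.op h x| ^ 2) (Icc 0 1) :=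
    ((hg.abs.pow 2).add (hhc.abs.pow 2)).add (hop.abs.pow 2)
  simp only [sq_abs] at hsum hM
  exact ⟨norm_cls_le_sqrt hg hsum (fun x _ => by nlinarith [sq_nonneg (h x)]) hM,
    norm_cls_le_sqrt hhc hsum (fun x _ => by nlinarith [sq_nonneg (g x)]) hM,
    norm_cls_le_sqrt hop hsum (fun x _ => by nlinarith [sq_nonneg (g x), sq_nonneg (h x)]) hM⟩

lemma timeRegular_update {g g' : ℝ → ℝ → ℝ} {a b : ℝ → ℝ} {N : ℝ} (hsT : s < T)
    (hg : ContinuousOn (fun z : ℝ × ℝ => g z.1 z.2) (Ioo s T ×ˢ Icc 0 1))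
    (hg' : ContinuousOn (fun z : ℝ × ℝ => g' z.1 z.2) (Ioo s T ×ˢ Icc 0 1))
    (hd : ∀ t ∈ Ioo s T, ∀ x ∈ Icc (0 : ℝ) 1, HasDerivAt (fun t => g t x) (g' t x) t)
    (hN : ∀ t ∈ Ioo s T, ‖A.cls (g t)‖ ≤ N) (ha : ContinuousOn a (Icc 0 1))
    (hb : ContinuousOn b (Icc 0 1))
    (hlim : ∀ x ∈ Icc (0 : ℝ) 1, Tendsto (fun t => g t x) (𝓝[<] T) (𝓝 (a x)))
    (hlim' : TendstoUniformlyOn g' b (𝓝[<] T) (Icc 0 1)) :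
    A.TimeRegular s T (Function.update g T a) g' := by
  have hbound : ∀ s₁ ∈ Ioo s T, ∃ C, 0 < C ∧ ∀ t ∈ Ioo s₁ T, ∀ x ∈ Icc (0 : ℝ) 1,
      |g' t x| ≤ C := by
    intro s₁ hs₁
    obtain ⟨C, hC, hC'⟩ := exists_abs_le_of_continuousOn_strip
      ((continuousOn_update_strip hg' hb fun x => tendsto_strip_of_tendstoUniformlyOn hb hlim').mono
        (prod_mono (Icc_subset_Ioc hs₁.1 le_rfl) Subset.rfl))
    refine ⟨C, hC, fun t ht x hx => ?_⟩
    simpa only [Function.update_of_ne ht.2.ne] using hC' t (Ioo_subset_Icc_self ht) x hx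
  refine ⟨continuousOn_update_strip hg ha fun x => tendsto_strip_of_tendstoUniformlyOn ha ?_, hg',
    fun t ht x hx => ?_, ⟨max N ‖A.cls a‖, ?_⟩, fun s₁ hs₁ => ?_⟩
  · obtain ⟨s₁, hs₁⟩ := exists_between hsT
    obtain ⟨C, -, hC⟩ := hbound s₁ hs₁
    exact tendstoUniformlyOn_of_abs_deriv_le hs₁.2
      (fun t ht => hd t ⟨hs₁.1.trans ht.1, ht.2⟩) hC hlim
  · refine (hd t ht x hx).congr_of_eventuallyEq ?_
    filter_upwards [update_eventuallyEq_of_lt g a ht.2] with y hy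
    rw [hy]
  · exact forall_update_Ioc (P := fun h => ‖A.cls h‖ ≤ max N ‖A.cls a‖)
      (fun t ht => (hN t ht).trans (le_max_left _ _)) (le_max_right _ _)
  · obtain ⟨C, hC, hC'⟩ := hbound s₁ hs₁
    exact ⟨_, fun t ht => norm_cls_le
      (memLp_wt (continuousOn_slice hg' ⟨hs₁.1.trans ht.1, ht.2⟩)) hC.le (hC' t ht)⟩

-- A family with bounded `(A - κ) g` is equicontinuous, being the inner product of a bounded family
-- with the section `x ↦ G(x, ·)` of the Green function.
lemma Green.tendsto_strip_of_norm_le (G : A.Green) {g : ℝ → ℝ → ℝ} {c : ℝ → ℝ} {N : ℝ}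
    (hg : ∀ t ∈ Ioo s T, A.MemDC2 (g t))
    (hN : ∀ t ∈ Ioo s T, ‖A.cls (fun y => A.op (g t) y - G.κ * g t y)‖ ≤ N) {x : ℝ}
    (hx : x ∈ Icc (0 : ℝ) 1) (hlim : Tendsto (fun t => g t x) (𝓝[<] T) (𝓝 (c x))) :
    Tendsto (fun z : ℝ × ℝ => g z.1 z.2) (𝓝[Ioo s T ×ˢ Icc 0 1] (T, x)) (𝓝 (c x)) := by
  have hsec : ContinuousOn (fun y => A.cls (G.ker y)) (Icc 0 1) :=
    continuousOn_iff_continuous_domRestrict.2 G.continuous_section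
  have hker : Tendsto (fun z : ℝ × ℝ => ‖A.cls (G.ker z.2) - A.cls (G.ker x)‖ * N)
      (𝓝[Ioo s T ×ˢ Icc 0 1] (T, x)) (𝓝 0) := by
    have := (((hsec x hx).tendsto.comp (tendsto_snd_strip s T x)).sub_const
      (A.cls (G.ker x))).norm.mul_const N
    simpa only [Function.comp_def, sub_self, norm_zero, zero_mul] using this
  have hosc : Tendsto (fun z : ℝ × ℝ => g z.1 z.2 - g z.1 x)
      (𝓝[Ioo s T ×ˢ Icc 0 1] (T, x)) (𝓝 0) := by
    refine squeeze_zero_norm' ?_ hker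
    filter_upwards [self_mem_nhdsWithin] with z hz
    rw [G.eq_inner_of_memDC2 (hg z.1 hz.1) hz.2, G.eq_inner_of_memDC2 (hg z.1 hz.1) hx,
      ← inner_sub_left]
    exact (norm_inner_le_norm _ _).trans
      (mul_le_mul_of_nonneg_left (hN z.1 hz.1) (norm_nonneg _))
  simpa [Function.comp_def] using hosc.add (hlim.comp (tendsto_fst_strip s T x))

lemma Green.domainValued_update (G : A.Green) {g : ℝ → ℝ → ℝ} {c : ℝ → ℝ} {N : ℝ}
    (hgc : ContinuousOn (fun z : ℝ × ℝ => g z.1 z.2) (Ioo s T ×ˢ Icc 0 1))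
    (hg : ∀ t ∈ Ioo s T, A.MemDC2 (g t)) (hc : A.MemDC2 c)
    (hN : ∀ t ∈ Ioo s T, ‖A.cls (g t)‖ ≤ N ∧ ‖A.cls (A.op (g t))‖ ≤ N)
    (hlim : ∀ x ∈ Icc (0 : ℝ) 1, Tendsto (fun t => g t x) (𝓝[<] T) (𝓝 (c x))) :
    A.DomainValued s T (Function.update g T c) := by
  have hres : ∀ t ∈ Ioo s T, ‖A.cls (fun y => A.op (g t) y - G.κ * g t y)‖ ≤ N + |G.κ| * N :=
    fun t ht => (norm_cls_op_sub_le (hg t ht).1 G.κ).trans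
      (add_le_add (hN t ht).2 (mul_le_mul_of_nonneg_left (hN t ht).1 (abs_nonneg _)))
  refine ⟨continuousOn_update_strip hgc hc.1.continuousOn fun x hx =>
      G.tendsto_strip_of_norm_le hg hres hx (hlim x hx), forall_update_Ioc hg hc,
    ⟨max N ‖A.cls c‖, ?_⟩, ⟨max N ‖A.cls (A.op c)‖, ?_⟩⟩
  · exact forall_update_Ioc (P := fun h => ‖A.cls h‖ ≤ max N ‖A.cls c‖)
      (fun t ht => (hN t ht).1.trans (le_max_left _ _)) (le_max_right _ _)
  · exact forall_update_Ioc (P := fun h => ‖A.cls (A.op h)‖ ≤ max N ‖A.cls (A.op c)‖)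
      (fun t ht => (hN t ht).2.trans (le_max_left _ _)) (le_max_right _ _)

/-- On `(s, T)` the function `f` is the sum of a time regular and a domain valued source, both
extended to `t = T` by the left limits. -/
def SourceOn (A : SLData) (s T : ℝ) (f : ℝ → ℝ → ℝ) : Prop :=
  ∃ F F' H, A.TimeRegular s T F F' ∧ A.DomainValued s T H ∧
    (∀ t ∈ Ioo s T, ∀ x ∈ Icc (0 : ℝ) 1, f t x = F t x + H t x) ∧
    ∀ x ∈ Icc (0 : ℝ) 1, Tendsto (fun t => f t x) (𝓝[<] T) (𝓝 (F T x + H T x))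

lemma GDOn.sourceOn {f : ℝ → ℝ → ℝ} (G : A.Green) (hf : A.GDOn s T f) (hsT : s < T) :
    A.SourceOn s T f := by
  obtain ⟨f₁, f₂, a, b, c, hf₁, hf₂, ha, hb, hc, hmem, hsum, ⟨M, hM⟩, hdiff, hf₁', hlim₁, hlim₁',
    hlim₂⟩ := hf
  have hnorm : ∀ t ∈ Ioo s T, ‖A.cls (f₁ t)‖ ≤ √M ∧ ‖A.cls (f₂ t)‖ ≤ √M ∧
      ‖A.cls (A.op (f₂ t))‖ ≤ √M := fun t ht =>
    norm_cls_le_of_integral_le (hmem t ht).1.1 (hmem t ht).2 (hM t ht)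
  refine ⟨Function.update f₁ T a, fun t x => deriv (fun t => f₁ t x) t, Function.update f₂ T c,
    timeRegular_update hsT hf₁ hf₁' (fun t ht x hx => (hdiff t ht x hx).hasDerivAt)
      (fun t ht => (hnorm t ht).1) ha.1 hb hlim₁ hlim₁',
    G.domainValued_update hf₂ (fun t ht => (hmem t ht).2) hc (fun t ht => (hnorm t ht).2) hlim₂,
    fun t ht x hx => ?_, fun x hx => ?_⟩
  · rw [Function.update_of_ne ht.2.ne, Function.update_of_ne ht.2.ne, hsum t ht x hx]
  · rw [Function.update_self, Function.update_self]
    refine ((hlim₁ x hx).add (hlim₂ x hx)).congr' ?_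
    filter_upwards [Ioo_mem_nhdsLT hsT] with t ht
    exact (hsum t ht x hx).symm

end SLData

/-! ### Time partitions and gluing -/

section Partials

variable {u ut : ℝ → ℝ → ℝ} {J K : Set ℝ} {t x : ℝ}

lemma isLittleO_fst_of_hasDerivWithinAt (hJ : Convex ℝ J) (ht : t ∈ J)
    (hu : ∀ s ∈ J, ∀ y ∈ K, HasDerivWithinAt (fun s => u s y) (ut s y) J s)
    (hut : ContinuousWithinAt (fun z : ℝ × ℝ => ut z.1 z.2) (J ×ˢ K) (t, x)) :
    (fun z : ℝ × ℝ => u z.1 z.2 - u t z.2 - (z.1 - t) * ut t x)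
      =o[𝓝[J ×ˢ K] (t, x)] fun z => z.1 - t := by
  refine Asymptotics.isLittleO_iff.2 fun ε hε => ?_
  obtain ⟨δ, hδ, hclose⟩ := Metric.continuousWithinAt_iff.1 hut ε hε
  filter_upwards [self_mem_nhdsWithin, mem_nhdsWithin_of_mem_nhds (Metric.ball_mem_nhds _ hδ)]
  rintro ⟨s, y⟩ ⟨hs, hy⟩ hball
  obtain ⟨hst, hyx⟩ := max_lt_iff.1 (Metric.mem_ball.1 hball)
  have hmean := (hJ.inter (convex_ball t δ)).norm_image_sub_le_of_norm_hasDerivWithin_le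
    (f := fun σ => u σ y - σ * ut t x) (f' := fun σ => ut σ y - ut t x) (C := ε)
    (fun σ hσ => (((hu σ hσ.1 y hy).sub ((hasDerivWithinAt_id σ J).mul_const (ut t x))).congr_deriv
      (by rw [one_mul])).mono inter_subset_left)
    (fun σ hσ => (hclose (x := (σ, y)) ⟨hσ.1, hy⟩ (max_lt hσ.2 hyx)).le)
    ⟨ht, Metric.mem_ball_self hδ⟩ ⟨hs, hst⟩
  have hsplit : u s y - u t y - (s - t) * ut t x =
      u s y - s * ut t x - (u t y - t * ut t x) := by ring
  simpa only [hsplit] using hmean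

lemma hasFDerivWithinAt_of_partials (hJ : Convex ℝ J) (ht : t ∈ J)
    (hu : ∀ s ∈ J, ∀ y ∈ K, HasDerivWithinAt (fun s => u s y) (ut s y) J s)
    (hut : ContinuousWithinAt (fun z : ℝ × ℝ => ut z.1 z.2) (J ×ˢ K) (t, x)) {c : ℝ}
    (hx : HasDerivWithinAt (u t) c K x) :
    HasFDerivWithinAt (fun z : ℝ × ℝ => u z.1 z.2)
      (ut t x • ContinuousLinearMap.fst ℝ ℝ ℝ + c • ContinuousLinearMap.snd ℝ ℝ ℝ) (J ×ˢ K)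
      (t, x) := by
  have hsnd : Tendsto Prod.snd (𝓝[J ×ˢ K] (t, x)) (𝓝[K] x) := by
    rw [nhdsWithin_prod_eq]
    exact tendsto_snd
  have hfst_le : (fun z : ℝ × ℝ => z.1 - t) =O[𝓝[J ×ˢ K] (t, x)] fun z => z - (t, x) :=
    Asymptotics.isBigO_of_le _ fun z => norm_fst_le (z - (t, x))
  have hsnd_le : (fun z : ℝ × ℝ => z.2 - x) =O[𝓝[J ×ˢ K] (t, x)] fun z => z - (t, x) :=
    Asymptotics.isBigO_of_le _ fun z => norm_snd_le (z - (t, x))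
  have htime := (isLittleO_fst_of_hasDerivWithinAt hJ ht hu hut).trans_isBigO hfst_le
  have hspace := ((hasDerivWithinAt_iff_isLittleO.1 hx).comp_tendsto hsnd).trans_isBigO hsnd_le
  refine hasFDerivWithinAt_iff_isLittleO.2 ((htime.add hspace).congr_left fun z => ?_)
  simp only [Function.comp_apply, smul_eq_mul, add_apply, smul_apply,
    ContinuousLinearMap.coe_fst', ContinuousLinearMap.coe_snd', Prod.fst_sub, Prod.snd_sub]
  ring

lemma contDiffOn_one_of_partials {ux : ℝ → ℝ → ℝ} (hJ : Convex ℝ J)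
    (hJK : UniqueDiffOn ℝ (J ×ˢ K))
    (ht : ∀ t ∈ J, ∀ x ∈ K, HasDerivWithinAt (fun s => u s x) (ut t x) J t)
    (hx : ∀ t ∈ J, ∀ x ∈ K, HasDerivWithinAt (u t) (ux t x) K x)
    (hut : ContinuousOn (fun z : ℝ × ℝ => ut z.1 z.2) (J ×ˢ K))
    (hux : ContinuousOn (fun z : ℝ × ℝ => ux z.1 z.2) (J ×ˢ K)) :
    ContDiffOn ℝ 1 (fun z : ℝ × ℝ => u z.1 z.2) (J ×ˢ K) := by
  have hD : ∀ z ∈ J ×ˢ K, HasFDerivWithinAt (fun z : ℝ × ℝ => u z.1 z.2)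
      (ut z.1 z.2 • ContinuousLinearMap.fst ℝ ℝ ℝ + ux z.1 z.2 • ContinuousLinearMap.snd ℝ ℝ ℝ)
      (J ×ˢ K) z := fun z hz =>
    hasFDerivWithinAt_of_partials hJ hz.1 ht (hut z hz) (hx z.1 hz.1 z.2 hz.2)
  refine (contDiffOn_succ_iff_fderivWithin (n := 0) hJK).2
    ⟨fun z hz => (hD z hz).differentiableWithinAt, by simp, contDiffOn_zero.2 ?_⟩
  exact ((hut.smul continuousOn_const).add (hux.smul continuousOn_const)).congr fun z hz =>
    (hD z hz).fderivWithin (hJK z hz)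

lemma hasDerivAt_fst_of_contDiffOn (hJ : IsOpen J)
    (hu : ContDiffOn ℝ 1 (fun z : ℝ × ℝ => u z.1 z.2) (J ×ˢ K)) (ht : t ∈ J) (hx : x ∈ K) :
    HasDerivAt (fun s => u s x)
      (fderivWithin ℝ (fun z : ℝ × ℝ => u z.1 z.2) (J ×ˢ K) (t, x) (1, 0)) t := by
  have hline : HasDerivWithinAt (fun s : ℝ => (s, x)) (1, 0) J t :=
    ((hasDerivAt_id t).prodMk (hasDerivAt_const t x)).hasDerivWithinAt
  exact ((hu.differentiableOn one_ne_zero (t, x) ⟨ht, hx⟩).hasFDerivWithinAt.comp_hasDerivWithinAt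
    (f := fun s : ℝ => (s, x)) t hline fun s hs => ⟨hs, hx⟩).hasDerivAt (hJ.mem_nhds ht)

lemma continuousOn_deriv_fst (hJ : IsOpen J) (hK : UniqueDiffOn ℝ K)
    (hu : ContDiffOn ℝ 1 (fun z : ℝ × ℝ => u z.1 z.2) (J ×ˢ K)) :
    ContinuousOn (fun z : ℝ × ℝ => deriv (fun s => u s z.2) z.1) (J ×ˢ K) :=
  ((hu.continuousOn_fderivWithin (hJ.uniqueDiffOn.prod hK) le_rfl).clm_apply
    (continuousOn_const (c := ((1 : ℝ), (0 : ℝ))))).congr fun _ hz =>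
      (hasDerivAt_fst_of_contDiffOn hJ hu hz.1 hz.2).deriv

end Partials

namespace IsTimes

variable {τ : ℕ → ℝ}

lemma lt_succ (hτ : IsTimes τ) (i : ℕ) : τ i < τ (i + 1) := hτ.1 i.lt_succ_self

lemma nonneg (hτ : IsTimes τ) (i : ℕ) : 0 ≤ τ i := hτ.2.1 ▸ hτ.1.monotone i.zero_le

lemma exists_mem_Ioc (hτ : IsTimes τ) {t : ℝ} (ht : 0 < t) :
    ∃ i, t ∈ Ioc (τ i) (τ (i + 1)) := by
  have hex : ∃ n, t ≤ τ n := (hτ.2.2.eventually_ge_atTop t).exists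
  have hne : Nat.find hex ≠ 0 := fun h => ht.not_ge (by
    simpa only [h, hτ.2.1] using Nat.find_spec hex)
  obtain ⟨i, hi⟩ := Nat.exists_eq_succ_of_ne_zero hne
  exact ⟨i, not_le.1 (Nat.find_min hex (hi ▸ i.lt_succ_self)), by
    simpa only [hi] using Nat.find_spec hex⟩

lemma exists_mem_Ico (hτ : IsTimes τ) {t : ℝ} (ht : 0 ≤ t) :
    ∃ i, t ∈ Ico (τ i) (τ (i + 1)) := by
  rcases ht.eq_or_lt with rfl | h0
  · exact ⟨0, hτ.2.1.le, hτ.2.1 ▸ hτ.lt_succ 0⟩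
  · obtain ⟨i, hi⟩ := hτ.exists_mem_Ioc h0
    rcases hi.2.eq_or_lt with rfl | h
    · exact ⟨i + 1, le_rfl, hτ.lt_succ (i + 1)⟩
    · exact ⟨i, hi.1.le, h⟩

lemma eq_of_mem_Ioc (hτ : IsTimes τ) {t : ℝ} {i j : ℕ} (hi : t ∈ Ioc (τ i) (τ (i + 1)))
    (hj : t ∈ Ioc (τ j) (τ (j + 1))) : i = j := by
  have h1 := hτ.1.lt_iff_lt.1 (hi.1.trans_le hj.2)
  have h2 := hτ.1.lt_iff_lt.1 (hj.1.trans_le hi.2)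
  omega

lemma Ioo_subset_offTimes (hτ : IsTimes τ) (i : ℕ) : Ioo (τ i) (τ (i + 1)) ⊆ offTimes τ := by
  refine fun t ht => ⟨(hτ.nonneg i).trans ht.1.le, ?_⟩
  rintro ⟨j, rfl⟩
  have h1 := hτ.1.lt_iff_lt.1 ht.1
  have h2 := hτ.1.lt_iff_lt.1 ht.2
  omega

lemma exists_mem_Ioo (hτ : IsTimes τ) {t : ℝ} (ht : t ∈ offTimes τ) :
    ∃ i, t ∈ Ioo (τ i) (τ (i + 1)) := by
  have h0 : t ≠ 0 := fun h => ht.2 ⟨0, hτ.2.1.trans h.symm⟩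
  obtain ⟨i, hi⟩ := hτ.exists_mem_Ioc (lt_of_le_of_ne ht.1 h0.symm)
  exact ⟨i, hi.1, lt_of_le_of_ne hi.2 fun h => ht.2 ⟨i + 1, h.symm⟩⟩

lemma continuousOn_Ici {X : Type*} [TopologicalSpace X] {g : ℝ → X} (hτ : IsTimes τ)
    (hg : ∀ i, ContinuousOn g (Icc (τ i) (τ (i + 1)))) : ContinuousOn g (Ici 0) := by
  intro t ht
  have hright : ContinuousWithinAt g (Ici t) t := by
    obtain ⟨i, hi⟩ := hτ.exists_mem_Ico ht
    exact (hg i t (Ico_subset_Icc_self hi)).mono_of_mem_nhdsWithin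
      (mem_of_superset (Icc_mem_nhdsGE hi.2) (Icc_subset_Icc_left hi.1))
  rcases (mem_Ici.1 ht).eq_or_lt with rfl | h0
  · exact hright
  have hleft : ContinuousWithinAt g (Iic t) t := by
    obtain ⟨j, hj⟩ := hτ.exists_mem_Ioc h0
    exact (hg j t (Ioc_subset_Icc_self hj)).mono_of_mem_nhdsWithin
      (mem_of_superset (Icc_mem_nhdsLE hj.1) (Icc_subset_Icc_right hj.2))
  exact (continuousAt_iff_continuous_left_right.2 ⟨hleft, hright⟩).continuousWithinAt

end IsTimes

lemma GBAlong.boundaryOn {τ : ℕ → ℝ} {d : ℝ → ℝ} (hd : GBAlong τ d) (hτ : IsTimes τ) (i : ℕ) :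
    BoundaryOn (τ i) (τ (i + 1)) d := by
  obtain ⟨⟨L, hL⟩, ⟨L', hL'⟩, ⟨L'', hL''⟩⟩ := hd.2.2.1 (i + 1) i.succ_pos
  exact boundaryOn_of_contDiffOn (hτ.lt_succ i) (hd.1 _ (hτ.nonneg i))
    (hd.2.1.mono (hτ.Ioo_subset_offTimes i)) hL hL' hL'' (hd.2.2.2 i)

lemma tendsto_left_of_continuousOn {F : ℝ → ℝ → ℝ} {s T : ℝ} (hsT : s < T)
    (hF : ContinuousOn (fun z : ℝ × ℝ => F z.1 z.2) (Ioc s T ×ˢ Icc 0 1)) {x : ℝ}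
    (hx : x ∈ Icc (0 : ℝ) 1) : Tendsto (fun t => F t x) (𝓝[<] T) (𝓝 (F T x)) := by
  have h := continuousOn_time hF hx T (right_mem_Ioc.2 hsT)
  rw [ContinuousWithinAt, nhdsWithin_Ioc_eq_nhdsLE hsT] at h
  exact h.mono_left (nhdsWithin_mono _ Iio_subset_Iic_self)

namespace SLData

variable {A : SLData} {s T : ℝ} {F : ℝ → ℝ → ℝ} {D₀ D₁ u₀ : ℝ → ℝ} {u u' v : ℝ → ℝ → ℝ}

namespace IntervalSol

lemma congr (hu : A.IntervalSol s T F D₀ D₁ u₀ u u') (h : EqOn v u (Ioc s T)) :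
    A.IntervalSol s T F D₀ D₁ u₀ v u' where
  continuousOn := hu.continuousOn.congr fun z hz => by simp only [h hz.1]
  continuousOn_dx := hu.continuousOn_dx.congr fun z hz => by simp only [h hz.1]
  continuousOn_dt := hu.continuousOn_dt
  contDiffOn_two t ht := by
    rw [h ht]
    exact hu.contDiffOn_two t ht
  hasDerivAt t ht x hx := (hu.hasDerivAt t ht x hx).congr_of_eventuallyEq <| by
    filter_upwards [Ioo_mem_nhds ht.1 ht.2] with y hy
    rw [h (Ioo_subset_Ioc_self hy)]
  equation t ht x hx := by
    rw [h ht]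
    exact hu.equation t ht x hx
  bc0 t ht := by rw [h ht, hu.bc0 t ht]
  bc1 t ht := by rw [h ht, hu.bc1 t ht]
  tendsto_initial := hu.tendsto_initial.congr' <| by
    filter_upwards [self_mem_nhdsWithin] with t ht
    rw [h ht]

lemma contDiffOn_one (hu : A.IntervalSol s T F D₀ D₁ u₀ u u') :
    ContDiffOn ℝ 1 (fun z : ℝ × ℝ => u z.1 z.2) (Ioo s T ×ˢ Icc 0 1) := by
  have hsub : Ioo s T ×ˢ Icc (0 : ℝ) 1 ⊆ Ioc s T ×ˢ Icc 0 1 :=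
    prod_mono Ioo_subset_Ioc_self Subset.rfl
  exact contDiffOn_one_of_partials (ux := fun t => dx (u t)) (convex_Ioo s T)
    (isOpen_Ioo.uniqueDiffOn.prod uniqueDiffOn_unit)
    (fun t ht x hx => (hu.hasDerivAt t ht x hx).hasDerivWithinAt)
    (fun t ht x hx => hasDerivWithinAt_dx
      ((hu.contDiffOn_two t (Ioo_subset_Ioc_self ht)).of_le one_le_two) hx)
    (hu.continuousOn_dt.mono hsub) (hu.continuousOn_dx.mono hsub)

lemma memLp (hu : A.IntervalSol s T F D₀ D₁ u₀ u u') {t : ℝ} (ht : t ∈ Ioc s T) :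
    MemLp (u t) 2 A.wt := memLp_wt (hu.contDiffOn_two t ht).continuousOn

lemma continuousOn_cls (hu : A.IntervalSol s T F D₀ D₁ (u s) u u') (hsT : s < T) :
    ContinuousOn (fun t => A.cls (u t)) (Icc s T) := by
  intro t ht
  rcases ht.1.eq_or_lt with rfl | hlt
  · rw [← Ioc_insert_left hsT.le, continuousWithinAt_insert_self]
    exact hu.tendsto_initial
  · exact (SLData.continuousOn_cls hu.continuousOn t ⟨hlt, ht.2⟩).mono_of_mem_nhdsWithin
      (mem_nhdsWithin.2 ⟨Ioi s, isOpen_Ioi, hlt, fun y hy => ⟨hy.1, hy.2.2⟩⟩)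

end IntervalSol

variable {f : ℝ → ℝ → ℝ} {d₀ d₁ : ℝ → ℝ} {τ : ℕ → ℝ}

variable (A) in
/-- `u` solves the problem with inputs `f, d₀, d₁` on `(s, T)`, takes the initial value `u₀` at `s`
in `L²_r(0,1)`, and solves it up to `T` for inputs `F, D₀, D₁` that agree with `f, d₀, d₁` before
`T`; at `T` itself `F` is the left limit of `f`. -/
def SolvesOn (s T : ℝ) (f : ℝ → ℝ → ℝ) (d₀ d₁ u₀ : ℝ → ℝ) (u : ℝ → ℝ → ℝ) : Prop :=
  ∃ F D₀ D₁ u', A.IntervalSol s T F D₀ D₁ u₀ u u' ∧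
    (∀ t ∈ Ioo s T, ∀ x ∈ Icc (0 : ℝ) 1, f t x = F t x) ∧
    (∀ x ∈ Icc (0 : ℝ) 1, Tendsto (fun t => f t x) (𝓝[<] T) (𝓝 (F T x))) ∧
    EqOn d₀ D₀ (Ioo s T) ∧ EqOn d₁ D₁ (Ioo s T)

lemma SolvesOn.congr (hu : A.SolvesOn s T f d₀ d₁ u₀ u) (h : EqOn v u (Ioc s T)) :
    A.SolvesOn s T f d₀ d₁ u₀ v := by
  obtain ⟨F, D₀, D₁, u', hsol, hinput⟩ := hu
  exact ⟨F, D₀, D₁, u', hsol.congr h, hinput⟩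

lemma SolvesOn.memLp (hu : A.SolvesOn s T f d₀ d₁ u₀ u) {t : ℝ} (ht : t ∈ Ioc s T) :
    MemLp (u t) 2 A.wt := by
  obtain ⟨_, _, _, _, hsol, -⟩ := hu
  exact hsol.memLp ht

lemma Spectral.exists_solvesOn (S : A.Spectral) (hsT : s < T) (hf : A.SourceOn s T f)
    (hd₀ : BoundaryOn s T d₀) (hd₁ : BoundaryOn s T d₁) (hu₀ : MemLp u₀ 2 A.wt) :
    ∃ u, A.SolvesOn s T f d₀ d₁ u₀ u := by
  obtain ⟨F, F', H, hF, hH, hsum, hlim⟩ := hf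
  obtain ⟨D₀, _, _, heq₀, hD₀⟩ := hd₀
  obtain ⟨D₁, _, _, heq₁, hD₁⟩ := hd₁
  obtain ⟨u, u', hu⟩ := S.exists_intervalSol hsT hF hH hD₀ hD₁ hu₀
  exact ⟨u, _, D₀, D₁, u', hu, hsum, hlim, heq₀, heq₁⟩

lemma SolvesOn.tendsto_deriv (hu : A.SolvesOn s T f d₀ d₁ u₀ u) (hsT : s < T) {x : ℝ}
    (hx : x ∈ Icc (0 : ℝ) 1) :
    ∃ L, Tendsto (fun t => f t x) (𝓝[<] T) (𝓝 L) ∧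
      Tendsto (fun t => deriv (fun s => u s x) t) (𝓝[<] T) (𝓝 (-A.op (u T) x + L)) := by
  obtain ⟨F, _, _, u', hsol, -, hlim, -⟩ := hu
  refine ⟨F T x, hlim x hx, ?_⟩
  rw [← hsol.equation T (right_mem_Ioc.2 hsT) x hx]
  refine (tendsto_left_of_continuousOn hsT hsol.continuousOn_dt hx).congr' ?_
  filter_upwards [Ioo_mem_nhdsLT hsT] with t ht
  exact (hsol.hasDerivAt t ht x hx).deriv.symm

lemma SolvesOn.deriv_eq (hu : A.SolvesOn s T f d₀ d₁ u₀ u) {t x : ℝ} (ht : t ∈ Ioo s T)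
    (hx : x ∈ Icc (0 : ℝ) 1) : deriv (fun s => u s x) t = -A.op (u t) x + f t x := by
  obtain ⟨F, _, _, u', hsol, hf, -⟩ := hu
  rw [(hsol.hasDerivAt t ht x hx).deriv, hsol.equation t (Ioo_subset_Ioc_self ht) x hx,
    hf t ht x hx]

lemma SolvesOn.boundary (hu : A.SolvesOn s T f d₀ d₁ u₀ u) {t : ℝ} (ht : t ∈ Ioo s T) :
    A.bc0 (u t) = d₀ t ∧ A.bc1 (u t) = d₁ t := by
  obtain ⟨_, D₀, D₁, _, hsol, -, -, hd₀, hd₁⟩ := hu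
  have ht' := Ioo_subset_Ioc_self ht
  exact ⟨by rw [hsol.bc0 t ht', hd₀ ht], by rw [hsol.bc1 t ht', hd₁ ht]⟩

lemma contL2_of_solvesOn (hτ : IsTimes τ) (h0 : MemLp (u 0) 2 A.wt)
    (hu : ∀ i, A.SolvesOn (τ i) (τ (i + 1)) f d₀ d₁ (u (τ i)) u) : A.ContL2 u := by
  have hmem : ∀ t, 0 ≤ t → MemLp (u t) 2 A.wt := by
    intro t ht
    rcases ht.eq_or_lt with rfl | ht
    · exact h0
    · obtain ⟨i, hi⟩ := hτ.exists_mem_Ioc ht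
      exact (hu i).memLp hi
  have hcls : ContinuousOn (fun t => A.cls (u t)) (Ici 0) := hτ.continuousOn_Ici fun i => by
    obtain ⟨_, _, _, _, hsol, -⟩ := hu i
    exact hsol.continuousOn_cls (hτ.lt_succ i)
  exact ⟨hmem, fun t₀ ht₀ => (tendsto_eLpNorm_iff
    (mem_of_superset self_mem_nhdsWithin hmem) (hmem t₀ ht₀)).2 (hcls t₀ ht₀)⟩

lemma contDiffOn_one_of_solvesOn (hτ : IsTimes τ) {g : ℕ → ℝ → ℝ}
    (hu : ∀ i, A.SolvesOn (τ i) (τ (i + 1)) f d₀ d₁ (g i) u) :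
    ContDiffOn ℝ 1 (fun z : ℝ × ℝ => u z.1 z.2) (offTimes τ ×ˢ Icc 0 1) := by
  rintro ⟨t, x⟩ ⟨ht, hx⟩
  obtain ⟨i, hi⟩ := hτ.exists_mem_Ioo ht
  obtain ⟨_, _, _, _, hsol, -⟩ := hu i
  exact (hsol.contDiffOn_one (t, x) ⟨hi, hx⟩).mono_of_mem_nhdsWithin (mem_nhdsWithin.2
    ⟨Ioo (τ i) (τ (i + 1)) ×ˢ univ, isOpen_Ioo.prod isOpen_univ, ⟨hi, mem_univ x⟩,
      fun z hz => ⟨hz.1.1, hz.2.2⟩⟩)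

lemma isSolution_of_solvesOn (hτ : IsTimes τ) (hu₀ : MemLp u₀ 2 A.wt) (h0 : u 0 = u₀)
    (hu : ∀ i, A.SolvesOn (τ i) (τ (i + 1)) f d₀ d₁ (u (τ i)) u) :
    A.IsSolution τ f d₀ d₁ u₀ u where
  contL2 := contL2_of_solvesOn hτ (h0 ▸ hu₀) hu
  contDiff_one := contDiffOn_one_of_solvesOn hτ hu
  contDiff_two t ht := by
    obtain ⟨i, hi⟩ := hτ.exists_mem_Ioc ht
    obtain ⟨_, _, _, _, hsol, -⟩ := hu i
    exact hsol.contDiffOn_two t hi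
  left_limit i hi x hx := by
    obtain ⟨j, rfl⟩ := Nat.exists_eq_add_of_le' hi
    obtain ⟨_, _, _, _, hsol, -⟩ := hu j
    exact tendsto_left_of_continuousOn (hτ.lt_succ j) hsol.continuousOn hx
  left_limit_dt i hi x hx := by
    obtain ⟨j, rfl⟩ := Nat.exists_eq_add_of_le' hi
    exact (hu j).tendsto_deriv (hτ.lt_succ j) hx
  left_limit_dx i hi x hx := by
    obtain ⟨j, rfl⟩ := Nat.exists_eq_add_of_le' hi
    obtain ⟨_, _, _, _, hsol, -⟩ := hu j
    exact tendsto_left_of_continuousOn (hτ.lt_succ j) hsol.continuousOn_dx hx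
  initial x _ := by rw [h0]
  pde t ht x hx := by
    obtain ⟨i, hi⟩ := hτ.exists_mem_Ioo ht
    rw [(hu i).deriv_eq hi (Ioo_subset_Icc_self hx), op]
    ring
  boundary t ht := by
    obtain ⟨i, hi⟩ := hτ.exists_mem_Ioo ht
    obtain ⟨h₀, h₁⟩ := (hu i).boundary hi
    exact ⟨sub_eq_zero.2 h₀, sub_eq_zero.2 h₁⟩

theorem Spectral.exists_isSolution (S : A.Spectral) (hτ : IsTimes τ)
    (hf : ∀ i, A.SourceOn (τ i) (τ (i + 1)) f) (hd₀ : ∀ i, BoundaryOn (τ i) (τ (i + 1)) d₀)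
    (hd₁ : ∀ i, BoundaryOn (τ i) (τ (i + 1)) d₁) (hu₀ : MemLp u₀ 2 A.wt) :
    ∃ u, A.IsSolution τ f d₀ d₁ u₀ u := by
  classical
  choose U hU using fun (i : ℕ) (g : {g : ℝ → ℝ // MemLp g 2 A.wt}) =>
    S.exists_solvesOn (hτ.lt_succ i) (hf i) (hd₀ i) (hd₁ i) g.2
  let start : ℕ → {g : ℝ → ℝ // MemLp g 2 A.wt} := fun n => Nat.rec ⟨u₀, hu₀⟩
    (fun i g => ⟨U i g (τ (i + 1)), (hU i g).memLp (right_mem_Ioc.2 (hτ.lt_succ i))⟩) n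
  let u : ℝ → ℝ → ℝ := fun t =>
    if h : ∃ i, t ∈ Ioc (τ i) (τ (i + 1)) then U h.choose (start h.choose) t else u₀
  have hpiece (i : ℕ) : EqOn u (U i (start i)) (Ioc (τ i) (τ (i + 1))) := by
    intro t ht
    have hex : ∃ i, t ∈ Ioc (τ i) (τ (i + 1)) := ⟨i, ht⟩
    simp only [u, dif_pos hex, hτ.eq_of_mem_Ioc hex.choose_spec ht]
  have h0 : u 0 = u₀ := dif_neg fun ⟨i, hi⟩ => (hτ.nonneg i).not_gt hi.1
  have hstart (i : ℕ) : u (τ i) = (start i).1 := by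
    cases i with
    | zero => exact (congrArg u hτ.2.1).trans h0
    | succ i => exact hpiece i (right_mem_Ioc.2 (hτ.lt_succ i))
  refine ⟨u, isSolution_of_solvesOn hτ hu₀ h0 fun i => ?_⟩
  rw [hstart i]
  exact (hU i (start i)).congr (hpiece i)

end SLData

/-! ### Uniqueness -/

namespace SLData

variable {A : SLData} {f : ℝ → ℝ → ℝ} {d₀ d₁ u₀ : ℝ → ℝ} {u v : ℝ → ℝ → ℝ} {τ : ℕ → ℝ}

namespace IsSolution

lemma continuousOn_coef (S : A.Spectral) (hu : A.IsSolution τ f d₀ d₁ u₀ u) (μ : A.Eig) :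
    ContinuousOn (fun t => S.coef (u t) μ) (Ici 0) := by
  have hcls : ContinuousOn (fun t => A.cls (u t)) (Ici 0) := fun t ht =>
    (tendsto_eLpNorm_iff (mem_of_superset self_mem_nhdsWithin hu.contL2.1)
      (hu.contL2.1 t ht)).1 (hu.contL2.2 t ht)
  exact (ContinuousOn.inner (𝕜 := ℝ) continuousOn_const hcls).congr
    fun t ht => S.coef_eq_inner (hu.contL2.1 t ht) μ

lemma continuousOn_deriv (hu : A.IsSolution τ f d₀ d₁ u₀ u) (hτ : IsTimes τ) (i : ℕ) :
    ContinuousOn (fun z : ℝ × ℝ => deriv (fun s => u s z.2) z.1)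
      (Ioo (τ i) (τ (i + 1)) ×ˢ Icc 0 1) :=
  continuousOn_deriv_fst isOpen_Ioo uniqueDiffOn_unit
    (hu.contDiff_one.mono (prod_mono (hτ.Ioo_subset_offTimes i) Subset.rfl))

lemma hasDerivAt_coef (S : A.Spectral) (hu : A.IsSolution τ f d₀ d₁ u₀ u) (hτ : IsTimes τ)
    (μ : A.Eig) {i : ℕ} {t : ℝ} (ht : t ∈ Ioo (τ i) (τ (i + 1))) :
    HasDerivAt (fun t => S.coef (u t) μ) (S.coef (fun x => deriv (fun s => u s x) t) μ) t := by
  have hC1 := hu.contDiff_one.mono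
    (prod_mono (hτ.Ioo_subset_offTimes i) (Subset.refl (Icc (0 : ℝ) 1)))
  refine S.hasDerivAt_coef (g' := fun t x => deriv (fun s => u s x) t) hC1.continuousOn
    (hu.continuousOn_deriv hτ i) (fun t ht x hx => ?_) μ ht
  exact (hasDerivAt_fst_of_contDiffOn isOpen_Ioo hC1 ht hx).differentiableAt.hasDerivAt

lemma memDC2_sub (hu : A.IsSolution τ f d₀ d₁ u₀ u) (hv : A.IsSolution τ f d₀ d₁ u₀ v)
    {t : ℝ} (ht0 : 0 < t) (ht : t ∈ offTimes τ) : A.MemDC2 (fun x => 1 * u t x + -1 * v t x) := by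
  have hu2 := hu.contDiff_two t ht0
  have hv2 := hv.contDiff_two t ht0
  refine ⟨(contDiffOn_const.mul hu2).add (contDiffOn_const.mul hv2), ?_, ?_⟩
  · rw [bc0_combo (hu2.of_le one_le_two) (hv2.of_le one_le_two)]
    linear_combination (hu.boundary t ht).1 - (hv.boundary t ht).1
  · rw [bc1_combo (hu2.of_le one_le_two) (hv2.of_le one_le_two)]
    linear_combination (hu.boundary t ht).2 - (hv.boundary t ht).2

lemma deriv_sub_eq (hu : A.IsSolution τ f d₀ d₁ u₀ u) (hv : A.IsSolution τ f d₀ d₁ u₀ v)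
    {t : ℝ} (ht0 : 0 < t) (ht : t ∈ offTimes τ) {x : ℝ} (hx : x ∈ Ioo (0 : ℝ) 1) :
    -1 * deriv (fun s => u s x) t + 1 * deriv (fun s => v s x) t =
      A.op (fun x => 1 * u t x + -1 * v t x) x := by
  have hu_pde := hu.pde t ht x hx
  have hv_pde := hv.pde t ht x hx
  rw [op_combo (hu.contDiff_two t ht0) (hv.contDiff_two t ht0) 1 (-1) (Ioo_subset_Icc_self hx),
    op, op]
  linear_combination hv_pde - hu_pde

lemma hasDerivAt_coef_sub (S : A.Spectral) (hτ : IsTimes τ) (hu : A.IsSolution τ f d₀ d₁ u₀ u)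
    (hv : A.IsSolution τ f d₀ d₁ u₀ v) (μ : A.Eig) {i : ℕ} {t : ℝ}
    (ht : t ∈ Ioo (τ i) (τ (i + 1))) :
    HasDerivAt (fun t => S.coef (u t) μ - S.coef (v t) μ)
      (-μ * (S.coef (u t) μ - S.coef (v t) μ)) t := by
  have ht0 : 0 < t := (hτ.nonneg i).trans_lt ht.1
  have hoff := hτ.Ioo_subset_offTimes i ht
  have hmem {w : ℝ → ℝ → ℝ} (hw : A.IsSolution τ f d₀ d₁ u₀ w) :
      MemLp (fun x => deriv (fun s => w s x) t) 2 A.wt :=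
    memLp_wt (continuousOn_slice (F := fun t x => deriv (fun s => w s x) t)
      (hw.continuousOn_deriv hτ i) ht)
  have hderiv : -1 * S.coef (fun x => deriv (fun s => u s x) t) μ
        + 1 * S.coef (fun x => deriv (fun s => v s x) t) μ
      = μ * (1 * S.coef (u t) μ + -1 * S.coef (v t) μ) := by
    rw [← S.coef_combo (hmem hu) (hmem hv), ← S.coef_combo (hu.contL2.1 t ht0.le)
      (hv.contL2.1 t ht0.le), ← S.coef_op (hu.memDC2_sub hv ht0 hoff)]
    exact integral_congr_ae (A.ae_wt_mem_Ioo.mono fun x hx => by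
      simp only [hu.deriv_sub_eq hv ht0 hoff hx])
  refine ((hu.hasDerivAt_coef S hτ μ ht).sub (hv.hasDerivAt_coef S hτ μ ht)).congr_deriv ?_
  linear_combination -hderiv

lemma coef_eq (S : A.Spectral) (hτ : IsTimes τ) (hu : A.IsSolution τ f d₀ d₁ u₀ u)
    (hv : A.IsSolution τ f d₀ d₁ u₀ v) (μ : A.Eig) {t : ℝ} (ht : 0 < t) :
    S.coef (v t) μ = S.coef (u t) μ := by
  let c : ℝ → ℝ := fun t => S.coef (u t) μ - S.coef (v t) μ
  have hc : ContinuousOn c (Ici 0) := (hu.continuousOn_coef S μ).sub (hv.continuousOn_coef S μ)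
  have hstep (i : ℕ) (hi : c (τ i) = 0) : ∀ t ∈ Icc (τ i) (τ (i + 1)), c t = 0 := by
    intro t ht
    have hbound := abs_le_of_mode (y := c) (g := 0) (μ := μ) (κ := min 0 (μ - 1)) (M := 0)
      (min_le_left _ _) (by linarith [min_le_right 0 ((μ : ℝ) - 1)]) le_rfl
      (hc.mono fun y hy => (hτ.nonneg i).trans hy.1)
      (fun y hy => (hu.hasDerivAt_coef_sub S hτ hv μ hy).congr_deriv (by simp [c]))
      (fun y _ => by simp) ht
    simpa only [hi, abs_zero, mul_zero, zero_div, add_zero, abs_nonpos_iff] using hbound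
  have hzero (i : ℕ) : c (τ i) = 0 := by
    induction i with
    | zero =>
      rw [hτ.2.1]
      exact sub_eq_zero.2 (S.coef_congr
        (fun x hx => (hu.initial x hx).trans (hv.initial x hx).symm) μ)
    | succ i ih => exact hstep i ih _ (right_mem_Icc.2 (hτ.lt_succ i).le)
  obtain ⟨i, hi⟩ := hτ.exists_mem_Ioc ht
  exact (sub_eq_zero.1 (hstep i (hzero i) t (Ioc_subset_Icc_self hi))).symm

theorem eqOn (S : A.Spectral) (hτ : IsTimes τ) (hu : A.IsSolution τ f d₀ d₁ u₀ u)
    (hv : A.IsSolution τ f d₀ d₁ u₀ v) {t : ℝ} (ht : 0 ≤ t) : EqOn (v t) (u t) (Icc 0 1) := by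
  rcases ht.eq_or_lt with rfl | ht
  · exact fun x hx => (hv.initial x hx).trans (hu.initial x hx).symm
  · exact S.eqOn_of_coef (hv.contDiff_two t ht).continuousOn (hu.contDiff_two t ht).continuousOn
      fun μ => hu.coef_eq S hτ hv μ ht

end IsSolution

end SLData

/-! ### Common refinements of time partitions -/

/-- `σ` refines `τ`: every interval between consecutive times of `σ` lies in one of `τ`. -/
def Refines (σ τ : ℕ → ℝ) : Prop := ∀ n, ∃ i, τ i ≤ σ n ∧ σ (n + 1) ≤ τ (i + 1)

lemma Refines.trans {σ τ ρ : ℕ → ℝ} (h : Refines σ τ) (h' : Refines τ ρ) : Refines σ ρ := by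
  intro n
  obtain ⟨i, hi⟩ := h n
  obtain ⟨j, hj⟩ := h' i
  exact ⟨j, hj.1.trans hi.1, hi.2.trans hj.2⟩

namespace IsTimes

variable {τ τ' : ℕ → ℝ}

lemma finite_range_inter_Iio (hτ : IsTimes τ) (b : ℝ) : (range τ ∩ Iio b).Finite := by
  obtain ⟨N, hN⟩ := (hτ.2.2.eventually_ge_atTop b).exists
  refine ((finite_Iio N).image τ).subset ?_
  rintro _ ⟨⟨i, rfl⟩, hi⟩
  exact ⟨i, hτ.1.lt_iff_lt.1 (lt_of_lt_of_le hi hN), rfl⟩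

lemma exists_next (hτ : IsTimes τ) (hτ' : IsTimes τ') {x : ℝ} (hx : 0 ≤ x) :
    ∃ y, x < y ∧ y ∈ range τ ∪ range τ' ∧ (∃ i, τ i ≤ x ∧ y ≤ τ (i + 1)) ∧
      ∃ j, τ' j ≤ x ∧ y ≤ τ' (j + 1) := by
  obtain ⟨i, hi⟩ := hτ.exists_mem_Ico hx
  obtain ⟨j, hj⟩ := hτ'.exists_mem_Ico hx
  refine ⟨min (τ (i + 1)) (τ' (j + 1)), lt_min hi.2 hj.2, ?_, ⟨i, hi.1, min_le_left _ _⟩,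
    ⟨j, hj.1, min_le_right _ _⟩⟩
  exact (min_choice (τ (i + 1)) (τ' (j + 1))).imp (fun h => ⟨_, h.symm⟩) fun h => ⟨_, h.symm⟩

lemma of_strictMono_of_mem (hτ : IsTimes τ) (hτ' : IsTimes τ') {σ : ℕ → ℝ} (hσ : StrictMono σ)
    (h0 : σ 0 = 0) (hmem : ∀ n, σ n ∈ range τ ∪ range τ') : IsTimes σ := by
  refine ⟨hσ, h0, tendsto_atTop_atTop_of_monotone hσ.monotone fun b => ?_⟩
  by_contra! hb
  refine infinite_range_of_injective hσ.injective
    (((hτ.finite_range_inter_Iio b).union (hτ'.finite_range_inter_Iio b)).subset ?_)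
  rintro _ ⟨n, rfl⟩
  exact (hmem n).imp (fun h => ⟨h, hb n⟩) fun h => ⟨h, hb n⟩

lemma exists_common_refinement (hτ : IsTimes τ) (hτ' : IsTimes τ') :
    ∃ σ, IsTimes σ ∧ Refines σ τ ∧ Refines σ τ' := by
  choose! next hlt hmem h₁ h₂ using fun x (hx : 0 ≤ x) => hτ.exists_next hτ' hx
  let σ : ℕ → ℝ := fun n => next^[n] 0
  have hsucc (n : ℕ) : σ (n + 1) = next (σ n) := Function.iterate_succ_apply' next n 0
  have hnonneg (n : ℕ) : 0 ≤ σ n := by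
    induction n with
    | zero => exact le_rfl
    | succ n ih => exact hsucc n ▸ ih.trans (hlt _ ih).le
  have hmono : StrictMono σ := strictMono_nat_of_lt_succ fun n => hsucc n ▸ hlt _ (hnonneg n)
  refine ⟨σ, hτ.of_strictMono_of_mem hτ' hmono rfl fun n => ?_,
    fun n => hsucc n ▸ h₁ _ (hnonneg n), fun n => hsucc n ▸ h₂ _ (hnonneg n)⟩
  cases n with
  | zero => exact Or.inl ⟨0, hτ.2.1⟩
  | succ n => exact hsucc n ▸ hmem _ (hnonneg n)

end IsTimes

lemma tendstoUniformlyOn_left_of_continuousOn {F : ℝ → ℝ → ℝ} {s T t : ℝ}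
    (hF : ContinuousOn (fun z : ℝ × ℝ => F z.1 z.2) (Ioo s T ×ˢ Icc 0 1)) (ht : t ∈ Ioo s T) :
    TendstoUniformlyOn F (F t) (𝓝[<] t) (Icc 0 1) := by
  intro U hU
  obtain ⟨V, hV, h⟩ := isCompact_Icc.mem_uniformity_of_prod hF ht (symm_le_uniformity hU)
  rw [isOpen_Ioo.nhdsWithin_eq ht] at hV
  filter_upwards [mem_nhdsWithin_of_mem_nhds hV] with y hy x hx
  exact h y hy x hx

lemma SLData.GDOn.mono {A : SLData} {f : ℝ → ℝ → ℝ} {s T s' T' : ℝ} (hf : A.GDOn s T f)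
    (hs : s ≤ s') (hlt : s' < T') (hT : T' ≤ T) : A.GDOn s' T' f := by
  obtain ⟨f₁, f₂, a, b, c, c₁, c₂, ha, hb, hc, hmem, hsum, ⟨M, hM⟩, hd, cd, la, lb, lc⟩ := hf
  have hsub : Ioo s' T' ⊆ Ioo s T := Ioo_subset_Ioo hs hT
  have hsub₂ := prod_mono hsub (Subset.refl (Icc (0 : ℝ) 1))
  have hrestrict : ∀ {a b c : ℝ → ℝ}, PC1 a → ContinuousOn b (Icc 0 1) → A.MemDC2 c →
      (∀ x ∈ Icc (0 : ℝ) 1, Tendsto (fun t => f₁ t x) (𝓝[<] T') (𝓝 (a x))) →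
      TendstoUniformlyOn (fun t x => deriv (fun s => f₁ s x) t) b (𝓝[<] T') (Icc 0 1) →
      (∀ x ∈ Icc (0 : ℝ) 1, Tendsto (fun t => f₂ t x) (𝓝[<] T') (𝓝 (c x))) →
      A.GDOn s' T' f := fun ha hb hc la lb lc =>
    ⟨f₁, f₂, _, _, _, c₁.mono hsub₂, c₂.mono hsub₂, ha, hb, hc, fun t ht => hmem t (hsub ht),
      fun t ht => hsum t (hsub ht), ⟨M, fun t ht => hM t (hsub ht)⟩,
      fun t ht => hd t (hsub ht), cd.mono hsub₂, la, lb, lc⟩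
  rcases eq_or_lt_of_le hT with rfl | hT
  · exact hrestrict ha hb hc la lb lc
  have hT' : T' ∈ Ioo s T := ⟨hs.trans_lt hlt, hT⟩
  exact hrestrict (hmem T' hT').1
    (continuousOn_slice (F := fun t x => deriv (fun s => f₁ s x) t) cd hT') (hmem T' hT').2
    (fun x hx => (tendstoUniformlyOn_left_of_continuousOn c₁ hT').tendsto_at hx)
    (tendstoUniformlyOn_left_of_continuousOn (F := fun t x => deriv (fun s => f₁ s x) t) cd hT')
    (fun x hx => (tendstoUniformlyOn_left_of_continuousOn c₂ hT').tendsto_at hx)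

lemma SLData.GDAlong.of_refines {A : SLData} {f : ℝ → ℝ → ℝ} {σ τ : ℕ → ℝ}
    (hf : A.GDAlong τ f) (hσ : IsTimes σ) (h : Refines σ τ) : A.GDAlong σ f := by
  intro n
  obtain ⟨i, hi⟩ := h n
  exact (hf i).mono hi.1 (hσ.lt_succ n) hi.2

lemma exists_left_limits_of_contDiffOn {d : ℝ → ℝ} {s T t : ℝ} (hd : ContDiffOn ℝ 2 d (Ioo s T))
    (ht : t ∈ Ioo s T) :
    (∃ L, Tendsto d (𝓝[<] t) (𝓝 L)) ∧ (∃ L, Tendsto (deriv d) (𝓝[<] t) (𝓝 L)) ∧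
      ∃ L, Tendsto (deriv (deriv d)) (𝓝[<] t) (𝓝 L) := by
  have hd' : ContDiffOn ℝ 1 (deriv d) (Ioo s T) := hd.deriv_of_isOpen isOpen_Ioo (by norm_num)
  have hlim {g : ℝ → ℝ} (hg : ContinuousOn g (Ioo s T)) : ∃ L, Tendsto g (𝓝[<] t) (𝓝 L) :=
    ⟨_, (hg.continuousAt (Ioo_mem_nhds ht.1 ht.2)).tendsto.mono_left nhdsWithin_le_nhds⟩
  exact ⟨hlim hd.continuousOn, hlim hd'.continuousOn,
    hlim (hd'.continuousOn_deriv_of_isOpen isOpen_Ioo le_rfl)⟩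

lemma GBAlong.of_refines {d : ℝ → ℝ} {σ τ : ℕ → ℝ} (hd : GBAlong τ d) (hτ : IsTimes τ)
    (hσ : IsTimes σ) (h : Refines σ τ) : GBAlong σ d := by
  obtain ⟨hright, hC2, hleft, hbound⟩ := hd
  refine ⟨hright, hC2.mono fun t ht => ?_, fun n hn => ?_, fun n => ?_⟩
  · obtain ⟨n, hn⟩ := hσ.exists_mem_Ioo ht
    obtain ⟨i, hi⟩ := h n
    exact hτ.Ioo_subset_offTimes i ⟨hi.1.trans_lt hn.1, hn.2.trans_le hi.2⟩
  · obtain ⟨m, rfl⟩ := Nat.exists_eq_add_of_le' hn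
    obtain ⟨i, hi⟩ := h m
    rcases eq_or_lt_of_le hi.2 with heq | hlt
    · exact heq ▸ hleft (i + 1) (Nat.le_add_left 1 i)
    · exact exists_left_limits_of_contDiffOn (hC2.mono (hτ.Ioo_subset_offTimes i))
        ⟨hi.1.trans_lt (hσ.lt_succ m), hlt⟩
  · obtain ⟨i, hi⟩ := h n
    obtain ⟨M, hM⟩ := hbound i
    exact ⟨M, fun t ht => hM t ⟨hi.1.trans_lt ht.1, ht.2.trans_le hi.2⟩⟩

theorem SLData.exists_admissible {A : SLData} {f : ℝ → ℝ → ℝ} {d₀ d₁ : ℝ → ℝ} (hf : A.GD f)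
    (hd₀ : GB d₀) (hd₁ : GB d₁) : ∃ τ, A.Admissible τ f d₀ d₁ := by
  obtain ⟨τ, hτ, hf⟩ := hf
  obtain ⟨τ₀, hτ₀, hd₀⟩ := hd₀
  obtain ⟨τ₁, hτ₁, hd₁⟩ := hd₁
  obtain ⟨ρ, hρ, hρ₀, hρ₁⟩ := hτ₀.exists_common_refinement hτ₁
  obtain ⟨σ, hσ, hστ, hσρ⟩ := hτ.exists_common_refinement hρ
  exact ⟨σ, hσ, hf.of_refines hσ hστ, hd₀.of_refines hτ₀ hσ (hσρ.trans hρ₀),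
    hd₁.of_refines hτ₁ hσ (hσρ.trans hρ₁)⟩

end SLParabolic

end

theorem theorem2p2_general (A : SLParabolic.SLData) (hH : A.AssumptionH) {τ : ℕ → ℝ}
    (hτ : SLParabolic.IsTimes τ) {f : ℝ → ℝ → ℝ} {d₀ d₁ : ℝ → ℝ}
    (hf : ∀ i, A.SourceOn (τ i) (τ (i + 1)) f)
    (hd₀ : ∀ i, SLParabolic.BoundaryOn (τ i) (τ (i + 1)) d₀)
    (hd₁ : ∀ i, SLParabolic.BoundaryOn (τ i) (τ (i + 1)) d₁)
    {u₀ : ℝ → ℝ} (hu₀ : MemLp u₀ 2 A.wt) :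
    ∃ u : ℝ → ℝ → ℝ, A.IsSolution τ f d₀ d₁ u₀ u ∧
      ∀ v : ℝ → ℝ → ℝ, A.IsSolution τ f d₀ d₁ u₀ v →
        ∀ t, 0 ≤ t → ∀ x ∈ Icc (0 : ℝ) 1, v t x = u t x := by
  obtain ⟨S⟩ := SLParabolic.SLData.nonempty_spectral hH
  obtain ⟨u, hu⟩ := S.exists_isSolution hτ hf hd₀ hd₁ hu₀
  exact ⟨u, hu, fun v hv t ht => hu.eqOn S hτ hv ht⟩

theorem theorem2p2 (A : SLParabolic.SLData) (hH : A.AssumptionH)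
    (f : ℝ → ℝ → ℝ) (d₀ d₁ : ℝ → ℝ) (hf : A.GD f) (hd₀ : SLParabolic.GB d₀) (hd₁ : SLParabolic.GB d₁) :
    (∃ τ : ℕ → ℝ, A.Admissible τ f d₀ d₁) ∧
    ∀ τ : ℕ → ℝ, A.Admissible τ f d₀ d₁ →
      ∀ u₀ : ℝ → ℝ, MemLp u₀ 2 A.wt →
        ∃ u : ℝ → ℝ → ℝ, A.IsSolution τ f d₀ d₁ u₀ u ∧
          ∀ v : ℝ → ℝ → ℝ, A.IsSolution τ f d₀ d₁ u₀ v →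
            ∀ t, 0 ≤ t → ∀ x ∈ Icc (0 : ℝ) 1, v t x = u t x := by
  obtain ⟨G⟩ := A.nonempty_green
  exact ⟨SLParabolic.SLData.exists_admissible hf hd₀ hd₁, fun τ ⟨hτ, hf, hd₀, hd₁⟩ _ hu₀ =>
    theorem2p2_general A hH hτ (fun i => (hf i).sourceOn G (hτ.lt_succ i))
      (hd₀.boundaryOn hτ) (hd₁.boundaryOn hτ) hu₀⟩
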